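/- Fix $c\ge 0$. Let $\mathrm{Vir}_c$ be the Virasoro algebra, $[L_m,L_n]=(m-n)L_{m+n}+\frac{c}{12}(m^3-m)\delta_{m+n,0}\mathbf 1$, and let $W$ be a unitary positive energy representation of it: $\mathbf 1$ acts as the identity, $W$ carries an inner product with $\langle L_nv,w\rangle=\langle v,L_{-n}w\rangle$, and $W$ is the algebraic direct sum of the eigenspaces of $L_0$, which are finite dimensional, the spectrum of $L_0$ being discrete and bounded below. Let $\mathcal H=\mathcal H_0$ be the Hilbert space completion of $W$, and let $\mathcal H_1$ be the domain of the closed operator $1+L_0$ with the norm $\|(1+L_0)v\|$. A smooth vector field $f(\theta)\partial_\theta$ on $S^1$ acts by the closed operator $\pi(f)$ that is the closure of $\sum_n i\hat f(n)L_n$ on $W$, where $\hat f(n)$ are the Fourier coefficients of $f$ (so $L_n$ corresponds to $z^{n+1}\partial_z$, $z=e^{i\theta}$). The Virasoro cocycle is $\omega(F\partial_z,G\partial_z)=\frac c{12}\int_{S^1}\frac{\partial^3F}{\partial z^3}\,G\,\frac{dz}{2\pi i}$; for functions $f,g$ of $\theta$, $\omega(f,g)$ means $\omega(f\partial_\theta,g\partial_\theta)$,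 where $f\partial_\theta=izf\,\partial_z$. Let $X\in\mathcal P^{in}$, i.e. $X:S^1\times[0,1]\to\mathbb C$ is smooth with $\mathrm{Im}\,X\ge 0$, regarded as the smooth path $t\mapsto X(t)=X(\cdot,t)\partial_\theta$ of inward pointing vector fields. Then the time-ordered exponential $$U(t,s)=\prod_{t\ge\tau\ge s}\mathrm{Exp}\big(\pi(X(\tau))\,d\tau\big)\in\mathcal B(\mathcal H),\qquad 0\le s\le t\le 1,$$ exists and is unique, that is, there is exactly one family of bounded operators such that $U(s,s)=1$; $U(t,r)U(r,s)=U(t,s)$ for $s\le r\le t$; $(t,s)\mapsto U(t,s)v$ is continuous into $\mathcal H$ for $v\in\mathcal H$; $\|U(t,s)\|\le e^{a(t-s)}$ for some constant $a\ge0$; and, for $v\in\mathcal H_1$, one has $\partial_tU(t,s)v=\pi(X(t))U(t,s)v$ and $\partial_sU(t,s)v=-U(t,s)\pi(X(s))v$ in the norm of $\mathcal H$ (one-sided derivatives where required), $U(t,s)v\in\mathcal H_1$, and $(t,s)\mapsto U(t,s)v$ is continuous into $\mathcal H_1$. The operator $T=U(1,0)$ satisfies the Segal commutation relations for $X$: for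 every smooth $f:S^1\times[0,1]\to\mathbb C$ with $f_t=X_\theta f-Xf_\theta$, writing $f(t)=f(\cdot,t)\partial_\theta$, $$T\,\pi(f(0))=\pi(f(1))\,T+\Big(\int_0^1\omega(X(\tau),f(\tau))\,d\tau\Big)\,T$$ as operators $\mathcal H_1\to\mathcal H_0$ (in particular, both sides are defined on all of $\mathcal H_1$). -/

import Mathlib

open scoped ContDiff

noncomputable section

namespace SegalVirasoro

/-! ### Vector fields on the circle

A complexified vector field `f(θ) ∂_θ` on the unit circle is given by its coefficient `f : ℝ → ℂ`,
a `2π`-periodic function of the angle `θ` (with `z = exp (i θ)`). -/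

/-- Smooth complex functions on the cylinder `[0,1] × S¹`, written `F t θ`, smooth up to the boundary
circles `t = 0` and `t = 1`.  Equivalently, smooth paths `[0,1] → C^∞(S¹, ℂ)`. -/
structure IsSmoothCylinderFun (F : ℝ → ℝ → ℂ) : Prop where
  smooth : ContDiffOn ℝ ∞ (fun p : ℝ × ℝ => F p.1 p.2) (Set.Icc 0 1 ×ˢ Set.univ)
  periodic : ∀ t ∈ Set.Icc (0 : ℝ) 1, Function.Periodic (F t) (2 * Real.pi)

/-- Smooth paths `t ↦ X t (θ) ∂_θ`, `t ∈ [0,1]`, in the cone of inward pointing vector fields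
(`Im f ≥ 0`). -/
structure IsInwardPath (X : ℝ → ℝ → ℂ) : Prop extends IsSmoothCylinderFun X where
  inward : ∀ t ∈ Set.Icc (0 : ℝ) 1, ∀ θ : ℝ, 0 ≤ (X t θ).im

/-- The coefficient `F` of `f ∂_θ = F ∂_z`, as a function of `θ`:  since `∂_θ = i z ∂_z`, it is
`i z f`. -/
def zCoeff (f : ℝ → ℂ) (θ : ℝ) : ℂ :=
  Complex.I * Complex.exp (Complex.I * θ) * f θ

/-- The derivative `∂F/∂z = (i z)⁻¹ ∂F/∂θ` of a function on the circle. -/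
def zDeriv (F : ℝ → ℂ) (θ : ℝ) : ℂ :=
  (Complex.I * Complex.exp (Complex.I * θ))⁻¹ * deriv F θ

/-- The Virasoro cocycle `ω (F ∂_z, G ∂_z) = c/12 ∫_{S¹} (∂³F/∂z³) G dz/(2πi)`, evaluated on the
vector fields `f ∂_θ` and `g ∂_θ`; here `dz = i z dθ`. -/
def virasoroCocycle (c : ℝ) (f g : ℝ → ℂ) : ℂ :=
  (c / 12 : ℂ) * ((2 * Real.pi * Complex.I)⁻¹ *
    ∫ θ in (0 : ℝ)..(2 * Real.pi),
      zDeriv (zDeriv (zDeriv (zCoeff f))) θ * zCoeff g θ *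
        (Complex.I * Complex.exp (Complex.I * θ)))

/-- The equation `f_t = X_θ f - X f_θ` on `[0,1] × S¹`. -/
def SolvesHoloEquation (X f : ℝ → ℝ → ℂ) : Prop :=
  ∀ t ∈ Set.Icc (0 : ℝ) 1, ∀ θ : ℝ,
    derivWithin (fun τ => f τ θ) (Set.Icc 0 1) t =
      deriv (X t) θ * f t θ - X t θ * deriv (f t) θ

/-! ### Time-ordered exponentials -/

section Evolution

variable {H : Type*} [NormedAddCommGroup H] [NormedSpace ℂ H]

/-- The parameters `(t, s)` with `0 ≤ s ≤ t ≤ 1`. -/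
def triangle : Set (ℝ × ℝ) := {p | 0 ≤ p.2 ∧ p.2 ≤ p.1 ∧ p.1 ≤ 1}

/-- Evolution systems `U t s`, `0 ≤ s ≤ t ≤ 1`; values outside this range are irrelevant. -/
structure IsEvolutionSystem (U : ℝ → ℝ → H →L[ℂ] H) : Prop where
  self : ∀ s ∈ Set.Icc (0 : ℝ) 1, U s s = ContinuousLinearMap.id ℂ H
  comp : ∀ s r t : ℝ, 0 ≤ s → s ≤ r → r ≤ t → t ≤ 1 → U t r ∘L U r s = U t s
  continuous : ∀ x : H, ContinuousOn (fun p : ℝ × ℝ => U p.1 p.2 x) triangle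

/-- `U t s = ∏_{t ≥ τ ≥ s} Exp (A τ dτ)`: `U` is the evolution system on `H` generated by the
unbounded operators `A t`, with respect to the dense subspace `Y = D(Q)`, normed by `‖Q v‖`.
A statement `(x, y) ∈ (A t).graph` says that `x` lies in the domain of `A t` and `y = A t x`. -/
structure IsTimeOrderedExp (A : ℝ → H →ₗ.[ℂ] H) (Q : H →ₗ.[ℂ] H)
    (U : ℝ → ℝ → H →L[ℂ] H) : Prop extends IsEvolutionSystem U where
  /-- `‖U(t,s)‖ ≤ e^{a(t-s)}` for a constant `a ≥ 0` -/
  norm_le : ∃ a : ℝ, 0 ≤ a ∧ ∀ s t : ℝ, 0 ≤ s → s ≤ t → t ≤ 1 →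
    ‖U t s‖ ≤ Real.exp (a * (t - s))
  /-- `∂_t U(t,s) v = A(t) U(t,s) v` for `v ∈ Y`, in the norm of `H` -/
  deriv_left : ∀ v ∈ Q.domain, ∀ s t : ℝ, 0 ≤ s → s ≤ t → t ≤ 1 →
    ∃ y : H, (U t s v, y) ∈ (A t).graph ∧
      HasDerivWithinAt (fun τ => U τ s v) y (Set.Icc s 1) t
  /-- `∂_s U(t,s) v = - U(t,s) A(s) v` for `v ∈ Y`, in the norm of `H` -/
  deriv_right : ∀ v ∈ Q.domain, ∀ s t : ℝ, 0 ≤ s → s ≤ t → t ≤ 1 →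
    ∃ y : H, (v, y) ∈ (A s).graph ∧
      HasDerivWithinAt (fun σ => U t σ v) (-(U t s y)) (Set.Icc 0 t) s
  /-- `U(t,s) Y ⊆ Y` -/
  mapsTo : ∀ v ∈ Q.domain, ∀ s t : ℝ, 0 ≤ s → s ≤ t → t ≤ 1 → U t s v ∈ Q.domain
  /-- `(t,s) ↦ U(t,s) v` is continuous into `Y` for `v ∈ Y` -/
  continuous_dom : ∀ v ∈ Q.domain, ∃ g : ℝ × ℝ → H, ContinuousOn g triangle ∧
    ∀ p ∈ triangle, (U p.1 p.2 v, g p) ∈ Q.graph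

end Evolution

/-! ### Unitary positive energy representations of the Virasoro algebra -/

/-- A unitary positive energy representation of `Vir_c` on `W`, together with the Hilbert space
completion `H` of `W` (a Hilbert space containing `W` as a dense subspace).  The central element `1`
acts as the identity; `W` is the algebraic direct sum of the eigenspaces of `L₀`, which are finite
dimensional; the spectrum of `L₀` is discrete and bounded below. -/
structure PosEnergyRep (c : ℝ) (H : Type*) [NormedAddCommGroup H] [InnerProductSpace ℂ H] where
  /-- the finite energy vectors -/
  W : Submodule ℂ H
  dense : Dense (W : Set H)
  /-- the action of the basis elements `L_n` -/
  L : ℤ → W →ₗ[ℂ] W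
  commutator : ∀ (m n : ℤ) (v : W),
    L m (L n v) - L n (L m v) = ((m : ℂ) - (n : ℂ)) • L (m + n) v +
      (if m + n = 0 then (c / 12 : ℂ) * ((m : ℂ) ^ 3 - (m : ℂ)) else 0) • v
  unitary : ∀ (n : ℤ) (v w : W), inner ℂ (L n v) w = inner ℂ v (L (-n) w)
  iSup_eigenspace : ⨆ μ : ℝ, Module.End.eigenspace (L 0) (μ : ℂ) = ⊤
  finite_eigenspace : ∀ μ : ℝ, FiniteDimensional ℂ (Module.End.eigenspace (L 0) (μ : ℂ))
  bddBelow : BddBelow {μ : ℝ | Module.End.HasEigenvalue (L 0) (μ : ℂ)}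
  discrete : ∀ E : ℝ, {μ : ℝ | Module.End.HasEigenvalue (L 0) (μ : ℂ) ∧ μ ≤ E}.Finite

namespace PosEnergyRep

variable {c : ℝ} {H : Type*} [NormedAddCommGroup H] [InnerProductSpace ℂ H]
  (ρ : PosEnergyRep c H)

/-- The `n`-th term of `f ∂_θ = ∑ i f̂(n) L_n` (recall `L_n = z^{n+1} ∂_z = -i e^{inθ} ∂_θ`) applied
to a finite energy vector, `f̂` denoting Fourier coefficients. -/
def term (f : ℝ → ℂ) (v : ρ.W) (n : ℤ) : H :=
  (Complex.I * fourierCoeffOn Real.two_pi_pos f n) • (ρ.L n v : H)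

theorem term_zero (f : ℝ → ℂ) (n : ℤ) : ρ.term f 0 n = 0 := by
  simp only [term, map_zero, Submodule.coe_zero, smul_zero]

theorem term_add (f : ℝ → ℂ) (v w : ρ.W) (n : ℤ) :
    ρ.term f (v + w) n = ρ.term f v n + ρ.term f w n := by
  simp only [term, map_add, Submodule.coe_add, smul_add]

theorem term_smul (f : ℝ → ℂ) (a : ℂ) (v : ρ.W) (n : ℤ) :
    ρ.term f (a • v) n = a • ρ.term f v n := by
  simp only [term, map_smul, Submodule.coe_smul]
  rw [smul_comm]

/-- The finite energy vectors `v` for which `∑ i f̂(n) L_n v` converges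
(for smooth `f` these are all vectors of `W`). -/
def summableVectors (f : ℝ → ℂ) : Submodule ℂ H where
  carrier := {x | ∃ hx : x ∈ ρ.W, Summable (ρ.term f ⟨x, hx⟩)}
  zero_mem' := ⟨ρ.W.zero_mem, by
    refine summable_zero.congr fun n => ?_
    exact (ρ.term_zero f n).symm⟩
  add_mem' := by
    rintro x y ⟨hx, sx⟩ ⟨hy, sy⟩
    exact ⟨ρ.W.add_mem hx hy, (sx.add sy).congr fun n => (ρ.term_add f ⟨x, hx⟩ ⟨y, hy⟩ n).symm⟩
  smul_mem' := by
    rintro a x ⟨hx, sx⟩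
    exact ⟨ρ.W.smul_mem a hx, (sx.const_smul a).congr fun n => (ρ.term_smul f a ⟨x, hx⟩ n).symm⟩

/-- The operator `v ↦ ∑ i f̂(n) L_n v` on the finite energy vectors. -/
def preSmeared (f : ℝ → ℂ) : H →ₗ.[ℂ] H where
  domain := ρ.summableVectors f
  toFun :=
    { toFun := fun x => ∑' n : ℤ, ρ.term f ⟨x.1, x.2.1⟩ n
      map_add' := by
        rintro ⟨x, hx, sx⟩ ⟨y, hy, sy⟩
        rw [← sx.tsum_add sy]
        exact tsum_congr fun n => ρ.term_add f ⟨x, hx⟩ ⟨y, hy⟩ n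
      map_smul' := by
        rintro a ⟨x, hx, sx⟩
        rw [RingHom.id_apply, ← sx.tsum_const_smul a]
        exact tsum_congr fun n => ρ.term_smul f a ⟨x, hx⟩ n }

/-- The closed unbounded operator `π(f ∂_θ)` on `H`: the closure of its restriction to `W`. -/
def smeared (f : ℝ → ℂ) : H →ₗ.[ℂ] H := (ρ.preSmeared f).closure

/-- The closed operator `L₀` on `H`: the closure of `L₀` on `W`. -/
def closedL0 : H →ₗ.[ℂ] H :=
  LinearPMap.closure ⟨ρ.W, ρ.W.subtype ∘ₗ ρ.L 0⟩

/-- The operator `1 + L₀`.  Its domain is the space `H₁`, with the norm `‖(1 + L₀) x‖`. -/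
def oneAddL0 : H →ₗ.[ℂ] H where
  domain := ρ.closedL0.domain
  toFun := ρ.closedL0.domain.subtype + ρ.closedL0.toFun

/-- `U t s = ∏_{t ≥ τ ≥ s} Exp (π(X τ) dτ)`, the time-ordered exponential of the operators `π(X τ)`
with respect to the pair of Hilbert spaces `H ⊇ H₁`. -/
def IsTimeOrderedExpOf (X : ℝ → ℝ → ℂ) (U : ℝ → ℝ → H →L[ℂ] H) : Prop :=
  IsTimeOrderedExp (fun t => ρ.smeared (X t)) ρ.oneAddL0 U

/-- The Segal commutation relations for `X`:
`T π(f(0)) = π(f(1)) T + (∫₀¹ ω(X(τ), f(τ)) dτ) T` on `H₁`, for every `f` on `S¹ × [0,1]` with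
`f_t = X_θ f - X f_θ`.  For `ξ ∈ H₁`, `y = π(f(0)) ξ` and `z = π(f(1)) T ξ` must be defined. -/
def SegalCommutationRelations (X : ℝ → ℝ → ℂ) (T : H →L[ℂ] H) : Prop :=
  ∀ f : ℝ → ℝ → ℂ, IsSmoothCylinderFun f → SolvesHoloEquation X f →
    ∀ ξ ∈ ρ.oneAddL0.domain, ∃ y z : H,
      (ξ, y) ∈ (ρ.smeared (f 0)).graph ∧ (T ξ, z) ∈ (ρ.smeared (f 1)).graph ∧
      T y = z + (∫ τ in (0 : ℝ)..1, virasoroCocycle c (X τ) (f τ)) • T ξ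

end PosEnergyRep

end SegalVirasoro

end

/-! Write `D = 1 + L₀`. The linear evolution equation with generators `π(X(t))` is solvable in the
pair `H₁ ⊂ H` because of three facts. The generators are bounded from `H₁` to `H`, continuously in
`t`: `‖L_n ξ‖ ≤ (1 + c)(1 + |n|)² ‖D ξ‖` (`norm_L_le`), while Fourier coefficients of smooth
functions decay rapidly. Commutation with `D` stays within the class: `[D, π(f)] = π(i f')`. And
inward pointing fields are quasi-dissipative: `Re ⟨π(X) ξ, ξ⟩ ≤ ν ‖ξ‖²` (`re_inner_op_le`).

Given these facts, replace `A = π(X)` by the bounded operators `J_n A J_n`, where `J_n = (1 +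
D/(n+1))⁻¹`. Their propagators obey `‖U_n(t,s)‖ ≤ e^{ν(t-s)}` uniformly in `n`, and Duhamel's
formula makes them Cauchy on the range of `D⁻²`, hence strongly convergent everywhere. Conjugation
by `D` changes `A` only by the bounded operator `[D, A] D⁻¹`, so the same construction gives an
evolution `V` with `U D⁻¹ = D⁻¹ V`; this yields the invariance of `H₁` and continuity in its norm.
Uniqueness and the Segal relations come from differentiating products such as `r ↦ U(1,r) π(f(r))
U(r,0) ξ`.

The deep point is dissipativity. Real fields act skew-symmetrically. For the imaginary part, `-∑
v̂(n) L_n` must be bounded above when `v ≥ 0`. If `v > 0`, a change of coordinate on the circle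
turns `v ∂_θ` into a constant field. It is implemented by the evolution of a real path, which is
isometric; skewness alone provides the dissipativity needed there, so nothing is circular. The Segal
relations for that path carry `π(v)` to a positive multiple of `i L₀` plus a scalar. The energy `L₀`
is nonnegative, and the scalar is a Schwarzian-type integral controlled by `v'² ≤ 4 M v`, with no
lower bound on `v`. Hence `v ≥ 0` follows by adding `ε` (`re_inner_op_I_mul_le`). -/

noncomputable section

namespace SegalVirasoro

open Set Filter Topology

set_option linter.unusedSectionVars false

/-! ### Linear differential equations in Banach spaces -/

section LinearODE

variable {E : Type*} [NormedAddCommGroup E] [NormedSpace ℝ E] [CompleteSpace E]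

/-- The terms of the Dyson series of `u' = A u`, `u 0 = u₀`. -/
def dyson (A : ℝ → E →L[ℝ] E) (u₀ : E) : ℕ → ℝ → E
  | 0 => fun _ => u₀
  | k + 1 => fun t => ∫ τ in (0 : ℝ)..t, A τ (dyson A u₀ k τ)

theorem continuous_dyson {A : ℝ → E →L[ℝ] E} (hA : Continuous A) (u₀ : E) (k : ℕ) :
    Continuous (dyson A u₀ k) := by
  induction k with
  | zero => exact continuous_const
  | succ k ih =>
    exact intervalIntegral.continuous_primitive
      (fun a b => (hA.clm_apply ih).intervalIntegrable a b) 0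

theorem hasDerivAt_dyson_succ {A : ℝ → E →L[ℝ] E} (hA : Continuous A) (u₀ : E) (k : ℕ) (t : ℝ) :
    HasDerivAt (dyson A u₀ (k + 1)) (A t (dyson A u₀ k t)) t :=
  intervalIntegral.integral_hasDerivAt_right
    ((hA.clm_apply (continuous_dyson hA u₀ k)).intervalIntegrable _ _)
    (hA.clm_apply (continuous_dyson hA u₀ k)).aestronglyMeasurable.stronglyMeasurableAtFilter
    (hA.clm_apply (continuous_dyson hA u₀ k)).continuousAt

theorem norm_dyson_le {A : ℝ → E →L[ℝ] E} {K : ℝ} (hK : ∀ t, ‖A t‖ ≤ K)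
    (u₀ : E) (k : ℕ) (t : ℝ) : ‖dyson A u₀ k t‖ ≤ (K * |t|) ^ k / k.factorial * ‖u₀‖ := by
  have hK0 : 0 ≤ K := (norm_nonneg _).trans (hK 0)
  induction k generalizing t with
  | zero => simp [dyson]
  | succ k ih =>
    have h1 : ∀ τ, ‖A τ (dyson A u₀ k τ)‖ ≤
        K ^ (k + 1) / k.factorial * ‖u₀‖ * |τ - 0| ^ k := by
      intro τ
      calc ‖A τ (dyson A u₀ k τ)‖ ≤ K * ((K * |τ|) ^ k / k.factorial * ‖u₀‖) :=
            (A τ).le_of_opNorm_le_of_le (hK τ) (ih τ)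
        _ = _ := by rw [sub_zero, mul_pow]; ring
    calc ‖dyson A u₀ (k + 1) t‖
        ≤ ∫ τ in Set.uIoc 0 t, K ^ (k + 1) / k.factorial * ‖u₀‖ * |τ - 0| ^ k := by
          rw [dyson, intervalIntegral.norm_intervalIntegral_eq]
          refine MeasureTheory.norm_integral_le_of_norm_le ?_ (Eventually.of_forall h1)
          exact (Continuous.integrableOn_uIoc (by fun_prop))
      _ = _ := by
          rw [MeasureTheory.integral_const_mul, integral_pow_abs_sub_uIoc, sub_zero,
            Nat.factorial_succ, mul_pow]
          push_cast
          field_simp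

/-- The Dyson series may be differentiated term by term: on each ball in `t` it is dominated by an
exponential series, and the derivative of term `k + 1` is `A` applied to term `k`. -/
theorem exists_linearODE_solution {A : ℝ → E →L[ℝ] E} (hA : Continuous A) {K : ℝ}
    (hK : ∀ t, ‖A t‖ ≤ K) (u₀ : E) :
    ∃ u : ℝ → E, u 0 = u₀ ∧ ∀ t, HasDerivAt u (A t (u t)) t := by
  have hK0 : 0 ≤ K := (norm_nonneg _).trans (hK 0)
  have hsum : ∀ r : ℝ, Summable fun k : ℕ => (K * r) ^ k / k.factorial * ‖u₀‖ := fun r =>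
    (Real.summable_pow_div_factorial _).mul_right _
  have hs : ∀ t, Summable fun k => dyson A u₀ k t := fun t =>
    .of_norm_bounded (hsum |t|) fun k => norm_dyson_le hK u₀ k t
  refine ⟨fun t => u₀ + ∑' k, dyson A u₀ (k + 1) t, ?_, fun t => ?_⟩
  · have : ∀ k, dyson A u₀ (k + 1) 0 = 0 := fun k => by simp [dyson]
    simp [this]
  · have key : HasDerivAt (fun t => ∑' k, dyson A u₀ (k + 1) t)
        (∑' k, A t (dyson A u₀ k t)) t := by
      have ht : t ∈ Metric.ball (0 : ℝ) (|t| + 1) := by simp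
      refine hasDerivAt_tsum_of_isPreconnected
        (g := fun k => dyson A u₀ (k + 1)) (g' := fun k t => A t (dyson A u₀ k t))
        ((hsum (|t| + 1)).mul_left K) Metric.isOpen_ball (convex_ball _ _).isPreconnected
        (fun k y _ => hasDerivAt_dyson_succ hA u₀ k y) (fun k y hy => ?_) ht
        ((summable_nat_add_iff 1).2 (hs t)) ht
      · refine (A y).le_of_opNorm_le_of_le (hK y) ((norm_dyson_le hK u₀ k y).trans ?_)
        have : |y| ≤ |t| + 1 := by simpa using (mem_ball_zero_iff.1 hy).le
        gcongr
    convert key.const_add u₀ using 1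
    rw [← (A t).map_tsum (hs t), (hs t).tsum_eq_zero_add]
    rfl

/-- The linear equation has unique solutions. -/
theorem linearODE_unique {A : ℝ → E →L[ℝ] E} {K : ℝ} (hK : ∀ t, ‖A t‖ ≤ K) {u v : ℝ → E}
    (hu : ∀ t, HasDerivAt u (A t (u t)) t) (hv : ∀ t, HasDerivAt v (A t (v t)) t)
    (h0 : u 0 = v 0) : u = v := by
  refine ODE_solution_unique_univ (v := fun t x => A t x) (s := fun _ => univ) (t₀ := 0)
    (K := K.toNNReal) (fun t => ?_) (fun t => ⟨hu t, trivial⟩) (fun t => ⟨hv t, trivial⟩) h0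
  refine ((A t).lipschitz.weaken ?_).lipschitzOnWith
  exact NNReal.le_toNNReal_of_coe_le (by simpa using hK t)

end LinearODE

/-! ### Propagators of bounded time-dependent generators. -/

section Propagator

variable {B : Type*} [NormedRing B] [NormedAlgebra ℝ B] [CompleteSpace B]

/-- `U` is the propagator of the linear equation `u' = A u`. -/
structure IsPropagator (A : ℝ → B) (U : ℝ → ℝ → B) : Prop where
  self : ∀ s, U s s = 1
  comp : ∀ t r s, U t r * U r s = U t s
  left : ∀ t s, HasDerivAt (fun t => U t s) (A t * U t s) t
  right : ∀ t s, HasDerivAt (fun s => U t s) (-(U t s * A s)) s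
  cont : Continuous fun p : ℝ × ℝ => U p.1 p.2

/-- The solutions of `Φ' = A Φ` and `Ψ' = -Ψ A` starting at `1` are mutually inverse, and `Φ(t)
Ψ(s)` is the propagator. -/
theorem exists_isPropagator {A : ℝ → B} (hA : Continuous A) {K : ℝ} (hK : ∀ t, ‖A t‖ ≤ K) :
    ∃ U, IsPropagator A U := by
  obtain ⟨Φ, h0, hΦ⟩ := exists_linearODE_solution (A := fun t => ContinuousLinearMap.mul ℝ B (A t))
    (by fun_prop) (K := K)
    (fun t => (ContinuousLinearMap.opNorm_mul_apply_le ℝ B (A t)).trans (hK t)) (1 : B)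
  obtain ⟨Ψ, h0', hΨ⟩ := exists_linearODE_solution
    (A := fun t => (ContinuousLinearMap.mul ℝ B).flip (-A t)) (by fun_prop) (K := K)
    (fun t => by
      refine ContinuousLinearMap.opNorm_le_bound _ ((norm_nonneg _).trans (hK t)) fun x => ?_
      simp only [ContinuousLinearMap.flip_apply, ContinuousLinearMap.mul_apply', mul_neg, norm_neg]
      refine (norm_mul_le _ _).trans ?_
      rw [mul_comm]
      exact mul_le_mul_of_nonneg_right (hK t) (norm_nonneg _)) (1 : B)
  simp only [ContinuousLinearMap.mul_apply', ContinuousLinearMap.flip_apply] at hΦ hΨ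
  have hΨΦ : ∀ t, Ψ t * Φ t = 1 := by
    have hd : ∀ t, HasDerivAt (fun t => Ψ t * Φ t) 0 t := fun t => by
      convert (hΨ t).fun_mul (hΦ t) using 1
      noncomm_ring
    intro t
    rw [is_const_of_deriv_eq_zero (fun t => (hd t).differentiableAt) (fun t => (hd t).deriv) t 0,
      h0, h0', mul_one]
  -- A left inverse need not be a right inverse here. Both `Φ Ψ` and the constant `1` solve `Y' = A
  -- Y - Y A`, so uniqueness identifies them.
  have hΦΨ : ∀ t, Φ t * Ψ t = 1 := by
    have := linearODE_unique (u := fun t => Φ t * Ψ t) (v := fun _ => 1) (K := K + K)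
      (A := fun t => ContinuousLinearMap.mul ℝ B (A t) - (ContinuousLinearMap.mul ℝ B).flip (A t))
      (fun t => ?_) (fun t => ?_) (fun t => ?_) ?_
    · exact fun t => congrFun this t
    · refine (norm_sub_le _ _).trans (add_le_add
        ((ContinuousLinearMap.opNorm_mul_apply_le ℝ B (A t)).trans (hK t)) ?_)
      refine ContinuousLinearMap.opNorm_le_bound _ ((norm_nonneg _).trans (hK t)) fun x => ?_
      simp only [ContinuousLinearMap.flip_apply, ContinuousLinearMap.mul_apply']
      refine (norm_mul_le _ _).trans ?_
      rw [mul_comm]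
      exact mul_le_mul_of_nonneg_right (hK t) (norm_nonneg _)
    · refine ((hΦ t).fun_mul (hΨ t)).congr_deriv ?_
      simp only [sub_apply, ContinuousLinearMap.mul_apply',
        ContinuousLinearMap.flip_apply]
      noncomm_ring
    · convert hasDerivAt_const t (1 : B) using 1
      simp
    · simp [h0, h0']
  refine ⟨fun t s => Φ t * Ψ s, ⟨hΦΨ, fun t r s => ?_, fun t s => ?_, fun t s => ?_, ?_⟩⟩
  · rw [mul_assoc, ← mul_assoc (Ψ r), hΨΦ, one_mul]
  · rw [← mul_assoc]
    exact (hΦ t).mul_const _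
  · convert (hΨ s).const_mul (Φ t) using 1
    noncomm_ring
  · have h1 : Continuous Φ := continuous_iff_continuousAt.2 fun t => (hΦ t).continuousAt
    have h2 : Continuous Ψ := continuous_iff_continuousAt.2 fun t => (hΨ t).continuousAt
    fun_prop

/-- The difference of two propagators. -/
theorem IsPropagator.hasDerivAt_mul {A A' : ℝ → B} {U U' : ℝ → ℝ → B} (hU : IsPropagator A U)
    (hU' : IsPropagator A' U') (C : B) (t r s : ℝ) :
    HasDerivAt (fun r => U t r * C * U' r s) (U t r * (C * A' r - A r * C) * U' r s) r := by
  convert (((hU.right t r).mul_const C).fun_mul (hU'.left r s)) using 1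
  noncomm_ring

/-- Propagators of intertwined generators are intertwined. -/
theorem IsPropagator.intertwine {A A' : ℝ → B} {U U' : ℝ → ℝ → B} (hU : IsPropagator A U)
    (hU' : IsPropagator A' U') {R : B} (h : ∀ t, A t * R = R * A' t) (t s : ℝ) :
    U t s * R = R * U' t s := by
  have hd : ∀ r, HasDerivAt (fun r => U t r * R * U' r s) 0 r := fun r => by
    convert hU.hasDerivAt_mul hU' R t r s using 1
    rw [h, sub_self, mul_zero, zero_mul]
  have := is_const_of_deriv_eq_zero (fun t => (hd t).differentiableAt) (fun t => (hd t).deriv) s t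
  simpa [hU.self, hU'.self] using this

end Propagator

/-! ### Evolution equations in a scale of Hilbert spaces

`R` plays the role of `D⁻¹`, and a generator `A` is given by the bounded operator `a = A R`. -/

section Abstract

variable {H : Type*} [NormedAddCommGroup H] [InnerProductSpace ℂ H] [CompleteSpace H]

/-- Bounded regularizations `J n` of the identity, commuting with `R`, and `K n = R⁻¹ J n`. -/
structure Cutoff (R : H →L[ℂ] H) (J K : ℕ → H →L[ℂ] H) : Prop where
  dense : DenseRange R
  norm_R : ‖R‖ ≤ 1
  norm_J : ∀ n, ‖J n‖ ≤ 1
  symm : ∀ n x y, inner ℂ (J n x) y = inner ℂ x (J n y)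
  comm : ∀ n, J n * R = R * J n
  R_mul : ∀ n, R * K n = J n
  mul_R : ∀ n, K n * R = J n
  err : ∀ n : ℕ, ‖(1 - J n) * R‖ ≤ 1 / (n + 1)

/-- The operators `a j t = A⁽ʲ⁾(t) R`, where `A⁽ʲ⁾` is the `j`-fold commutator of `R⁻¹` with `A`. -/
structure IsGenerator (R : H →L[ℂ] H) (a : ℕ → ℝ → H →L[ℂ] H) (ν : ℝ) : Prop where
  cont : ∀ j, Continuous (a j)
  bdd : ∀ j, ∃ C, ∀ t, ‖a j t‖ ≤ C
  rel : ∀ j t, a j t * R = R * a j t + R * a (j + 1) t * R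
  nonneg : 0 ≤ ν
  dissip : ∀ t z, (inner ℂ (a 0 t z) (R z)).re ≤ ν * ‖R z‖ ^ 2

/-- The operators `R⁻¹ A⁽ʲ⁾` acting on the range of `R`. -/
def shiftGen (R : H →L[ℂ] H) (a : ℕ → ℝ → H →L[ℂ] H) (j : ℕ) (t : ℝ) : H →L[ℂ] H :=
  a j t + a (j + 1) t * R

variable {R : H →L[ℂ] H} {J K : ℕ → H →L[ℂ] H} {a : ℕ → ℝ → H →L[ℂ] H} {ν : ℝ}

theorem IsGenerator.mul_R (ha : IsGenerator R a ν) (j : ℕ) (t : ℝ) :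
    a j t * R = R * shiftGen R a j t := by
  rw [ha.rel, shiftGen, mul_add, mul_assoc]

/-- With `D = R⁻¹` one has `D A D⁻¹ = A + [D, A] D⁻¹`, and the last term is the bounded operator `a
1`. A bounded perturbation preserves quasi-dissipativity at the cost of a larger constant. The whole
hierarchy of commutators is carried along so that the shift can be iterated. -/
theorem IsGenerator.shift (ha : IsGenerator R a ν) : ∃ ν', IsGenerator R (shiftGen R a) ν' := by
  obtain ⟨C, hC⟩ := ha.bdd 1
  have hC0 : 0 ≤ C := (norm_nonneg _).trans (hC 0)
  refine ⟨ν + C, ⟨fun j => (ha.cont j).add ((ha.cont (j + 1)).mul continuous_const), fun j => ?_,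
    fun j t => ?_, add_nonneg ha.nonneg hC0, fun t z => ?_⟩⟩
  · obtain ⟨C₁, h1⟩ := ha.bdd j
    obtain ⟨C₂, h2⟩ := ha.bdd (j + 1)
    exact ⟨C₁ + C₂ * ‖R‖, fun t => (norm_add_le _ _).trans (add_le_add (h1 t)
      ((norm_mul_le _ _).trans (mul_le_mul_of_nonneg_right (h2 t) (norm_nonneg _))))⟩
  · calc shiftGen R a j t * R = a j t * R + a (j + 1) t * R * R := add_mul _ _ _
      _ = R * a j t + R * a (j + 1) t * R + (R * a (j + 1) t + R * a (j + 1 + 1) t * R) * R := by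
        rw [ha.rel j, ha.rel (j + 1)]
      _ = _ := by
        simp only [shiftGen]
        noncomm_ring
  · have h1 := ha.dissip t z
    have h2 : (inner ℂ (a 1 t (R z)) (R z)).re ≤ C * ‖R z‖ ^ 2 := by
      refine (Complex.re_le_norm _).trans ((norm_inner_le_norm _ _).trans ?_)
      rw [pow_two, ← mul_assoc]
      exact mul_le_mul_of_nonneg_right ((a 1 t).le_of_opNorm_le (hC t) _) (norm_nonneg _)
    simp only [shiftGen, add_apply, mul_apply_eq_comp, zero_add, inner_add_left,
      Complex.add_re]
    linarith

theorem hasDerivWithinAt_op_apply {φ : ℝ → H →L[ℂ] H} {φ' : H →L[ℂ] H} {x : ℝ → H} {x' : H}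
    {s : Set ℝ} {t : ℝ} (hφ : HasDerivWithinAt φ φ' s t) (hx : HasDerivWithinAt x x' s t) :
    HasDerivWithinAt (fun t => φ t (x t)) (φ' (x t) + φ t x') s t := by
  have h := (ContinuousLinearMap.restrictScalarsL ℂ H H ℝ ℝ).hasFDerivAt.comp_hasDerivWithinAt t hφ
  exact h.clm_apply hx

/-- Extending `g` by constants beyond the interval reduces the one-sided derivatives at the
endpoints to the ordinary fundamental theorem of calculus. -/
theorem hasDerivWithinAt_of_integral_right {E : Type*} [NormedAddCommGroup E] [NormedSpace ℝ E]
    [CompleteSpace E] {g u : ℝ → E} {a b : ℝ} (x : E) (hg : ContinuousOn g (Icc a b))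
    (hu : ∀ t ∈ Icc a b, u t = x + ∫ τ in a..t, g τ) {t : ℝ} (ht : t ∈ Icc a b) :
    HasDerivWithinAt u (g t) (Icc a b) t := by
  have hab := ht.1.trans ht.2
  set G : ℝ → E := fun τ => g (projIcc a b hab τ) with hG
  have hGc : Continuous G :=
    (continuousOn_iff_continuous_domRestrict.1 hg).comp (continuous_projIcc (h := hab))
  have hGg : ∀ τ ∈ Icc a b, G τ = g τ := fun τ hτ => by simp [hG, projIcc_of_mem hab hτ]
  have h1 : HasDerivAt (fun t => x + ∫ τ in a..t, G τ) (G t) t :=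
    (intervalIntegral.integral_hasDerivAt_right (hGc.intervalIntegrable _ _)
      hGc.aestronglyMeasurable.stronglyMeasurableAtFilter hGc.continuousAt).const_add x
  rw [← hGg t ht]
  refine h1.hasDerivWithinAt.congr_of_mem (fun τ hτ => ?_) ht
  rw [hu τ hτ]
  congr 1
  refine intervalIntegral.integral_congr fun σ hσ => (hGg σ ?_).symm
  rw [uIcc_of_le hτ.1] at hσ
  exact ⟨hσ.1, hσ.2.trans hτ.2⟩

theorem hasDerivWithinAt_of_integral_left {E : Type*} [NormedAddCommGroup E] [NormedSpace ℝ E]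
    [CompleteSpace E] {g u : ℝ → E} {a b : ℝ} (x : E) (hg : ContinuousOn g (Icc a b))
    (hu : ∀ t ∈ Icc a b, u t = x + ∫ τ in t..b, g τ) {t : ℝ} (ht : t ∈ Icc a b) :
    HasDerivWithinAt u (-g t) (Icc a b) t := by
  have hab := ht.1.trans ht.2
  set G : ℝ → E := fun τ => g (projIcc a b hab τ) with hG
  have hGc : Continuous G :=
    (continuousOn_iff_continuous_domRestrict.1 hg).comp (continuous_projIcc (h := hab))
  have hGg : ∀ τ ∈ Icc a b, G τ = g τ := fun τ hτ => by simp [hG, projIcc_of_mem hab hτ]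
  have h1 : HasDerivAt (fun t => x + ∫ τ in t..b, G τ) (-G t) t :=
    (intervalIntegral.integral_hasDerivAt_left (hGc.intervalIntegrable _ _)
      hGc.aestronglyMeasurable.stronglyMeasurableAtFilter hGc.continuousAt).const_add x
  rw [← hGg t ht]
  refine h1.hasDerivWithinAt.congr_of_mem (fun τ hτ => ?_) ht
  rw [hu τ hτ]
  congr 1
  refine intervalIntegral.integral_congr fun σ hσ => (hGg σ ?_).symm
  rw [uIcc_of_le hτ.2] at hσ
  exact ⟨hτ.1.trans hσ.1, hσ.2⟩

/-! ### Regularized propagators: uniform bounds and rate of approximation. -/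

open Classical in
/-- A propagator of `A`, if there is one. -/
def propagator (A : ℝ → H →L[ℂ] H) : ℝ → ℝ → H →L[ℂ] H :=
  if h : ∃ U, IsPropagator A U then h.choose else 0

/-- The propagators of the regularized generators. -/
def approx (J K : ℕ → H →L[ℂ] H) (a : ℕ → ℝ → H →L[ℂ] H) (n : ℕ) : ℝ → ℝ → H →L[ℂ] H :=
  propagator fun t => J n * a 0 t * K n

theorem isPropagator_approx (ha : IsGenerator R a ν) (n : ℕ) :
    IsPropagator (fun t => J n * a 0 t * K n) (approx J K a n) := by
  obtain ⟨C, hC⟩ := ha.bdd 0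
  have h : ∃ U, IsPropagator (fun t => J n * a 0 t * K n) U := by
    refine exists_isPropagator ((continuous_const.mul (ha.cont 0)).mul continuous_const)
      (K := ‖J n‖ * C * ‖K n‖) fun t => (norm_mul_le _ _).trans ?_
    gcongr
    exact (norm_mul_le _ _).trans (by gcongr; exact hC t)
  rw [approx, propagator, dif_pos h]
  exact h.choose_spec

theorem hasDerivAt_op_apply {φ : ℝ → H →L[ℂ] H} {φ' : H →L[ℂ] H} {t : ℝ} (hφ : HasDerivAt φ φ' t)
    (v : H) : HasDerivAt (fun t => φ t v) (φ' v) t := by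
  have h := hasDerivWithinAt_op_apply hφ.hasDerivWithinAt (hasDerivWithinAt_const t univ v)
  rw [map_zero, add_zero, hasDerivWithinAt_univ] at h
  exact h

theorem hasDerivAt_norm_sq {u : ℝ → H} {u' : H} {t : ℝ} (hu : HasDerivAt u u' t) :
    HasDerivAt (fun t => ‖u t‖ ^ 2) (2 * (inner ℂ u' (u t)).re) t := by
  have h := (hu.inner ℂ hu)
  have h2 := (Complex.reCLM.hasFDerivAt.comp_hasDerivAt t h)
  refine (h2.congr_deriv ?_).congr_of_eventuallyEq (Eventually.of_forall fun x => ?_)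
  · simp only [map_add, Complex.reCLM_apply]
    rw [← inner_conj_symm u' (u t), Complex.conj_re]
    ring
  · simp only [Function.comp, Complex.reCLM_apply]
    exact (inner_self_eq_norm_sq (𝕜 := ℂ) (u x)).symm

/-- The regularized generator is `J A J`, written with bounded factors as `J (A R) (R⁻¹ J)`. Moving
the symmetric outer `J` across leaves the quadratic form of `A` at `J u = R (K u)`, so dissipativity
is inherited with the same constant. -/
theorem re_inner_cut_eq (hc : Cutoff R J K) (n : ℕ) (t : ℝ) (u : H) :
    (inner ℂ ((J n * a 0 t * K n) u) u).re = (inner ℂ (a 0 t (K n u)) (R (K n u))).re := by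
  simp only [mul_apply_eq_comp, hc.symm]
  rw [← mul_apply_eq_comp R, hc.R_mul]

/-- Dissipativity makes `e^{-2ντ} ‖u(τ)‖²` nonincreasing along solutions. It bounds the growth by `ν
‖J u‖²`; passing to `ν ‖u‖²` uses `ν ≥ 0` and `‖J‖ ≤ 1`. -/
theorem norm_approx_apply_le (hc : Cutoff R J K) (ha : IsGenerator R a ν) (n : ℕ) {s t : ℝ}
    (hst : s ≤ t) (v : H) : ‖approx J K a n t s v‖ ≤ Real.exp (ν * (t - s)) * ‖v‖ := by
  have hp := isPropagator_approx (J := J) (K := K) ha n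
  have hd : ∀ τ, HasDerivAt (fun τ => Real.exp (-2 * ν * τ) * ‖approx J K a n τ s v‖ ^ 2)
      (Real.exp (-2 * ν * τ) * (-2 * ν) * ‖approx J K a n τ s v‖ ^ 2 +
        Real.exp (-2 * ν * τ) *
          (2 * (inner ℂ ((J n * a 0 τ * K n) (approx J K a n τ s v)) (approx J K a n τ s v)).re))
      τ := fun τ => by
    refine HasDerivAt.fun_mul ?_ (hasDerivAt_norm_sq (hasDerivAt_op_apply (hp.left τ s) v))
    simpa using ((hasDerivAt_id τ).const_mul (-2 * ν)).exp
  have hanti : Antitone (fun τ => Real.exp (-2 * ν * τ) * ‖approx J K a n τ s v‖ ^ 2) := by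
    refine antitone_of_deriv_nonpos (fun τ => (hd τ).differentiableAt) fun τ => ?_
    rw [(hd τ).deriv, re_inner_cut_eq hc]
    have h1 := ha.dissip τ (K n (approx J K a n τ s v))
    rw [← mul_apply_eq_comp R, hc.R_mul] at h1
    have h2 : ‖J n (approx J K a n τ s v)‖ ^ 2 ≤ ‖approx J K a n τ s v‖ ^ 2 := by
      have := (J n).le_of_opNorm_le (hc.norm_J n) (approx J K a n τ s v)
      rw [one_mul] at this
      gcongr
    have h3 := mul_le_mul_of_nonneg_left h2 ha.nonneg
    have h4 := mul_nonneg (Real.exp_pos (-2 * ν * τ)).le (sub_nonneg.2 (h1.trans h3))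
    rw [← mul_apply_eq_comp R, hc.R_mul]
    linarith
  have h := hanti hst
  simp only [hp.self, one_apply_eq_self] at h
  have h2 : ‖approx J K a n t s v‖ ^ 2 ≤ (Real.exp (ν * (t - s)) * ‖v‖) ^ 2 := by
    have h5 := mul_le_mul_of_nonneg_left h (Real.exp_pos (2 * ν * t)).le
    rw [← mul_assoc, ← mul_assoc, ← Real.exp_add, ← Real.exp_add,
      show 2 * ν * t + -2 * ν * t = 0 by ring, Real.exp_zero, one_mul,
      show 2 * ν * t + -2 * ν * s = (2 : ℕ) * (ν * (t - s)) by push_cast; ring] at h5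
    rwa [mul_pow, ← Real.exp_nat_mul]
  exact (pow_le_pow_iff_left₀ (norm_nonneg _) (by positivity) two_ne_zero).1 h2

theorem norm_approx_le (hc : Cutoff R J K) (ha : IsGenerator R a ν) (n : ℕ) {s t : ℝ}
    (hst : s ≤ t) : ‖approx J K a n t s‖ ≤ Real.exp (ν * (t - s)) :=
  ContinuousLinearMap.opNorm_le_bound _ (Real.exp_pos _).le (norm_approx_apply_le hc ha n hst)

theorem norm_approx_apply_eq (hc : Cutoff R J K) (ha : IsGenerator R a ν)
    (h0 : ∀ t z, (inner ℂ (a 0 t z) (R z)).re = 0) (n : ℕ) (s t : ℝ) (v : H) :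
    ‖approx J K a n t s v‖ = ‖v‖ := by
  have hp := isPropagator_approx (J := J) (K := K) ha n
  have hd : ∀ τ, HasDerivAt (fun τ => ‖approx J K a n τ s v‖ ^ 2) 0 τ := fun τ => by
    refine (hasDerivAt_norm_sq (hasDerivAt_op_apply (hp.left τ s) v)).congr_deriv ?_
    rw [mul_apply_eq_comp, re_inner_cut_eq hc, h0, mul_zero]
  have h := is_const_of_deriv_eq_zero (fun t => (hd t).differentiableAt) (fun t => (hd t).deriv) t s
  simp only [hp.self, one_apply_eq_self] at h
  exact (pow_left_inj₀ (norm_nonneg _) (norm_nonneg _) two_ne_zero).1 h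

/-- Since `J` commutes with `R`, conjugating the regularized generator by `R` is the same as
regularizing the conjugated one; intertwined generators have intertwined propagators. -/
theorem approx_mul_R (hc : Cutoff R J K) (ha : IsGenerator R a ν) (n : ℕ) (t s : ℝ) :
    approx J K a n t s * R = R * approx J K (shiftGen R a) n t s := by
  obtain ⟨ν', ha'⟩ := ha.shift
  refine (isPropagator_approx ha n).intertwine (isPropagator_approx ha' n) (fun τ => ?_) t s
  calc J n * a 0 τ * K n * R = J n * (a 0 τ * R) * K n := by
        rw [mul_assoc, hc.mul_R, mul_assoc, mul_assoc, mul_assoc, hc.R_mul]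
    _ = R * (J n * shiftGen R a 0 τ * K n) := by
        rw [ha.mul_R, ← mul_assoc, ← mul_assoc, ← mul_assoc, hc.comm]

/-- One factor `R` makes `A` bounded; the second pays for the rate, because `(1 - J n) R` is of size
`1/(n+1)`. In the outer error the `R` has to be pulled to the left through `A`, which is where the
shifted generator enters. -/
theorem norm_cut_sub_le (hc : Cutoff R J K) (ha : IsGenerator R a ν) :
    ∃ C, 0 ≤ C ∧ ∀ (n : ℕ) t, ‖J n * a 0 t * K n * (R * R) - a 0 t * R‖ ≤ C * (1 / (n + 1)) := by
  obtain ⟨C, hC⟩ := ha.bdd 0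
  obtain ⟨ν', ha'⟩ := ha.shift
  obtain ⟨C', hC'⟩ := ha'.bdd 0
  have hC0 : 0 ≤ C := (norm_nonneg _).trans (hC 0)
  have hC0' : 0 ≤ C' := (norm_nonneg _).trans (hC' 0)
  refine ⟨C' + C, by positivity, fun n t => ?_⟩
  have hn : (0 : ℝ) ≤ 1 / (n + 1) := by positivity
  have e : J n * a 0 t * K n * (R * R) - a 0 t * R =
      -((1 - J n) * R * shiftGen R a 0 t * J n) - a 0 t * ((1 - J n) * R) := by
    have h1 : J n * a 0 t * K n * (R * R) = J n * (R * shiftGen R a 0 t) * J n := by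
      rw [← ha.mul_R, mul_assoc (J n * a 0 t), ← mul_assoc (K n), hc.mul_R, hc.comm, mul_assoc,
        mul_assoc, mul_assoc]
    have h2 : (1 - J n) * R = R - R * J n := by rw [sub_mul, one_mul, hc.comm]
    rw [h1, h2, mul_sub, ← mul_assoc (a 0 t), ha.mul_R, ← hc.comm]
    noncomm_ring
  rw [e, add_mul]
  refine (norm_sub_le _ _).trans (add_le_add ?_ ?_)
  · rw [norm_neg]
    calc _ ≤ ‖(1 - J n) * R‖ * ‖shiftGen R a 0 t‖ * ‖J n‖ := norm_mul₃_le
      _ ≤ 1 / (n + 1) * C' * 1 := by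
        gcongr
        · exact hc.err n
        · exact hC' t
        · exact hc.norm_J n
      _ = _ := by ring
  · exact (norm_mul_le _ _).trans (mul_le_mul (hC t) (hc.err n) (norm_nonneg _) hC0)

end Abstract

/-! ### Convergence of the regularized evolutions -/

section Convergence

variable {H : Type*} [NormedAddCommGroup H] [InnerProductSpace ℂ H] [CompleteSpace H]
variable {R : H →L[ℂ] H} {J K : ℕ → H →L[ℂ] H} {a : ℕ → ℝ → H →L[ℂ] H} {ν : ℝ}

theorem norm_approx_le_exp (hc : Cutoff R J K) (ha : IsGenerator R a ν) (n : ℕ) {p : ℝ × ℝ}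
    (hp : p ∈ triangle) : ‖approx J K a n p.1 p.2‖ ≤ Real.exp ν := by
  refine (norm_approx_le hc ha n hp.2.1).trans (Real.exp_le_exp.2 ?_)
  have := ha.nonneg
  have h1 := hp.1
  have h2 := hp.2.2
  nlinarith

/-- Duhamel: the derivative in `r` of `U_n(t,r) U_m(r,s) R²` contains the difference of the
generators, which is small only when followed by `R²`. -/
theorem norm_approx_sub_le (hc : Cutoff R J K) (ha : IsGenerator R a ν) :
    ∃ C, 0 ≤ C ∧ ∀ (n m : ℕ), ∀ p ∈ triangle,
      ‖approx J K a n p.1 p.2 * (R * R) - approx J K a m p.1 p.2 * (R * R)‖ ≤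
        C * (1 / (n + 1) + 1 / (m + 1)) := by
  obtain ⟨ν₁, ha₁⟩ := ha.shift
  obtain ⟨ν₂, ha₂⟩ := ha₁.shift
  obtain ⟨C, hC0, hC⟩ := norm_cut_sub_le hc ha
  refine ⟨Real.exp ν * C * Real.exp ν₂, by positivity, fun n m p hp => ?_⟩
  obtain ⟨t, s⟩ := p
  obtain ⟨h0s, hst, ht1⟩ := hp
  simp only at h0s hst ht1 ⊢
  set ε : ℝ := 1 / (n + 1) + 1 / (m + 1) with hε
  have hp := isPropagator_approx (J := J) (K := K) ha n
  have hp' := isPropagator_approx (J := J) (K := K) ha m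
  -- Both factors `R` are moved to the left of `U_m`, next to the difference of generators. What
  -- remains on the right is the propagator of the doubly shifted generator, again bounded uniformly
  -- in `m`.
  have hRR : ∀ τ, approx J K a m τ s * (R * R) =
      R * R * approx J K (shiftGen R (shiftGen R a)) m τ s := fun τ => by
    rw [← mul_assoc, approx_mul_R hc ha, mul_assoc, approx_mul_R hc ha₁, mul_assoc]
  have hd : ∀ r, HasDerivAt (fun r => approx J K a n t r * approx J K a m r s * (R * R))
      (approx J K a n t r * (J m * a 0 r * K m - J n * a 0 r * K n) *
        approx J K a m r s * (R * R)) r := fun r => by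
    simpa using (hp.hasDerivAt_mul hp' 1 t r s).mul_const (R * R)
  have hb := norm_image_sub_le_of_norm_deriv_le_segment' (a := s) (b := t)
    (C := Real.exp ν * (C * ε) * Real.exp ν₂)
    (fun r _ => (hd r).hasDerivWithinAt) (fun r hr => ?_) t ⟨hst, le_rfl⟩
  · simp only [hp.self, hp'.self, one_mul, mul_one] at hb
    rw [norm_sub_rev]
    refine hb.trans ?_
    have : Real.exp ν * (C * ε) * Real.exp ν₂ * (t - s) ≤ Real.exp ν * (C * ε) * Real.exp ν₂ * 1 :=
      mul_le_mul_of_nonneg_left (by linarith) (by positivity)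
    linarith
  · rw [mul_assoc _ _ (R * R), hRR, ← mul_assoc, mul_assoc (approx J K a n t r)]
    refine norm_mul₃_le.trans ?_
    gcongr
    · exact norm_approx_le_exp hc ha n (p := (t, r)) ⟨h0s.trans hr.1, hr.2.le, ht1⟩
    · have e : (J m * a 0 r * K m - J n * a 0 r * K n) * (R * R) =
          (J m * a 0 r * K m * (R * R) - a 0 r * R) - (J n * a 0 r * K n * (R * R) - a 0 r * R) := by
        noncomm_ring
      rw [e]
      refine (norm_sub_le _ _).trans ((add_le_add (hC m r) (hC n r)).trans (le_of_eq ?_))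
      rw [hε]
      ring
    · exact norm_approx_le_exp hc ha₂ m (p := (r, s)) ⟨h0s, hr.1, hr.2.le.trans ht1⟩

theorem Cutoff.dense_sq (hc : Cutoff R J K) : DenseRange fun z => R (R z) :=
  hc.dense.comp hc.dense R.continuous

/-- The rate holds on the dense range of `R²`; the uniform bound `e^ν` on the triangle spreads
convergence to every vector. -/
theorem uniformCauchySeqOn_approx (hc : Cutoff R J K) (ha : IsGenerator R a ν) (v : H) :
    UniformCauchySeqOn (fun n (p : ℝ × ℝ) => approx J K a n p.1 p.2 v) atTop triangle := by
  rw [Metric.uniformCauchySeqOn_iff]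
  intro ε hε
  have hE := Real.exp_pos ν
  obtain ⟨C, hC0, hC⟩ := norm_approx_sub_le hc ha
  obtain ⟨z, hz⟩ := hc.dense_sq.exists_dist_lt v (ε := ε / (4 * Real.exp ν)) (by positivity)
  rw [dist_eq_norm] at hz
  obtain ⟨N, hN⟩ := exists_nat_gt (8 * (C + 1) * (‖z‖ + 1) / ε)
  have hsmall : ∀ n ≥ N, C * (1 / ((n : ℝ) + 1)) * ‖z‖ ≤ ε / 8 := fun n hn => by
    have hn' : (N : ℝ) ≤ n := by exact_mod_cast hn
    have h1 : 8 * (C + 1) * (‖z‖ + 1) / ε < n + 1 := by linarith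
    rw [div_lt_iff₀ hε] at h1
    have hn1 : (0 : ℝ) < n + 1 := by positivity
    rw [mul_one_div, div_mul_eq_mul_div, div_le_iff₀ hn1]
    nlinarith [norm_nonneg z]
  refine ⟨N, fun m hm n hn p hp => ?_⟩
  rw [dist_eq_norm]
  have h1 : ∀ k, ‖approx J K a k p.1 p.2 (v - R (R z))‖ ≤ ε / 4 := fun k => by
    refine (ContinuousLinearMap.le_of_opNorm_le_of_le _ (norm_approx_le_exp hc ha k hp)
      hz.le).trans (le_of_eq ?_)
    field_simp
  have h2 := ContinuousLinearMap.le_of_opNorm_le _ (hC m n p hp) z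
  simp only [sub_apply, mul_apply_eq_comp] at h2
  have h3 : approx J K a m p.1 p.2 v - approx J K a n p.1 p.2 v =
      approx J K a m p.1 p.2 (v - R (R z)) - approx J K a n p.1 p.2 (v - R (R z)) +
      (approx J K a m p.1 p.2 (R (R z)) - approx J K a n p.1 p.2 (R (R z))) := by
    simp only [map_sub]
    abel
  rw [h3]
  have h4 := norm_add_le (approx J K a m p.1 p.2 (v - R (R z)) -
    approx J K a n p.1 p.2 (v - R (R z)))
    (approx J K a m p.1 p.2 (R (R z)) - approx J K a n p.1 p.2 (R (R z)))
  have h5 := norm_sub_le (approx J K a m p.1 p.2 (v - R (R z)))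
    (approx J K a n p.1 p.2 (v - R (R z)))
  have h6 := h1 m
  have h7 := h1 n
  have h8 := hsmall m hm
  have h9 := hsmall n hn
  have h10 : C * (1 / ((m : ℝ) + 1) + 1 / (n + 1)) * ‖z‖ =
    C * (1 / ((m : ℝ) + 1)) * ‖z‖ + C * (1 / ((n : ℝ) + 1)) * ‖z‖ := by ring
  linarith

open Classical in
/-- The strong limit of the regularized propagators. -/
def evol (J K : ℕ → H →L[ℂ] H) (a : ℕ → ℝ → H →L[ℂ] H) (t s : ℝ) : H →L[ℂ] H :=
  if h : ∃ U : H →L[ℂ] H, ∀ v, Tendsto (fun n => approx J K a n t s v) atTop (𝓝 (U v))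
  then h.choose else 0

theorem tendsto_approx (hc : Cutoff R J K) (ha : IsGenerator R a ν) {t s : ℝ}
    (hp : (t, s) ∈ triangle) (v : H) :
    Tendsto (fun n => approx J K a n t s v) atTop (𝓝 (evol J K a t s v)) := by
  have h : ∃ U : H →L[ℂ] H, ∀ v, Tendsto (fun n => approx J K a n t s v) atTop (𝓝 (U v)) := by
    have h1 : ∀ v, ∃ y, Tendsto (fun n => approx J K a n t s v) atTop (𝓝 y) := fun v =>
      cauchySeq_tendsto_of_complete ((uniformCauchySeqOn_approx hc ha v).cauchySeq hp)
    choose f hf using h1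
    refine ⟨continuousLinearMapOfTendsto (fun n => approx J K a n t s) (f := f)
      (tendsto_pi_nhds.2 hf), hf⟩
  rw [evol, dif_pos h]
  exact h.choose_spec v

theorem tendstoUniformlyOn_approx (hc : Cutoff R J K) (ha : IsGenerator R a ν) (v : H) :
    TendstoUniformlyOn (fun n (p : ℝ × ℝ) => approx J K a n p.1 p.2 v)
      (fun p => evol J K a p.1 p.2 v) atTop triangle :=
  (uniformCauchySeqOn_approx hc ha v).tendstoUniformlyOn_of_tendsto
    fun _ hp => tendsto_approx hc ha hp v

theorem tendsto_approx_seq (hc : Cutoff R J K) (ha : IsGenerator R a ν) {t s : ℝ}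
    (hp : (t, s) ∈ triangle) {x : ℕ → H} {v : H} (hx : Tendsto x atTop (𝓝 v)) :
    Tendsto (fun n => approx J K a n t s (x n)) atTop (𝓝 (evol J K a t s v)) := by
  have h1 : Tendsto (fun n => approx J K a n t s (x n - v)) atTop (𝓝 0) := by
    refine squeeze_zero_norm (fun n => ContinuousLinearMap.le_of_opNorm_le _
      (norm_approx_le_exp hc ha n hp) _) ?_
    simpa using ((tendsto_iff_norm_sub_tendsto_zero.1 hx).const_mul (Real.exp ν))
  simpa using (tendsto_approx hc ha hp v).add h1

theorem norm_evol_apply_le (hc : Cutoff R J K) (ha : IsGenerator R a ν) {t s : ℝ}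
    (hp : (t, s) ∈ triangle) (v : H) :
    ‖evol J K a t s v‖ ≤ Real.exp (ν * (t - s)) * ‖v‖ :=
  le_of_tendsto (tendsto_approx hc ha hp v).norm
    (Eventually.of_forall fun n => norm_approx_apply_le hc ha n hp.2.1 v)

theorem norm_evol_apply_eq (hc : Cutoff R J K) (ha : IsGenerator R a ν)
    (h0 : ∀ t z, (inner ℂ (a 0 t z) (R z)).re = 0) {t s : ℝ} (hp : (t, s) ∈ triangle) (v : H) :
    ‖evol J K a t s v‖ = ‖v‖ := by
  refine tendsto_nhds_unique (tendsto_approx hc ha hp v).norm ?_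
  simp only [norm_approx_apply_eq hc ha h0, tendsto_const_nhds]

theorem isEvolutionSystem_evol (hc : Cutoff R J K) (ha : IsGenerator R a ν) :
    IsEvolutionSystem (evol J K a) where
  self s hs := by
    ext v
    refine tendsto_nhds_unique (tendsto_approx hc ha (t := s) (s := s) ⟨hs.1, le_rfl, hs.2⟩ v) ?_
    simp [(isPropagator_approx (J := J) (K := K) ha _).self]
  comp s r t hs hsr hrt ht := by
    ext v
    refine tendsto_nhds_unique ?_
      (tendsto_approx hc ha (t := t) (s := s) ⟨hs, hsr.trans hrt, ht⟩ v)
    have h := tendsto_approx_seq hc ha (t := t) (s := r) ⟨hs.trans hsr, hrt, ht⟩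
      (tendsto_approx hc ha (t := r) (s := s) ⟨hs, hsr, hrt.trans ht⟩ v)
    simpa [← (isPropagator_approx (J := J) (K := K) ha _).comp t r s] using h
  continuous x := by
    refine (tendstoUniformlyOn_approx hc ha x).continuousOn (Frequently.of_forall fun n => ?_)
    exact ((isPropagator_approx (J := J) (K := K) ha n).cont.clm_apply
      continuous_const).continuousOn

/-- This is the source of the invariance of the range of `R`, and of continuity in its norm: the
image is `R` applied to a strongly continuous evolution. -/
theorem evol_R (hc : Cutoff R J K) (ha : IsGenerator R a ν) {t s : ℝ} (hp : (t, s) ∈ triangle)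
    (z : H) : evol J K a t s (R z) = R (evol J K (shiftGen R a) t s z) := by
  obtain ⟨ν', ha'⟩ := ha.shift
  refine tendsto_nhds_unique (tendsto_approx hc ha hp (R z)) ?_
  have h := (R.continuous.tendsto _).comp (tendsto_approx hc ha' hp z)
  refine h.congr fun n => ?_
  have := approx_mul_R hc ha n t s
  simpa using (DFunLike.congr_fun this z).symm

theorem tendsto_J (hc : Cutoff R J K) (v : H) : Tendsto (fun n => J n v) atTop (𝓝 v) := by
  rw [Metric.tendsto_atTop]
  intro ε hε
  obtain ⟨z, hz⟩ := hc.dense.exists_dist_lt v (ε := ε / 4) (by positivity)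
  rw [dist_eq_norm] at hz
  obtain ⟨N, hN⟩ := exists_nat_gt (4 * ‖z‖ / ε)
  refine ⟨N, fun n hn => ?_⟩
  have hn' : (N : ℝ) ≤ n := by exact_mod_cast hn
  have h1 : ‖(1 - J n) (R z)‖ ≤ ε / 4 := by
    refine (ContinuousLinearMap.le_of_opNorm_le _ (hc.err n) z).trans ?_
    rw [div_lt_iff₀ hε] at hN
    rw [one_div_mul_eq_div, div_le_iff₀ (by positivity)]
    nlinarith
  have h2 := (J n).le_of_opNorm_le (hc.norm_J n) (v - R z)
  have e : J n v - v = J n (v - R z) - (v - R z) - (1 - J n) (R z) := by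
    simp only [map_sub, sub_apply, one_apply_eq_self]
    abel
  rw [dist_eq_norm, e]
  have h3 := norm_sub_le (J n (v - R z) - (v - R z)) ((1 - J n) (R z))
  have h4 := norm_sub_le (J n (v - R z)) (v - R z)
  linarith

theorem tendsto_J_seq (hc : Cutoff R J K) {x : ℕ → H} {v : H} (hx : Tendsto x atTop (𝓝 v)) :
    Tendsto (fun n => J n (x n)) atTop (𝓝 v) := by
  have h1 : Tendsto (fun n => J n (x n - v)) atTop (𝓝 0) := by
    refine squeeze_zero_norm (fun n => ContinuousLinearMap.le_of_opNorm_le _ (hc.norm_J n) _) ?_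
    simpa using tendsto_iff_norm_sub_tendsto_zero.1 hx
  simpa using (tendsto_J hc v).add h1

theorem continuousOn_evol_left (hc : Cutoff R J K) (ha : IsGenerator R a ν) {s : ℝ} (hs : 0 ≤ s)
    (v : H) : ContinuousOn (fun τ => evol J K a τ s v) (Icc s 1) :=
  ((isEvolutionSystem_evol hc ha).continuous v).comp (f := fun τ : ℝ => (τ, s))
    (by fun_prop) fun _ hτ => ⟨hs, hτ.1, hτ.2⟩

theorem IsEvolutionSystem.continuousOn_right {U : ℝ → ℝ → H →L[ℂ] H} (hU : IsEvolutionSystem U)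
    {t : ℝ} (ht : t ≤ 1) (v : H) : ContinuousOn (fun σ => U t σ v) (Icc 0 t) :=
  (hU.continuous v).comp (f := fun σ : ℝ => (t, σ)) (by fun_prop) fun _ hσ => ⟨hσ.1, hσ.2, ht⟩

/-- The strong convergence of vectors under a uniformly bounded strongly continuous family. -/
theorem continuousWithinAt_op_apply {φ : ℝ → H →L[ℂ] H} {x : ℝ → H} {C : ℝ} {S : Set ℝ} {r : ℝ}
    (hC : ∀ σ ∈ S, ‖φ σ‖ ≤ C) (hφ : ContinuousWithinAt (fun σ => φ σ (x r)) S r)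
    (hx : ContinuousWithinAt x S r) : ContinuousWithinAt (fun σ => φ σ (x σ)) S r := by
  have h1 : Tendsto (fun σ => φ σ (x σ - x r)) (𝓝[S] r) (𝓝 0) := by
    refine squeeze_zero_norm' (a := fun σ => C * ‖x σ - x r‖) ?_ ?_
    · filter_upwards [self_mem_nhdsWithin] with σ hσ
      exact (φ σ).le_of_opNorm_le (hC σ hσ) _
    · simpa using (tendsto_iff_norm_sub_tendsto_zero.1 hx).const_mul C
  have h2 := hφ.tendsto.add h1
  simp only [map_sub, add_zero] at h2
  exact h2.congr fun σ => by abel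

/-- Strong limits do not preserve derivatives, so the limit is taken in the integral equation. There
`K n` meets the `R` produced by `U_n R = R V_n` and becomes `J n`, which leaves an integrand bounded
uniformly in `n`. -/
theorem hasDerivWithinAt_evol_left (hc : Cutoff R J K) (ha : IsGenerator R a ν) {s t : ℝ}
    (hs : 0 ≤ s) (hst : s ≤ t) (ht : t ≤ 1) (z : H) :
    HasDerivWithinAt (fun τ => evol J K a τ s (R z))
      (a 0 t (evol J K (shiftGen R a) t s z)) (Icc s 1) t := by
  obtain ⟨ν', ha'⟩ := ha.shift
  obtain ⟨C, hC⟩ := ha.bdd 0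
  have hC0 : 0 ≤ C := (norm_nonneg _).trans (hC 0)
  refine hasDerivWithinAt_of_integral_right (g := fun τ => a 0 τ (evol J K (shiftGen R a) τ s z))
    (R z) ((ha.cont 0).continuousOn.clm_apply (continuousOn_evol_left hc ha' hs z)) ?_ ⟨hst, ht⟩
  intro t ht
  have hn : ∀ n, approx J K a n t s (R z) =
      R z + ∫ τ in s..t, J n (a 0 τ (J n (approx J K (shiftGen R a) n τ s z))) := fun n => by
    have hp := isPropagator_approx (J := J) (K := K) ha n
    have hp' := isPropagator_approx (J := J) (K := K) ha' n
    have hd : ∀ τ, HasDerivAt (fun τ => approx J K a n τ s (R z))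
        (J n (a 0 τ (J n (approx J K (shiftGen R a) n τ s z)))) τ := fun τ => by
      refine (hasDerivAt_op_apply (hp.left τ s) (R z)).congr_deriv ?_
      have h1 := DFunLike.congr_fun (approx_mul_R hc ha n τ s) z
      simp only [mul_apply_eq_comp] at h1 ⊢
      rw [h1, ← mul_apply_eq_comp (K n), hc.mul_R]
    have hcont : Continuous fun τ => J n (a 0 τ (J n (approx J K (shiftGen R a) n τ s z))) := by
      have h1 : Continuous fun τ => approx J K (shiftGen R a) n τ s z :=
        continuous_iff_continuousAt.2 fun τ => (hasDerivAt_op_apply (hp'.left τ s) z).continuousAt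
      exact (J n).continuous.comp ((ha.cont 0).clm_apply ((J n).continuous.comp h1))
    rw [intervalIntegral.integral_eq_sub_of_hasDerivAt (fun τ _ => hd τ)
      (hcont.intervalIntegrable _ _), hp.self]
    simp
  refine tendsto_nhds_unique (tendsto_approx hc ha ⟨hs, ht.1, ht.2⟩ (R z)) ?_
  simp only [hn]
  refine Tendsto.const_add _ ?_
  refine intervalIntegral.tendsto_integral_filter_of_dominated_convergence
    (fun _ => C * (Real.exp ν' * ‖z‖)) ?_ ?_ intervalIntegrable_const ?_
  · refine Eventually.of_forall fun n => ?_
    have hp' := isPropagator_approx (J := J) (K := K) ha' n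
    have h1 : Continuous fun τ => approx J K (shiftGen R a) n τ s z :=
      continuous_iff_continuousAt.2 fun τ => (hasDerivAt_op_apply (hp'.left τ s) z).continuousAt
    exact ((J n).continuous.comp
      ((ha.cont 0).clm_apply ((J n).continuous.comp h1))).aestronglyMeasurable
  · refine Eventually.of_forall fun n => Eventually.of_forall fun τ hτ => ?_
    rw [uIoc_of_le ht.1] at hτ
    have h1 := ContinuousLinearMap.le_of_opNorm_le _ (norm_approx_le_exp hc ha' n (p := (τ, s))
      ⟨hs, hτ.1.le, hτ.2.trans ht.2⟩) z
    have h2 := (J n).le_of_opNorm_le_of_le (hc.norm_J n) h1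
    rw [one_mul] at h2
    have h3 := (J n).le_of_opNorm_le_of_le (hc.norm_J n) ((a 0 τ).le_of_opNorm_le_of_le (hC τ) h2)
    rwa [one_mul] at h3
  · refine Eventually.of_forall fun τ hτ => ?_
    rw [uIoc_of_le ht.1] at hτ
    have h1 := tendsto_J_seq hc (tendsto_approx hc ha' (t := τ) (s := s)
      ⟨hs, hτ.1.le, hτ.2.trans ht.2⟩ z)
    exact tendsto_J_seq hc (((a 0 τ).continuous.tendsto _).comp h1)

/-- The integral equation again passes to the limit. Here the generator acts before the evolution,
on the fixed vector `R z`, so the shifted evolution is not needed. -/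
theorem hasDerivWithinAt_evol_right (hc : Cutoff R J K) (ha : IsGenerator R a ν) {s t : ℝ}
    (hs : 0 ≤ s) (hst : s ≤ t) (ht : t ≤ 1) (z : H) :
    HasDerivWithinAt (fun σ => evol J K a t σ (R z)) (-(evol J K a t s (a 0 s z))) (Icc 0 t) s := by
  obtain ⟨C, hC⟩ := ha.bdd 0
  have hC0 : 0 ≤ C := (norm_nonneg _).trans (hC 0)
  have hU := isEvolutionSystem_evol hc ha
  have hbd : ∀ σ ∈ Icc 0 t, ‖evol J K a t σ‖ ≤ Real.exp ν := fun σ hσ =>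
    ContinuousLinearMap.opNorm_le_bound _ (Real.exp_pos _).le fun v =>
      (norm_evol_apply_le hc ha ⟨hσ.1, hσ.2, ht⟩ v).trans (by
        gcongr
        nlinarith [ha.nonneg, hσ.1, hσ.2])
  refine hasDerivWithinAt_of_integral_left (g := fun σ => evol J K a t σ (a 0 σ z)) (R z)
    (fun σ hσ => continuousWithinAt_op_apply hbd (hU.continuousOn_right ht _ σ hσ)
      ((ha.cont 0).clm_apply continuous_const).continuousWithinAt) ?_ ⟨hs, hst⟩
  intro s hs
  have hn : ∀ n, approx J K a n t s (R z) =
      R z + ∫ σ in s..t, approx J K a n t σ (J n (a 0 σ (J n z))) := fun n => by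
    have hp := isPropagator_approx (J := J) (K := K) ha n
    have hd : ∀ σ, HasDerivAt (fun σ => approx J K a n t σ (R z))
        (-(approx J K a n t σ (J n (a 0 σ (J n z))))) σ := fun σ => by
      refine (hasDerivAt_op_apply (hp.right t σ) (R z)).congr_deriv ?_
      simp only [neg_apply, mul_apply_eq_comp]
      rw [← mul_apply_eq_comp (K n), hc.mul_R]
    have hcont : Continuous fun σ => approx J K a n t σ (J n (a 0 σ (J n z))) :=
      (hp.cont.comp (by fun_prop : Continuous fun σ : ℝ => (t, σ))).clm_apply
        ((J n).continuous.comp ((ha.cont 0).clm_apply continuous_const))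
    have h1 := intervalIntegral.integral_eq_sub_of_hasDerivAt (a := s) (b := t)
      (fun σ _ => hd σ) (hcont.neg.intervalIntegrable _ _)
    rw [intervalIntegral.integral_neg, hp.self] at h1
    rw [neg_eq_iff_eq_neg.1 h1]
    simp
  refine tendsto_nhds_unique (tendsto_approx hc ha ⟨hs.1, hs.2, ht⟩ (R z)) ?_
  simp only [hn]
  refine Tendsto.const_add _ ?_
  refine intervalIntegral.tendsto_integral_filter_of_dominated_convergence
    (fun _ => Real.exp ν * (C * ‖z‖)) ?_ ?_ intervalIntegrable_const ?_
  · refine Eventually.of_forall fun n => ?_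
    have hp := isPropagator_approx (J := J) (K := K) ha n
    exact ((hp.cont.comp (by fun_prop : Continuous fun σ : ℝ => (t, σ))).clm_apply
        ((J n).continuous.comp ((ha.cont 0).clm_apply continuous_const))).aestronglyMeasurable
  · refine Eventually.of_forall fun n => Eventually.of_forall fun σ hσ => ?_
    rw [uIoc_of_le hs.2] at hσ
    have h2 := (J n).le_of_opNorm_le (hc.norm_J n) z
    rw [one_mul] at h2
    have h3 := (J n).le_of_opNorm_le_of_le (hc.norm_J n) ((a 0 σ).le_of_opNorm_le_of_le (hC σ) h2)
    rw [one_mul] at h3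
    exact ContinuousLinearMap.le_of_opNorm_le_of_le _ (norm_approx_le_exp hc ha n (p := (t, σ))
      ⟨hs.1.trans hσ.1.le, hσ.2, ht⟩) h3
  · refine Eventually.of_forall fun σ hσ => ?_
    rw [uIoc_of_le hs.2] at hσ
    exact tendsto_approx_seq hc ha (t := t) (s := σ) ⟨hs.1.trans hσ.1.le, hσ.2, ht⟩
      (tendsto_J_seq hc (((a 0 σ).continuous.tendsto _).comp (tendsto_J hc z)))

end Convergence

/-! ### Uniqueness and commutation relations -/

section Uniqueness

variable {H : Type*} [NormedAddCommGroup H] [InnerProductSpace ℂ H] [CompleteSpace H]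

/-- The product rule for a strongly continuous family applied to a differentiable curve. -/
theorem hasDerivWithinAt_strong_apply {φ : ℝ → H →L[ℂ] H} {x : ℝ → H} {x' y' : H} {C : ℝ}
    {S : Set ℝ} {r : ℝ} (hC : ∀ σ ∈ S, ‖φ σ‖ ≤ C)
    (hφc : ContinuousWithinAt (fun σ => φ σ x') S r)
    (hφ : HasDerivWithinAt (fun σ => φ σ (x r)) y' S r) (hx : HasDerivWithinAt x x' S r) :
    HasDerivWithinAt (fun σ => φ σ (x σ)) (y' + φ r x') S r := by
  have h2 : HasDerivWithinAt (fun σ => φ σ (x σ - x r)) (φ r x') S r := by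
    rw [hasDerivWithinAt_iff_tendsto_slope] at hx ⊢
    have h3 : Tendsto (fun σ => φ σ (slope x r σ - x')) (𝓝[S \ {r}] r) (𝓝 0) := by
      refine squeeze_zero_norm' (a := fun σ => C * ‖slope x r σ - x'‖) ?_ ?_
      · filter_upwards [self_mem_nhdsWithin] with σ hσ
        exact (φ σ).le_of_opNorm_le (hC σ hσ.1) _
      · simpa using (tendsto_iff_norm_sub_tendsto_zero.1 hx).const_mul C
    have h4 := (hφc.mono_left (nhdsWithin_mono r sdiff_subset)).add h3
    rw [add_zero] at h4
    refine h4.congr fun σ => ?_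
    simp only [slope_def_module, sub_self, sub_zero, map_sub,
      ContinuousLinearMap.map_smul_of_tower]
    abel
  refine (hφ.add h2).congr (fun σ _ => ?_) ?_
  · simp
  · simp

theorem eq_of_hasDerivWithinAt_zero {E : Type*} [NormedAddCommGroup E] [NormedSpace ℝ E]
    {f : ℝ → E} {a b : ℝ} (hab : a ≤ b) (hf : ∀ x ∈ Icc a b, HasDerivWithinAt f 0 (Icc a b) x) :
    f b = f a := by
  have h := norm_image_sub_le_of_norm_deriv_le_segment' (C := 0) hf (fun x _ => by simp) b
    ⟨hab, le_rfl⟩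
  rw [zero_mul, norm_le_zero_iff, sub_eq_zero] at h
  exact h

theorem IsTimeOrderedExp.exists_norm_le {A : ℝ → H →ₗ.[ℂ] H} {Q : H →ₗ.[ℂ] H}
    {U : ℝ → ℝ → H →L[ℂ] H} (hU : IsTimeOrderedExp A Q U) :
    ∃ C, ∀ s t : ℝ, 0 ≤ s → s ≤ t → t ≤ 1 → ‖U t s‖ ≤ C := by
  obtain ⟨b, hb, h⟩ := hU.norm_le
  refine ⟨Real.exp b, fun s t hs hst ht => (h s t hs hst ht).trans (Real.exp_le_exp.2 ?_)⟩
  nlinarith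

/-- Time-ordered exponentials are unique. -/
theorem IsTimeOrderedExp.unique {A : ℝ → H →ₗ.[ℂ] H} {Q : H →ₗ.[ℂ] H}
    {U U' : ℝ → ℝ → H →L[ℂ] H} (hQ : Dense (Q.domain : Set H)) (hU : IsTimeOrderedExp A Q U)
    (hU' : IsTimeOrderedExp A Q U') {s t : ℝ} (hs : 0 ≤ s) (hst : s ≤ t) (ht : t ≤ 1) :
    U' t s = U t s := by
  obtain ⟨C, hC⟩ := hU'.exists_norm_le
  refine ContinuousLinearMap.ext_on (s := Q.domain) ?_ fun v hv => ?_
  · simpa using hQ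
  -- The curve `r ↦ U'(t,r) U(r,s) v` is constant: by `mapsTo` the vector `U(r,s) v` lies in the
  -- domain where `deriv_right` applies, and the two terms cancel because the operator `A r` is
  -- single-valued. Its endpoint values are the two evolutions.
  have hd : ∀ r ∈ Icc s t,
      HasDerivWithinAt (fun r => U' t r (U r s v)) 0 (Icc s t) r := fun r hr => by
    have h0r := hs.trans hr.1
    have hr1 := hr.2.trans ht
    obtain ⟨y, hy, hdy⟩ := hU.deriv_left v hv s r hs hr.1 hr1
    obtain ⟨y', hy', hdy'⟩ := hU'.deriv_right _ (hU.mapsTo v hv s r hs hr.1 hr1) r t h0r hr.2 ht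
    have e : y' = y := LinearPMap.mem_graph_snd_inj _ hy' hy rfl
    subst e
    have hsub : Icc s t ⊆ Icc 0 t := Icc_subset_Icc_left hs
    have := hasDerivWithinAt_strong_apply (φ := fun r => U' t r) (S := Icc s t) (C := C)
      (fun σ hσ => hC σ t (hs.trans hσ.1) hσ.2 ht)
      ((hU'.toIsEvolutionSystem.continuousOn_right ht y' r ⟨h0r, hr.2⟩).mono hsub)
      (hdy'.mono hsub) (hdy.mono (Icc_subset_Icc_right ht))
    rwa [neg_add_cancel] at this
  have h := eq_of_hasDerivWithinAt_zero hst hd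
  simpa [hU.self t ⟨hs.trans hst, ht⟩, hU'.self t ⟨hs.trans hst, ht⟩,
    hU.self s ⟨hs, hst.trans ht⟩] using h.symm

variable {R : H →L[ℂ] H} {J K : ℕ → H →L[ℂ] H} {a : ℕ → ℝ → H →L[ℂ] H} {ν : ℝ}

/-- The evolution system generated by `a` is a time-ordered exponential. -/
theorem isTimeOrderedExp_evol (hc : Cutoff R J K) (ha : IsGenerator R a ν) {A : ℝ → H →ₗ.[ℂ] H}
    {Q : H →ₗ.[ℂ] H} (hQ : ∀ x y, (x, y) ∈ Q.graph ↔ x = R y)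
    (hA : ∀ t ∈ Icc (0 : ℝ) 1, ∀ z, (R z, a 0 t z) ∈ (A t).graph) :
    IsTimeOrderedExp A Q (evol J K a) := by
  obtain ⟨ν', ha'⟩ := ha.shift
  have hdom : ∀ v ∈ Q.domain, ∃ z, v = R z := fun v hv =>
    ⟨Q ⟨v, hv⟩, (hQ _ _).1 (Q.mem_graph ⟨v, hv⟩)⟩
  refine { isEvolutionSystem_evol hc ha with
    norm_le := ⟨ν, ha.nonneg, fun s t hs hst ht =>
      ContinuousLinearMap.opNorm_le_bound _ (Real.exp_pos _).le
        (norm_evol_apply_le hc ha ⟨hs, hst, ht⟩)⟩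
    deriv_left := fun v hv s t hs hst ht => ?_
    deriv_right := fun v hv s t hs hst ht => ?_
    mapsTo := fun v hv s t hs hst ht => ?_
    continuous_dom := fun v hv => ?_ }
  all_goals obtain ⟨z, rfl⟩ := hdom v hv
  · refine ⟨_, ?_, hasDerivWithinAt_evol_left hc ha hs hst ht z⟩
    rw [evol_R hc ha (t := t) (s := s) ⟨hs, hst, ht⟩]
    exact hA t ⟨hs.trans hst, ht⟩ _
  · exact ⟨_, hA s ⟨hs, hst.trans ht⟩ z, hasDerivWithinAt_evol_right hc ha hs hst ht z⟩
  · rw [evol_R hc ha (t := t) (s := s) ⟨hs, hst, ht⟩]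
    exact LinearPMap.mem_domain_of_mem_graph ((hQ _ _).2 rfl)
  · exact ⟨fun p => evol J K (shiftGen R a) p.1 p.2 z, (isEvolutionSystem_evol hc ha').continuous z,
      fun p hp => (hQ _ _).2 (evol_R hc ha hp z)⟩

/-- The commutation relations of an evolution system with a solution of the Heisenberg equation. -/
theorem evol_commutation (hc : Cutoff R J K) (ha : IsGenerator R a ν)
    {φ φ₁ φd : ℝ → H →L[ℂ] H} {κ : ℝ → ℂ} (hκ : ContinuousOn κ (Icc 0 1))
    (hφ : ∀ t ∈ Icc (0 : ℝ) 1, HasDerivWithinAt φ (φd t) (Icc 0 1) t)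
    (hφR : ∀ t ∈ Icc (0 : ℝ) 1, φ t * R = R * (φ t + φ₁ t * R))
    (hH : ∀ t ∈ Icc (0 : ℝ) 1, φd t * R =
      a 0 t * (φ t + φ₁ t * R) - φ t * (a 0 t + a 1 t * R) - κ t • (R * R)) (z : H) :
    evol J K a 1 0 (φ 0 z) = φ 1 (evol J K (shiftGen R a) 1 0 z) +
      (∫ τ in (0 : ℝ)..1, κ τ) • evol J K a 1 0 (R z) := by
  obtain ⟨ν₁, ha₁⟩ := ha.shift
  obtain ⟨ν₂, ha₂⟩ := ha₁.shift
  set U := evol J K a with hUdef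
  set V := evol J K (shiftGen R a) with hVdef
  set W := evol J K (shiftGen R (shiftGen R a)) with hWdef
  have hU : IsEvolutionSystem U := isEvolutionSystem_evol hc ha
  have hV : IsEvolutionSystem V := isEvolutionSystem_evol hc ha₁
  -- With `φ = π(f) R`, the expression below is `U(1,r) π(f(r)) U(r,0) R² z` plus the accumulated
  -- scalar term, and its `r`-derivative vanishes by the Heisenberg equation. The extra `R` puts `φ
  -- r (V r 0 (R z))` in the range of `R`, where `U(1,·)` is differentiable.
  have key : ∀ z, U 1 0 (φ 0 (R z)) = φ 1 (V 1 0 (R z)) +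
      (∫ τ in (0 : ℝ)..1, κ τ) • U 1 0 (R (R z)) := by
    intro z
    have hd : ∀ r ∈ Icc (0 : ℝ) 1, HasDerivWithinAt (fun r => U 1 r (φ r (V r 0 (R z))) +
        (∫ τ in (0 : ℝ)..r, κ τ) • U 1 0 (R (R z))) 0 (Icc 0 1) r := fun r hr => by
      have htri : (r, (0 : ℝ)) ∈ triangle := ⟨le_rfl, hr.1, hr.2⟩
      have hVW : V r 0 (R z) = R (W r 0 z) := evol_R hc ha₁ htri z
      have hUV : U r 0 (R (R z)) = R (R (W r 0 z)) := by
        rw [← hVW]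
        exact evol_R hc ha htri (R z)
      have h1 : HasDerivWithinAt (fun r => φ r (V r 0 (R z)))
          (φd r (V r 0 (R z)) + φ r (shiftGen R a 0 r (W r 0 z))) (Icc 0 1) r :=
        hasDerivWithinAt_op_apply (hφ r hr) (hasDerivWithinAt_evol_left hc ha₁ le_rfl hr.1 hr.2 z)
      have h2 : φ r (V r 0 (R z)) = R ((φ r + φ₁ r * R) (W r 0 z)) := by
        rw [hVW]
        exact DFunLike.congr_fun (hφR r hr) _
      have h3 : HasDerivWithinAt (fun σ => U 1 σ (φ r (V r 0 (R z))))
          (-(U 1 r (a 0 r ((φ r + φ₁ r * R) (W r 0 z))))) (Icc 0 1) r := by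
        rw [h2]
        exact hasDerivWithinAt_evol_right hc ha hr.1 hr.2 le_rfl _
      have h4 := hasDerivWithinAt_strong_apply (φ := fun σ => U 1 σ) (C := Real.exp ν) (r := r)
        (S := Icc 0 1) (x := fun r => φ r (V r 0 (R z)))
        (fun σ hσ => ContinuousLinearMap.opNorm_le_bound _ (Real.exp_pos _).le fun v =>
          (norm_evol_apply_le hc ha ⟨hσ.1, hσ.2, le_rfl⟩ v).trans (by
            gcongr
            nlinarith [ha.nonneg, hσ.1, hσ.2]))
        (hU.continuousOn_right le_rfl _ r hr) h3 h1
      have h5 : HasDerivWithinAt (fun r => ∫ τ in (0 : ℝ)..r, κ τ) (κ r) (Icc 0 1) r :=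
        hasDerivWithinAt_of_integral_right 0 hκ (fun t _ => (zero_add _).symm) hr
      refine (h4.add (h5.smul_const (U 1 0 (R (R z))))).congr_deriv ?_
      have h6 := DFunLike.congr_fun (hH r hr) (W r 0 z)
      simp only [mul_apply_eq_comp, sub_apply, smul_apply] at h6
      have h7 : U 1 0 (R (R z)) = U 1 r (R (R (W r 0 z))) := by
        rw [← hUV, ← hU.comp 0 r 1 le_rfl hr.1 hr.2 le_rfl]
        rfl
      rw [hVW, h6, h7]
      simp only [shiftGen, zero_add, map_add, map_sub, map_smul]
      abel
    have h := eq_of_hasDerivWithinAt_zero zero_le_one hd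
    simp only [hU.self 1 ⟨zero_le_one, le_rfl⟩, hV.self 0 ⟨le_rfl, zero_le_one⟩,
      intervalIntegral.integral_same, zero_smul, add_zero, ContinuousLinearMap.id_apply] at h
    exact h.symm
  -- Both sides are bounded operators in `z`, so the extra `R` is removed by density.
  exact congrFun (hc.dense.equalizer (g := fun z => U 1 0 (φ 0 z))
    (h := fun z => φ 1 (V 1 0 z) + (∫ τ in (0 : ℝ)..1, κ τ) • U 1 0 (R z))
    (by fun_prop) (by fun_prop) (funext key)) z

end Uniqueness

namespace PosEnergyRep

variable {c : ℝ} {H : Type*} [NormedAddCommGroup H] [InnerProductSpace ℂ H]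
  (ρ : PosEnergyRep c H)

/-! ### Finite energy vectors -/

/-- The vectors of energy `μ`. -/
def energy (μ : ℝ) : Submodule ℂ ρ.W := Module.End.eigenspace (ρ.L 0) (μ : ℂ)

variable {ρ}

theorem mem_energy {μ : ℝ} {v : ρ.W} : v ∈ ρ.energy μ ↔ ρ.L 0 v = (μ : ℂ) • v :=
  Module.End.mem_eigenspace_iff

theorem L_zero_L (n : ℤ) (v : ρ.W) :
    ρ.L 0 (ρ.L n v) = ρ.L n (ρ.L 0 v) - (n : ℂ) • ρ.L n v := by
  have h := ρ.commutator 0 n v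
  have e : (if (0 : ℤ) + n = 0 then (c / 12 : ℂ) * (((0 : ℤ) : ℂ) ^ 3 - ((0 : ℤ) : ℂ)) else 0) = 0 := by
    split_ifs <;> simp
  rw [e, zero_smul, add_zero, zero_add, sub_eq_iff_eq_add] at h
  rw [h]
  module

theorem L_mem_energy {μ : ℝ} {v : ρ.W} (hv : v ∈ ρ.energy μ) (n : ℤ) :
    ρ.L n v ∈ ρ.energy (μ - n) := by
  rw [mem_energy] at hv ⊢
  rw [L_zero_L, hv, map_smul]
  push_cast
  module

/-- This is the expectation value of `[L_n, L_{-n}]` in an energy eigenvector. -/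
theorem norm_L_neg_sq {μ : ℝ} {v : ρ.W} (hv : v ∈ ρ.energy μ) (n : ℤ) :
    ‖ρ.L (-n) v‖ ^ 2 =
      ‖ρ.L n v‖ ^ 2 + (2 * n * μ + c / 12 * ((n : ℝ) ^ 3 - n)) * ‖v‖ ^ 2 := by
  have h := ρ.commutator n (-n) v
  rw [add_neg_cancel, if_pos rfl, mem_energy.1 hv] at h
  have h2 := congrArg (fun x => inner ℂ v x) h
  simp only [inner_sub_right, inner_add_right, inner_smul_right] at h2
  have e1 : inner ℂ v (ρ.L n (ρ.L (-n) v)) = (‖ρ.L (-n) v‖ : ℂ) ^ 2 := by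
    have h := inner_self_eq_norm_sq_to_K (𝕜 := ℂ) (ρ.L (-n) v)
    rwa [ρ.unitary, neg_neg] at h
  have e2 : inner ℂ v (ρ.L (-n) (ρ.L n v)) = (‖ρ.L n v‖ : ℂ) ^ 2 := by
    have h := inner_self_eq_norm_sq_to_K (𝕜 := ℂ) (ρ.L n v)
    rwa [ρ.unitary] at h
  have e3 : inner ℂ v v = (‖v‖ : ℂ) ^ 2 := inner_self_eq_norm_sq_to_K (𝕜 := ℂ) v
  rw [e1, e2, e3] at h2
  have h3 : ((‖ρ.L (-n) v‖ ^ 2 - ‖ρ.L n v‖ ^ 2 : ℝ) : ℂ) =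
      (((2 * n * μ + c / 12 * ((n : ℝ) ^ 3 - n)) * ‖v‖ ^ 2 : ℝ) : ℂ) := by
    push_cast at h2 ⊢
    rw [h2]
    ring
  have h4 := Complex.ofReal_injective h3
  linarith

theorem inner_energy_eq_zero {μ ν : ℝ} (h : μ ≠ ν) {v w : ρ.W} (hv : v ∈ ρ.energy μ)
    (hw : w ∈ ρ.energy ν) : inner ℂ v w = 0 := by
  have h1 := ρ.unitary 0 v w
  rw [neg_zero, mem_energy.1 hv, mem_energy.1 hw, inner_smul_left, inner_smul_right,
    Complex.conj_ofReal] at h1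
  have h2 : ((μ : ℂ) - ν) * inner ℂ v w = 0 := by rw [sub_mul, h1, sub_self]
  refine (mul_eq_zero.1 h2).resolve_left ?_
  exact sub_ne_zero.2 fun h3 => h (by exact_mod_cast h3)

/-- The energy is nonnegative. -/
theorem energy_nonneg {μ : ℝ} {v : ρ.W} (hv : v ∈ ρ.energy μ) (hv0 : v ≠ 0) : 0 ≤ μ := by
  by_contra hμ
  rw [not_le] at hμ
  set S : Set ℝ := {ν : ℝ | Module.End.HasEigenvalue (ρ.L 0) (ν : ℂ) ∧ ν ≤ μ} with hS
  have hne : S.Nonempty := ⟨μ, Module.End.hasEigenvalue_of_hasEigenvector ⟨hv, hv0⟩, le_rfl⟩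
  -- Take the lowest eigenvalue `ν ≤ μ < 0`. Its eigenvector is killed by `L_1`, which would lower
  -- the energy, so `‖L_{-1} w‖² = 2 ν ‖w‖²` would be negative.
  obtain ⟨ν, ⟨hν, hνμ⟩, hmin⟩ := (ρ.discrete μ).exists_minimal hne
  obtain ⟨w, hw, hw0⟩ := hν.exists_hasEigenvector
  have hw' : w ∈ ρ.energy ν := hw
  have h1 : ρ.L 1 w = 0 := by
    by_contra h1
    have h3 := L_mem_energy hw' 1
    rw [Int.cast_one] at h3
    have h2 : ν - 1 ∈ S := ⟨Module.End.hasEigenvalue_of_hasEigenvector ⟨h3, h1⟩, by linarith⟩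
    have := hmin h2 (by linarith)
    linarith
  have h2 := norm_L_neg_sq hw' 1
  rw [h1, norm_zero] at h2
  have h3 : 0 < ‖w‖ ^ 2 := by positivity
  have h4 : 0 ≤ ‖ρ.L (-1) w‖ ^ 2 := by positivity
  rw [h2] at h4
  norm_num at h4
  nlinarith

/-- Induction on the energy. For `u = L_n v`, of energy `μ - n`, Cauchy–Schwarz gives `‖u‖² ≤ ‖v‖
‖L_{-n} u‖`, and `‖L_{-n} u‖²` is `‖L_n u‖²` plus the commutator term. The form of the constant is
chosen so that the `n³` terms cancel and the bound reproduces itself. -/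
theorem norm_L_sq_le (hc : 0 ≤ c) {n : ℤ} (hn : 1 ≤ n) {μ : ℝ} {v : ρ.W} (hv : v ∈ ρ.energy μ) :
    ‖ρ.L n v‖ ^ 2 ≤ (μ ^ 2 + c * n ^ 2 * μ / 12) * ‖v‖ ^ 2 := by
  have hn' : (1 : ℝ) ≤ n := by exact_mod_cast hn
  obtain ⟨k, hk⟩ := exists_nat_gt μ
  induction k generalizing μ v with
  | zero =>
    have : v = 0 := by
      by_contra h0
      have := energy_nonneg hv h0
      norm_num at hk
      linarith
    simp [this]
  | succ k ih =>
    by_cases hu0 : ρ.L n v = 0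
    · by_cases hv0 : v = 0
      · simp [hv0]
      · have := energy_nonneg hv hv0
        rw [hu0, norm_zero, zero_pow two_ne_zero]
        positivity
    have hu := L_mem_energy hv n
    set u := ρ.L n v with hudef
    have hν := energy_nonneg hu hu0
    have h1 := ih hu (by push_cast at hk; linarith)
    have h2 := norm_L_neg_sq hu n
    have h3 : ‖ρ.L (-n) u‖ ^ 2 ≤ (μ ^ 2 + c * n ^ 2 * μ / 12) * ‖u‖ ^ 2 := by
      rw [h2]
      have h4 : 0 ≤ c * n * ‖u‖ ^ 2 := by positivity
      have h5 : 0 ≤ (n : ℝ) ^ 2 * ‖u‖ ^ 2 := by positivity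
      nlinarith
    have h4 : ‖u‖ ^ 2 ≤ ‖v‖ * ‖ρ.L (-n) u‖ := by
      have : (inner ℂ u u).re = ‖u‖ ^ 2 := inner_self_eq_norm_sq (𝕜 := ℂ) u
      rw [← this]
      conv_lhs => rw [hudef, ρ.unitary]
      exact (Complex.re_le_norm _).trans (norm_inner_le_norm _ _)
    have h5 : 0 < ‖u‖ ^ 2 := by positivity
    have h6 : (‖u‖ ^ 2) ^ 2 ≤ ‖v‖ ^ 2 * ((μ ^ 2 + c * n ^ 2 * μ / 12) * ‖u‖ ^ 2) :=
      calc (‖u‖ ^ 2) ^ 2 ≤ (‖v‖ * ‖ρ.L (-n) u‖) ^ 2 := by gcongr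
        _ = ‖v‖ ^ 2 * ‖ρ.L (-n) u‖ ^ 2 := by ring
        _ ≤ _ := by gcongr
    nlinarith

/-- The linear energy bounds on eigenvectors. -/
theorem norm_L_le_of_mem_energy (hc : 0 ≤ c) (n : ℤ) {μ : ℝ} {v : ρ.W} (hv : v ∈ ρ.energy μ) :
    ‖ρ.L n v‖ ≤ (1 + c) * (1 + |(n : ℝ)|) ^ 2 * ((1 + μ) * ‖v‖) := by
  by_cases hv0 : v = 0
  · simp [hv0]
  have hμ := energy_nonneg hv hv0
  have key : ‖ρ.L n v‖ ^ 2 ≤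
      (μ ^ 2 + c * |(n : ℝ)| ^ 2 * μ / 12 + 2 * |(n : ℝ)| * μ + c / 12 * |(n : ℝ)| ^ 3) *
        ‖v‖ ^ 2 := by
    rcases lt_trichotomy n 0 with h | h | h
    · have h1 := norm_L_sq_le hc (n := -n) (by lia) hv
      have h2 := norm_L_neg_sq hv (-n)
      have h3 : |(n : ℝ)| = ((-n : ℤ) : ℝ) := by
        rw [abs_of_neg (by exact_mod_cast h)]
        push_cast
        ring
      rw [neg_neg] at h2
      rw [h2, h3]
      have h4 : (0 : ℝ) ≤ ((-n : ℤ) : ℝ) := by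
        rw [← h3]
        exact abs_nonneg _
      have h5 : 0 ≤ c * ((-n : ℤ) : ℝ) * ‖v‖ ^ 2 := by positivity
      nlinarith
    · subst h
      rw [mem_energy.1 hv, norm_smul, mul_pow]
      simp
    · have h1 := norm_L_sq_le hc (n := n) (by lia) hv
      rw [abs_of_pos (by exact_mod_cast h : (0 : ℝ) < n)]
      have h4 : (0 : ℝ) ≤ n := by exact_mod_cast h.le
      refine h1.trans (mul_le_mul_of_nonneg_right ?_ (by positivity))
      have h5 : 0 ≤ 2 * n * μ := by positivity
      have h6 : 0 ≤ c / 12 * (n : ℝ) ^ 3 := by positivity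
      linarith
  refine (pow_le_pow_iff_left₀ (norm_nonneg _) (by positivity) two_ne_zero).1 (key.trans ?_)
  rw [mul_pow, mul_pow, mul_pow, ← mul_assoc]
  refine mul_le_mul_of_nonneg_right ?_ (by positivity)
  set x := |(n : ℝ)| with hx
  have hx0 : 0 ≤ x := abs_nonneg _
  -- The difference expands into a polynomial in `c`, `x`, `μ` with nonnegative coefficients. The
  -- cubic growth in `x` is then rounded up to the fourth power, to obtain a square.
  have h1 : μ ^ 2 + c * x ^ 2 * μ / 12 + 2 * x * μ + c / 12 * x ^ 3 ≤
      (1 + c) * (1 + x) ^ 3 * (1 + μ) ^ 2 := by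
    have : 0 ≤ (1 + c) * (1 + x) ^ 3 * (1 + μ) ^ 2 -
      (μ ^ 2 + c * x ^ 2 * μ / 12 + 2 * x * μ + c / 12 * x ^ 3) := by
      ring_nf
      positivity
    linarith
  refine h1.trans (mul_le_mul_of_nonneg_right ?_ (by positivity))
  rw [← pow_mul]
  exact mul_le_mul (le_self_pow₀ (by linarith) two_ne_zero)
    (pow_le_pow_right₀ (by linarith) (by norm_num)) (by positivity) (by positivity)

theorem exists_energy_decomposition (v : ρ.W) :
    ∃ (s : Finset ℝ) (f : ℝ → ρ.W), (∀ μ, f μ ∈ ρ.energy μ) ∧ v = ∑ μ ∈ s, f μ := by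
  have hv : v ∈ ⨆ μ : ℝ, ρ.energy μ := by
    rw [show (⨆ μ : ℝ, ρ.energy μ) = ⊤ from ρ.iSup_eigenspace]
    trivial
  obtain ⟨f, hf, hfv⟩ := (Submodule.mem_iSup_iff_exists_finsupp _ _).1 hv
  exact ⟨f.support, f, hf, hfv.symm⟩

/-- The shift `d` serves sums of vectors `L_n (f μ)`, which have energies `μ - n` and are still
mutually orthogonal. -/
theorem norm_sum_energy_sq {d : ℝ} (s : Finset ℝ) {f : ℝ → ρ.W}
    (hf : ∀ μ, f μ ∈ ρ.energy (μ - d)) : ‖∑ μ ∈ s, f μ‖ ^ 2 = ∑ μ ∈ s, ‖f μ‖ ^ 2 := by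
  classical
  induction s using Finset.induction_on with
  | empty => simp
  | insert μ s hμ ih =>
    rw [Finset.sum_insert hμ, Finset.sum_insert hμ, ← ih, pow_two, pow_two, pow_two]
    refine norm_add_sq_eq_norm_sq_add_norm_sq_of_inner_eq_zero _ _ (𝕜 := ℂ) ?_
    rw [inner_sum]
    refine Finset.sum_eq_zero fun ν hν => inner_energy_eq_zero ?_ (hf μ) (hf ν)
    intro h
    exact hμ (by rwa [show μ = ν by linarith])

/-- The linear energy bounds. -/
theorem norm_L_le (hc : 0 ≤ c) (n : ℤ) (v : ρ.W) :
    ‖ρ.L n v‖ ≤ (1 + c) * (1 + |(n : ℝ)|) ^ 2 * ‖v + ρ.L 0 v‖ := by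
  obtain ⟨s, f, hf, rfl⟩ := exists_energy_decomposition v
  refine (pow_le_pow_iff_left₀ (norm_nonneg _) (by positivity) two_ne_zero).1 ?_
  have e : ∑ μ ∈ s, f μ + ρ.L 0 (∑ μ ∈ s, f μ) = ∑ μ ∈ s, ((1 + μ : ℝ) : ℂ) • f μ := by
    rw [map_sum, ← Finset.sum_add_distrib]
    refine Finset.sum_congr rfl fun μ _ => ?_
    rw [mem_energy.1 (hf μ)]
    push_cast
    module
  rw [e, map_sum, mul_pow, norm_sum_energy_sq (d := n) s fun μ => L_mem_energy (hf μ) n,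
    norm_sum_energy_sq (d := 0) s fun μ => by
      rw [sub_zero]
      exact Submodule.smul_mem _ _ (hf μ), Finset.mul_sum]
  refine Finset.sum_le_sum fun μ _ => ?_
  rw [← mul_pow]
  refine pow_le_pow_left₀ (norm_nonneg _) ((norm_L_le_of_mem_energy hc n (hf μ)).trans ?_) 2
  rw [norm_smul, Complex.norm_real]
  gcongr
  exact le_abs_self _

theorem norm_le_add_L_zero {b : ℝ} (hb : 0 ≤ b) (v : ρ.W) :
    b * ‖v‖ ≤ ‖(b : ℂ) • v + ρ.L 0 v‖ := by
  obtain ⟨s, f, hf, rfl⟩ := exists_energy_decomposition v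
  refine (pow_le_pow_iff_left₀ (by positivity) (norm_nonneg _) two_ne_zero).1 ?_
  have e : (b : ℂ) • ∑ μ ∈ s, f μ + ρ.L 0 (∑ μ ∈ s, f μ) = ∑ μ ∈ s, ((b + μ : ℝ) : ℂ) • f μ := by
    rw [map_sum, Finset.smul_sum, ← Finset.sum_add_distrib]
    refine Finset.sum_congr rfl fun μ _ => ?_
    rw [mem_energy.1 (hf μ)]
    push_cast
    module
  rw [e, mul_pow, norm_sum_energy_sq (d := 0) s fun μ => by simpa using hf μ,
    norm_sum_energy_sq (d := 0) s fun μ => by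
      rw [sub_zero]
      exact Submodule.smul_mem _ _ (hf μ), Finset.mul_sum]
  refine Finset.sum_le_sum fun μ _ => ?_
  rw [← mul_pow]
  refine pow_le_pow_left₀ (by positivity) ?_ 2
  by_cases h0 : f μ = 0
  · simp [h0]
  have hμ := energy_nonneg (hf μ) h0
  rw [norm_smul, Complex.norm_real]
  gcongr
  exact le_trans (by linarith) (le_abs_self _)

variable (ρ) in
/-- The operator `b + L₀` on the finite energy vectors. -/
def addL0 (b : ℝ) : ρ.W →ₗ[ℂ] ρ.W := (b : ℂ) • LinearMap.id + ρ.L 0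

theorem addL0_apply (b : ℝ) (v : ρ.W) : ρ.addL0 b v = (b : ℂ) • v + ρ.L 0 v := rfl

theorem addL0_bijective {b : ℝ} (hb : 0 < b) : Function.Bijective (ρ.addL0 b) := by
  constructor
  · refine (injective_iff_map_eq_zero _).2 fun v hv => ?_
    have h := norm_le_add_L_zero hb.le v
    rw [← addL0_apply, hv, norm_zero] at h
    have := norm_nonneg v
    exact norm_eq_zero.1 (by nlinarith)
  · rw [← LinearMap.range_eq_top, eq_top_iff, ← ρ.iSup_eigenspace]
    refine iSup_le fun μ v hv => ?_
    by_cases hv0 : v = 0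
    · simp [hv0]
    have hμ := energy_nonneg hv hv0
    have hne : ((b : ℂ) + μ) ≠ 0 := by
      have : b + μ ≠ 0 := by positivity
      exact_mod_cast this
    refine ⟨((b : ℂ) + μ)⁻¹ • v, ?_⟩
    rw [map_smul, addL0_apply, mem_energy.1 hv, ← add_smul, smul_smul, inv_mul_cancel₀ hne, one_smul]

/-! ### Resolvents of `L₀` and the bounded operators `L_n (1 + L₀)⁻¹`. -/

variable [CompleteSpace H]

/-- As `D` is bijective on `W`, the operator `S D⁻¹` is defined on all of `W`; being bounded there,
it extends by density. -/
theorem exists_extension {D S : ρ.W →ₗ[ℂ] ρ.W} (hD : Function.Bijective D) {C : ℝ} (hC : 0 ≤ C)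
    (h : ∀ w, ‖S w‖ ≤ C * ‖D w‖) :
    ∃ T : H →L[ℂ] H, ‖T‖ ≤ C ∧ ∀ w : ρ.W, T (D w) = S w := by
  set e := LinearEquiv.ofBijective D hD with he
  set T₀ : ρ.W →L[ℂ] H := (ρ.W.subtype ∘ₗ S ∘ₗ e.symm.toLinearMap).mkContinuous C (fun w => by
    have h1 := h (e.symm w)
    have h2 : D (e.symm w) = w := e.apply_symm_apply w
    rw [h2] at h1
    exact h1) with hT₀
  have hd : DenseRange ρ.W.subtypeL := by
    simpa [DenseRange] using ρ.dense
  have hT : ∀ w : ρ.W, T₀.extend ρ.W.subtypeL w = T₀ w := fun w =>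
    ContinuousLinearMap.extend_eq T₀ hd isUniformEmbedding_subtype_val.isUniformInducing w
  refine ⟨T₀.extend ρ.W.subtypeL, ContinuousLinearMap.opNorm_le_bound _ hC fun x => ?_, fun w => ?_⟩
  · refine hd.induction_on (p := fun x => ‖T₀.extend ρ.W.subtypeL x‖ ≤ C * ‖x‖) x
      (isClosed_le (by fun_prop) (by fun_prop)) fun w => ?_
    have : ρ.W.subtypeL w = (w : H) := rfl
    rw [this, hT]
    exact T₀.le_of_opNorm_le (LinearMap.mkContinuous_norm_le _ hC _) w
  · rw [hT]
    have h2 : e.symm (D w) = w := e.symm_apply_apply w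
    change ((S (e.symm (D w)) : ρ.W) : H) = S w
    rw [h2]

open Classical in
variable (ρ) in
/-- The resolvent `(b + L₀)⁻¹`. -/
def res (b : ℝ) : H →L[ℂ] H :=
  if h : ∃ T : H →L[ℂ] H, ‖T‖ ≤ 1 / b ∧ ∀ w : ρ.W, T (ρ.addL0 b w) = w then h.choose else 0

open Classical in
variable (ρ) in
/-- The bounded operator `L_n (1 + L₀)⁻¹`. -/
def ell (n : ℤ) : H →L[ℂ] H :=
  if h : ∃ T : H →L[ℂ] H, ‖T‖ ≤ (1 + c) * (1 + |(n : ℝ)|) ^ 2 ∧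
    ∀ w : ρ.W, T (ρ.addL0 1 w) = ρ.L n w then h.choose else 0

theorem res_spec {b : ℝ} (hb : 0 < b) :
    ‖ρ.res b‖ ≤ 1 / b ∧ ∀ w : ρ.W, ρ.res b (ρ.addL0 b w) = w := by
  have h : ∃ T : H →L[ℂ] H, ‖T‖ ≤ 1 / b ∧ ∀ w : ρ.W, T (ρ.addL0 b w) = w := by
    refine exists_extension (S := LinearMap.id) (addL0_bijective hb) (by positivity) fun w => ?_
    have := norm_le_add_L_zero hb.le w
    rw [one_div_mul_eq_div, le_div_iff₀ hb, mul_comm]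
    exact this
  rw [res, dif_pos h]
  exact h.choose_spec

theorem ell_spec (hc : 0 ≤ c) (n : ℤ) :
    ‖ρ.ell n‖ ≤ (1 + c) * (1 + |(n : ℝ)|) ^ 2 ∧ ∀ w : ρ.W, ρ.ell n (ρ.addL0 1 w) = ρ.L n w := by
  have h : ∃ T : H →L[ℂ] H, ‖T‖ ≤ (1 + c) * (1 + |(n : ℝ)|) ^ 2 ∧
      ∀ w : ρ.W, T (ρ.addL0 1 w) = ρ.L n w := by
    refine exists_extension (addL0_bijective one_pos) (by positivity) fun w => ?_
    have := norm_L_le hc n w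
    simpa [addL0_apply] using! this
  rw [ell, dif_pos h]
  exact h.choose_spec

variable (ρ) in
/-- The inverse `(1 + L₀)⁻¹`, with range `H₁`. -/
def R : H →L[ℂ] H := ρ.res 1

theorem R_addL0 (w : ρ.W) : ρ.R (ρ.addL0 1 w) = w := (res_spec one_pos).2 w

variable (ρ) in
theorem op_ext {S T : H →L[ℂ] H} (h : ∀ w : ρ.W, S w = T w) : S = T :=
  ContinuousLinearMap.ext_on (s := ρ.W) (by simpa using ρ.dense) fun w hw => h ⟨w, hw⟩

theorem op_ext_addL0 {S T : H →L[ℂ] H} {b : ℝ} (hb : 0 < b)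
    (h : ∀ w : ρ.W, S (ρ.addL0 b w) = T (ρ.addL0 b w)) : S = T := by
  refine ρ.op_ext fun w => ?_
  obtain ⟨w, rfl⟩ := (addL0_bijective hb).2 w
  exact h w

theorem inner_op_symm {S T S' T' : H →L[ℂ] H}
    (h : ∀ v w : ρ.W, inner ℂ (S v) (T w) = inner ℂ (S' v) (T' w)) (x y : H) :
    inner ℂ (S x) (T y) = inner ℂ (S' x) (T' y) := by
  have hd : DenseRange (fun w : ρ.W => (w : H)) := by simpa [DenseRange] using ρ.dense
  refine hd.induction_on₂ (p := fun x y => inner ℂ (S x) (T y) = inner ℂ (S' x) (T' y))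
    (isClosed_eq (by fun_prop) (by fun_prop)) h x y

theorem inner_op_symm_addL0 {S T S' T' : H →L[ℂ] H} {b : ℝ} (hb : 0 < b)
    (h : ∀ v w : ρ.W, inner ℂ (S (ρ.addL0 b v)) (T (ρ.addL0 b w)) =
      inner ℂ (S' (ρ.addL0 b v)) (T' (ρ.addL0 b w))) (x y : H) :
    inner ℂ (S x) (T y) = inner ℂ (S' x) (T' y) := by
  refine inner_op_symm (ρ := ρ) (fun v w => ?_) x y
  obtain ⟨v, rfl⟩ := (addL0_bijective hb).2 v
  obtain ⟨w, rfl⟩ := (addL0_bijective hb).2 w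
  exact h v w

theorem res_symm {b : ℝ} (hb : 0 < b) (x y : H) :
    inner ℂ (ρ.res b x) y = inner ℂ x (ρ.res b y) := by
  refine inner_op_symm_addL0 (ρ := ρ) (T := ContinuousLinearMap.id ℂ H)
    (S' := ContinuousLinearMap.id ℂ H) hb (fun v w => ?_) x y
  have h := ρ.unitary 0 v w
  rw [neg_zero] at h
  simp only [ContinuousLinearMap.id_apply, (res_spec hb).2]
  change inner ℂ v (ρ.addL0 b w) = inner ℂ (ρ.addL0 b v) w
  simp only [addL0_apply, inner_add_left, inner_add_right, inner_smul_left, inner_smul_right, h,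
    Complex.conj_ofReal]

theorem inner_ell (hc : 0 ≤ c) (n : ℤ) (x y : H) :
    inner ℂ (ρ.ell n x) (ρ.R y) = inner ℂ (ρ.R x) (ρ.ell (-n) y) := by
  refine inner_op_symm_addL0 (ρ := ρ) one_pos (fun v w => ?_) x y
  simp only [(ell_spec hc _).2, R_addL0]
  exact ρ.unitary n v w

/-- The kernel of a symmetric operator is orthogonal to its range, which contains the dense space
`W`. -/
theorem R_injective : Function.Injective ρ.R := by
  refine (injective_iff_map_eq_zero _).2 fun x hx => ?_
  refine ρ.dense.eq_zero_of_inner_left (𝕜 := ℂ) fun w hw => ?_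
  have h : w = ρ.R (ρ.addL0 1 ⟨w, hw⟩) := (R_addL0 (ρ := ρ) ⟨w, hw⟩).symm
  rw [h, R, ← res_symm one_pos]
  rw [R] at hx
  rw [hx, inner_zero_left]

theorem denseRange_R : DenseRange ρ.R := by
  refine ρ.dense.mono fun w hw => ⟨ρ.addL0 1 ⟨w, hw⟩, R_addL0 _⟩

/-- This is `[L₀, L_n] = -n L_n` in terms of bounded operators: the bracket on the right is `(1 +
L₀) L_n R²`. -/
theorem ell_mul_R (hc : 0 ≤ c) (n : ℤ) :
    ρ.ell n * ρ.R = ρ.R * (ρ.ell n - (n : ℂ) • (ρ.ell n * ρ.R)) := by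
  refine op_ext_addL0 (ρ := ρ) one_pos fun w => ?_
  obtain ⟨w, rfl⟩ := (addL0_bijective (ρ := ρ) one_pos).2 w
  simp only [mul_apply_eq_comp, sub_apply, smul_apply, R_addL0, (ell_spec hc _).2]
  have h : ((ρ.L n (ρ.addL0 1 w) : ρ.W) : H) - (n : ℂ) • (ρ.L n w : H) =
      (ρ.addL0 1 (ρ.L n w) : ρ.W) := by
    rw [← Submodule.coe_smul, ← Submodule.coe_sub]
    congr 1
    rw [addL0_apply, addL0_apply, L_zero_L, map_add, map_smul]
    abel
  rw [h, R_addL0]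

/-- The Virasoro relation composed with `R²` on the right; the brackets are again `(1 + L₀) L_n R²`,
so `ell m` applied to them gives `L_m L_n R²`. -/
theorem ell_commutator (hc : 0 ≤ c) (m n : ℤ) :
    ρ.ell m * (ρ.ell n - (n : ℂ) • (ρ.ell n * ρ.R)) -
      ρ.ell n * (ρ.ell m - (m : ℂ) • (ρ.ell m * ρ.R)) =
    ((m : ℂ) - n) • (ρ.ell (m + n) * ρ.R) +
      (if m + n = 0 then (c / 12 : ℂ) * ((m : ℂ) ^ 3 - m) else 0) • (ρ.R * ρ.R) := by
  refine op_ext_addL0 (ρ := ρ) one_pos fun w => ?_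
  obtain ⟨w, rfl⟩ := (addL0_bijective (ρ := ρ) one_pos).2 w
  have h : ∀ n, ((ρ.L n (ρ.addL0 1 w) : ρ.W) : H) - (n : ℂ) • (ρ.L n w : H) =
      (ρ.addL0 1 (ρ.L n w) : ρ.W) := fun n => by
    rw [← Submodule.coe_smul, ← Submodule.coe_sub]
    congr 1
    rw [addL0_apply, addL0_apply, L_zero_L, map_add, map_smul]
    abel
  simp only [mul_apply_eq_comp, sub_apply, smul_apply, add_apply, R_addL0, (ell_spec hc _).2, h]
  have := congrArg (Subtype.val) (ρ.commutator m n w)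
  simpa only [Submodule.coe_sub, Submodule.coe_add, Submodule.coe_smul] using this

theorem ell_zero (hc : 0 ≤ c) : ρ.ell 0 = 1 - ρ.R := by
  refine op_ext_addL0 (ρ := ρ) one_pos fun w => ?_
  rw [(ell_spec hc _).2, sub_apply, one_apply_eq_self, R_addL0, addL0_apply]
  simp

variable (ρ) in
/-- The regularizing operators `(1 + (1 + L₀) / (n + 1))⁻¹`. -/
def J (n : ℕ) : H →L[ℂ] H := ((n : ℂ) + 1) • ρ.res (n + 2)

variable (ρ) in
/-- The operators `(1 + L₀) J n`. -/
def K (n : ℕ) : H →L[ℂ] H := ((n : ℂ) + 1) • (1 - ρ.J n)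

theorem R_mul_one_sub_J (n : ℕ) : ρ.R * (1 - ρ.J n) = ρ.res (n + 2) := by
  have hb : (0 : ℝ) < n + 2 := by positivity
  refine op_ext_addL0 (ρ := ρ) hb fun w => ?_
  simp only [mul_apply_eq_comp, sub_apply, one_apply_eq_self, J, smul_apply, (res_spec hb).2]
  have h : ((ρ.addL0 (n + 2) w : ρ.W) : H) - ((n : ℂ) + 1) • (w : H) = (ρ.addL0 1 w : ρ.W) := by
    rw [← Submodule.coe_smul, ← Submodule.coe_sub]
    congr 1
    rw [addL0_apply, addL0_apply]
    push_cast
    module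
  rw [h, R_addL0]

theorem one_sub_J_mul_R (n : ℕ) : (1 - ρ.J n) * ρ.R = ρ.res (n + 2) := by
  have hb : (0 : ℝ) < n + 2 := by positivity
  refine op_ext_addL0 (ρ := ρ) one_pos fun w => ?_
  obtain ⟨w, rfl⟩ := (addL0_bijective (ρ := ρ) hb).2 w
  have h1 : ρ.addL0 1 (ρ.addL0 (n + 2) w) = ρ.addL0 (n + 2) (ρ.addL0 1 w) := by
    simp only [addL0_apply, map_add, map_smul]
    module
  have h : ((ρ.addL0 (n + 2) w : ρ.W) : H) - ((n : ℂ) + 1) • (w : H) = (ρ.addL0 1 w : ρ.W) := by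
    rw [← Submodule.coe_smul, ← Submodule.coe_sub]
    congr 1
    rw [addL0_apply, addL0_apply]
    push_cast
    module
  simp only [mul_apply_eq_comp, sub_apply, one_apply_eq_self, J, smul_apply, R_addL0]
  rw [h1, (res_spec hb).2, (res_spec hb).2, h]

/-- Since `1 - J n = (1 + L₀)(n + 2 + L₀)⁻¹`, the product `(1 - J n) R` is the resolvent at `n + 2`,
of norm at most `1/(n+2)`. -/
theorem cutoff : Cutoff ρ.R ρ.J ρ.K where
  dense := denseRange_R
  norm_R := by simpa using! (res_spec (ρ := ρ) one_pos).1
  norm_J n := by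
    have hb : (0 : ℝ) < n + 2 := by positivity
    rw [J, norm_smul, show ((n : ℂ) + 1) = ((n + 1 : ℝ) : ℂ) by push_cast; rfl, Complex.norm_real,
      Real.norm_of_nonneg (by positivity)]
    calc ((n : ℝ) + 1) * ‖ρ.res (n + 2)‖ ≤ (n + 1) * (1 / (n + 2)) := by
          gcongr
          exact (res_spec hb).1
      _ ≤ 1 := by
          rw [mul_one_div, div_le_one hb]
          linarith
  symm n x y := by
    have hb : (0 : ℝ) < n + 2 := by positivity
    simp only [J, smul_apply, inner_smul_left, inner_smul_right, res_symm hb]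
    simp
  comm n := by
    have h := (R_mul_one_sub_J (ρ := ρ) n).trans (one_sub_J_mul_R n).symm
    rw [mul_sub, sub_mul, mul_one, one_mul, sub_right_inj] at h
    exact h.symm
  R_mul n := by rw [K, mul_smul_comm, R_mul_one_sub_J, J]
  mul_R n := by rw [K, smul_mul_assoc, one_sub_J_mul_R, J]
  err n := by
    have hb : (0 : ℝ) < n + 2 := by positivity
    rw [one_sub_J_mul_R]
    refine (res_spec hb).1.trans (one_div_le_one_div_of_le (by positivity) (by linarith))

/-- The graph of `1 + L₀`. -/
theorem mem_graph_oneAddL0 (x y : H) : (x, y) ∈ ρ.oneAddL0.graph ↔ x = ρ.R y := by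
  set T : H →ₗ.[ℂ] H := ⟨ρ.W, ρ.W.subtype ∘ₗ ρ.L 0⟩ with hT
  have hsub : ∀ p ∈ T.graph.topologicalClosure, p.1 = ρ.R (p.1 + p.2) := by
    intro p hp
    refine closure_minimal (s := (T.graph : Set (H × H))) (t := {p | p.1 = ρ.R (p.1 + p.2)})
      ?_ (isClosed_eq (by fun_prop) (by fun_prop)) hp
    rintro ⟨u, v⟩ h
    obtain ⟨w, rfl, rfl⟩ := (LinearPMap.mem_graph_iff _).1 h
    change (w : H) = ρ.R (w + (ρ.L 0 w : ρ.W))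
    have := R_addL0 (ρ := ρ) w
    rw [addL0_apply] at this
    simpa using this.symm
  -- `LinearPMap.closure` returns the operator itself when it is not closable, so closability has to
  -- come first. It holds because a limit point `(0, y)` of the graph satisfies `R y = 0`.
  have hcl : T.IsClosable := by
    refine ⟨T.graph.topologicalClosure.toLinearPMap, ?_⟩
    rw [Submodule.toLinearPMap_graph_eq]
    intro p hp hp0
    have h := hsub p hp
    rw [hp0, zero_add] at h
    exact R_injective (h.symm.trans (map_zero _).symm)
  have hgr : ∀ p : H × H, p ∈ ρ.closedL0.graph ↔ p ∈ T.graph.topologicalClosure := fun p => by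
    rw [hcl.graph_closure_eq_closure_graph]
    rfl
  have h1 : (x, y) ∈ ρ.oneAddL0.graph ↔ (x, y - x) ∈ ρ.closedL0.graph := by
    simp only [LinearPMap.mem_graph_iff]
    constructor
    · rintro ⟨w, h1, h2⟩
      refine ⟨w, h1, ?_⟩
      rw [← h2, ← h1]
      exact (add_sub_cancel_left (w : H) (ρ.closedL0 w)).symm
    · rintro ⟨w, h1, h2⟩
      refine ⟨w, h1, ?_⟩
      have : ρ.oneAddL0 w = (w : H) + ρ.closedL0 w := rfl
      rw [this, h1, h2]
      abel
  rw [h1, hgr]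
  constructor
  · intro h
    simpa using hsub _ h
  · rintro rfl
    have hd : DenseRange (fun w : ρ.W => (ρ.addL0 1 w : H)) := by
      have : (range fun w : ρ.W => (ρ.addL0 1 w : H)) = ρ.W := by
        ext u
        refine ⟨?_, fun hu => ?_⟩
        · rintro ⟨w, rfl⟩
          exact (ρ.addL0 1 w).2
        · obtain ⟨w, hw⟩ := (addL0_bijective (ρ := ρ) one_pos).2 ⟨u, hu⟩
          exact ⟨w, by simp [hw]⟩
      rw [DenseRange, this]
      exact ρ.dense
    refine hd.induction_on (p := fun y => (ρ.R y, y - ρ.R y) ∈ T.graph.topologicalClosure) y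
      (T.graph.isClosed_topologicalClosure.preimage (by fun_prop)) fun w => ?_
    refine T.graph.le_topologicalClosure ((LinearPMap.mem_graph_iff _).2 ⟨w, ?_, ?_⟩)
    · exact (R_addL0 w).symm
    · simp only [R_addL0]
      rw [addL0_apply]
      change ((ρ.L 0 w : ρ.W) : H) = _
      simp

end PosEnergyRep

/-! ### Smooth functions on the circle and on the cylinder -/

/-- Smooth complex functions on the circle. -/
structure IsSmoothPeriodic (f : ℝ → ℂ) : Prop where
  smooth : ContDiff ℝ ∞ f
  periodic : Function.Periodic f (2 * Real.pi)

/-- The Fourier coefficients of a `2π`-periodic function. -/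
def coef (f : ℝ → ℂ) (n : ℤ) : ℂ := fourierCoeffOn Real.two_pi_pos f n

/-- The character `exp (i n θ)`. -/
def character (n : ℤ) (θ : ℝ) : ℂ := Complex.exp (Complex.I * n * θ)

theorem character_add (m n : ℤ) (θ : ℝ) :
    character (m + n) θ = character m θ * character n θ := by
  rw [character, character, character, ← Complex.exp_add]
  push_cast
  ring_nf

theorem norm_character (n : ℤ) (θ : ℝ) : ‖character n θ‖ = 1 := by
  rw [character, show Complex.I * n * θ = ((n * θ : ℝ) : ℂ) * Complex.I by push_cast; ring,
    Complex.norm_exp_ofReal_mul_I]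

theorem continuous_character (n : ℤ) : Continuous (character n) := by
  unfold character
  fun_prop

theorem hasDerivAt_character (n : ℤ) (θ : ℝ) :
    HasDerivAt (character n) (Complex.I * n * character n θ) θ := by
  have h : HasDerivAt (character n) (Complex.exp (Complex.I * n * θ) * (Complex.I * n * 1)) θ :=
    ((hasDerivAt_id (θ : ℂ)).const_mul (Complex.I * n)).cexp.comp_ofReal
  refine h.congr_deriv ?_
  rw [character]
  ring

theorem character_two_pi (n : ℤ) : character n (2 * Real.pi) = 1 := by
  rw [character, Complex.exp_eq_one_iff]
  exact ⟨n, by push_cast; ring⟩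

theorem character_zero_right (n : ℤ) : character n 0 = 1 := by simp [character]

theorem fourier_eq_character {T : ℝ} (hT : T = 2 * Real.pi) (n : ℤ) (θ : ℝ) :
    fourier n (θ : AddCircle T) = character n θ := by
  subst hT
  rw [fourier_coe_apply, character]
  congr 1
  have := Real.pi_ne_zero
  push_cast
  field_simp

theorem coef_eq_integral (f : ℝ → ℂ) (n : ℤ) :
    coef f n = (2 * Real.pi : ℂ)⁻¹ * ∫ θ in (0 : ℝ)..(2 * Real.pi), character (-n) θ * f θ := by
  rw [coef, fourierCoeffOn_eq_integral]
  simp only [fourier_eq_character (sub_zero _), smul_eq_mul]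
  rw [sub_zero, Complex.real_smul]
  push_cast
  rw [one_div]

theorem coef_add {f g : ℝ → ℂ} (hf : Continuous f) (hg : Continuous g) (n : ℤ) :
    coef (fun θ => f θ + g θ) n = coef f n + coef g n := by
  have hc := continuous_character (-n)
  simp only [coef_eq_integral, mul_add]
  rw [← mul_add]
  congr 1
  exact intervalIntegral.integral_add ((hc.mul hf).intervalIntegrable _ _)
    ((hc.mul hg).intervalIntegrable _ _)

theorem coef_const_mul (a : ℂ) (f : ℝ → ℂ) (n : ℤ) :
    coef (fun θ => a * f θ) n = a * coef f n := by
  simp only [coef_eq_integral, mul_left_comm _ a]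
  rw [intervalIntegral.integral_const_mul, mul_left_comm]

theorem coef_neg (f : ℝ → ℂ) (n : ℤ) : coef (fun θ => -f θ) n = -coef f n := by
  simpa using coef_const_mul (-1) f n

theorem coef_sub {f g : ℝ → ℂ} (hf : Continuous f) (hg : Continuous g) (n : ℤ) :
    coef (fun θ => f θ - g θ) n = coef f n - coef g n := by
  simp only [sub_eq_add_neg]
  rw [coef_add (g := fun θ => -g θ) hf (by fun_prop), coef_neg]

theorem coef_conj (f : ℝ → ℂ) (n : ℤ) :
    coef (fun θ => starRingEnd ℂ (f θ)) n = starRingEnd ℂ (coef f (-n)) := by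
  simp only [coef_eq_integral, map_mul, map_inv₀, ← intervalIntegral.intervalIntegral_conj]
  simp [character, ← Complex.exp_conj]
  exact Or.inl (map_ofNat _ 2).symm

theorem coef_congr {f g : ℝ → ℂ} (h : ∀ θ, f θ = g θ) (n : ℤ) : coef f n = coef g n := by
  rw [funext h]

theorem norm_coef_le {f : ℝ → ℂ} {M : ℝ} (h : ∀ θ, ‖f θ‖ ≤ M) (n : ℤ) : ‖coef f n‖ ≤ M := by
  have hpi := Real.two_pi_pos
  rw [coef_eq_integral, norm_mul, norm_inv,
    show (2 * Real.pi : ℂ) = ((2 * Real.pi : ℝ) : ℂ) by push_cast; rfl, Complex.norm_real,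
    Real.norm_of_nonneg hpi.le]
  have h1 := intervalIntegral.norm_integral_le_of_norm_le_const (a := 0) (b := 2 * Real.pi)
    (f := fun θ => character (-n) θ * f θ) (C := M) fun θ _ => by
      rw [norm_mul, norm_character, one_mul]
      exact h θ
  rw [sub_zero, abs_of_pos hpi] at h1
  rw [inv_mul_le_iff₀ hpi, mul_comm (2 * Real.pi) M]
  exact h1

namespace IsSmoothPeriodic

variable {f g : ℝ → ℂ}

theorem hasDerivAt (hf : IsSmoothPeriodic f) (θ : ℝ) : HasDerivAt f (deriv f θ) θ :=
  (hf.smooth.differentiable (by simp) θ).hasDerivAt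

theorem deriv (hf : IsSmoothPeriodic f) : IsSmoothPeriodic (deriv f) :=
  ⟨(contDiff_infty_iff_deriv.1 hf.smooth).2, fun θ => by
    rw [← deriv_comp_add_const]
    congr 1
    exact funext hf.periodic⟩

theorem continuous (hf : IsSmoothPeriodic f) : Continuous f := hf.smooth.continuous

theorem add (hf : IsSmoothPeriodic f) (hg : IsSmoothPeriodic g) :
    IsSmoothPeriodic fun θ => f θ + g θ :=
  ⟨hf.smooth.add hg.smooth, hf.periodic.add hg.periodic⟩

theorem mul (hf : IsSmoothPeriodic f) (hg : IsSmoothPeriodic g) :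
    IsSmoothPeriodic fun θ => f θ * g θ :=
  ⟨hf.smooth.mul hg.smooth, hf.periodic.mul hg.periodic⟩

theorem sub (hf : IsSmoothPeriodic f) (hg : IsSmoothPeriodic g) :
    IsSmoothPeriodic fun θ => f θ - g θ :=
  ⟨hf.smooth.sub hg.smooth, hf.periodic.sub hg.periodic⟩

theorem const (a : ℂ) : IsSmoothPeriodic fun _ => a := ⟨contDiff_const, fun _ => rfl⟩

theorem const_mul (a : ℂ) (hf : IsSmoothPeriodic f) : IsSmoothPeriodic fun θ => a * f θ :=
  (const a).mul hf

theorem conj (hf : IsSmoothPeriodic f) : IsSmoothPeriodic fun θ => starRingEnd ℂ (f θ) :=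
  ⟨Complex.conjCLE.contDiff.comp hf.smooth, fun θ => by rw [hf.periodic θ]⟩

theorem coef_deriv (hf : IsSmoothPeriodic f) (n : ℤ) :
    coef (_root_.deriv f) n = Complex.I * n * coef f n := by
  have h := intervalIntegral.integral_mul_deriv_eq_deriv_mul (a := 0) (b := 2 * Real.pi)
    (fun θ _ => hasDerivAt_character (-n) θ) (fun θ _ => hf.hasDerivAt θ)
    ((continuous_const.mul (continuous_character _)).intervalIntegrable _ _)
    (hf.deriv.continuous.intervalIntegrable _ _)
  have hp : f (2 * Real.pi) = f 0 := by simpa using hf.periodic 0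
  rw [character_two_pi, character_zero_right, hp, sub_self, zero_sub] at h
  simp only [coef_eq_integral, h, mul_assoc, intervalIntegral.integral_const_mul]
  push_cast
  ring

end IsSmoothPeriodic

namespace IsSmoothCylinderFun

variable {F G : ℝ → ℝ → ℂ}

theorem uniqueDiffOn : UniqueDiffOn ℝ (Icc (0 : ℝ) 1 ×ˢ (univ : Set ℝ)) :=
  (uniqueDiffOn_Icc zero_lt_one).prod uniqueDiffOn_univ

theorem of_isSmoothPeriodic {f : ℝ → ℂ} (hf : IsSmoothPeriodic f) :
    IsSmoothCylinderFun fun _ => f :=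
  ⟨(hf.smooth.comp contDiff_snd).contDiffOn, fun _ _ => hf.periodic⟩

theorem slice (hF : IsSmoothCylinderFun F) {t : ℝ} (ht : t ∈ Icc (0 : ℝ) 1) :
    IsSmoothPeriodic (F t) := by
  refine ⟨?_, hF.periodic t ht⟩
  rw [← contDiffOn_univ]
  exact hF.smooth.comp (t := Icc (0 : ℝ) 1 ×ˢ univ) (f := fun θ : ℝ => (t, θ))
    (by fun_prop) fun θ _ => ⟨ht, trivial⟩

theorem hasFDerivWithinAt (hF : IsSmoothCylinderFun F) {t : ℝ} (ht : t ∈ Icc (0 : ℝ) 1) (θ : ℝ) :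
    HasFDerivWithinAt (fun p : ℝ × ℝ => F p.1 p.2)
      (fderivWithin ℝ (fun p : ℝ × ℝ => F p.1 p.2) (Icc (0 : ℝ) 1 ×ˢ univ) (t, θ))
      (Icc (0 : ℝ) 1 ×ˢ univ) (t, θ) :=
  (hF.smooth.differentiableOn (by simp) (t, θ) ⟨ht, trivial⟩).hasFDerivWithinAt

theorem hasDerivWithinAt_fst (hF : IsSmoothCylinderFun F) {t : ℝ} (ht : t ∈ Icc (0 : ℝ) 1)
    (θ : ℝ) : HasDerivWithinAt (fun τ => F τ θ)
      (fderivWithin ℝ (fun p : ℝ × ℝ => F p.1 p.2) (Icc (0 : ℝ) 1 ×ˢ univ) (t, θ) (1, 0))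
      (Icc 0 1) t :=
  (hF.hasFDerivWithinAt ht θ).comp_hasDerivWithinAt (f := fun τ : ℝ => (τ, θ)) t
    ((hasDerivWithinAt_id t _).prodMk (hasDerivWithinAt_const t _ θ)) fun _ hτ => ⟨hτ, trivial⟩

theorem hasDerivAt_snd (hF : IsSmoothCylinderFun F) {t : ℝ} (ht : t ∈ Icc (0 : ℝ) 1)
    (θ : ℝ) : HasDerivAt (F t)
      (fderivWithin ℝ (fun p : ℝ × ℝ => F p.1 p.2) (Icc (0 : ℝ) 1 ×ˢ univ) (t, θ) (0, 1)) θ := by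
  rw [← hasDerivWithinAt_univ]
  exact (hF.hasFDerivWithinAt ht θ).comp_hasDerivWithinAt (f := fun θ : ℝ => (t, θ)) θ
    ((hasDerivWithinAt_const θ _ t).prodMk (hasDerivWithinAt_id θ _)) fun θ _ => ⟨ht, trivial⟩

theorem deriv_snd (hF : IsSmoothCylinderFun F) : IsSmoothCylinderFun fun t => deriv (F t) := by
  refine ⟨?_, fun t ht => (hF.slice ht).deriv.periodic⟩
  refine ((hF.smooth.fderivWithin uniqueDiffOn (m := ∞) (by simp)).clm_apply
    (contDiffOn_const (c := ((0 : ℝ), (1 : ℝ))))).congr fun p hp => ?_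
  exact (hF.hasDerivAt_snd hp.1 p.2).deriv

theorem hasDerivWithinAt (hF : IsSmoothCylinderFun F) {t : ℝ} (ht : t ∈ Icc (0 : ℝ) 1)
    (θ : ℝ) : HasDerivWithinAt (fun τ => F τ θ)
      (derivWithin (fun τ => F τ θ) (Icc 0 1) t) (Icc 0 1) t :=
  (hF.hasDerivWithinAt_fst ht θ).differentiableWithinAt.hasDerivWithinAt

theorem deriv_fst (hF : IsSmoothCylinderFun F) :
    IsSmoothCylinderFun fun t θ => derivWithin (fun τ => F τ θ) (Icc 0 1) t := by
  refine ⟨?_, fun t ht θ => ?_⟩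
  · refine ((hF.smooth.fderivWithin uniqueDiffOn (m := ∞) (by simp)).clm_apply
      (contDiffOn_const (c := ((1 : ℝ), (0 : ℝ))))).congr fun p hp => ?_
    exact (hF.hasDerivWithinAt_fst hp.1 p.2).derivWithin (uniqueDiffOn_Icc zero_lt_one _ hp.1)
  · exact derivWithin_congr (fun τ hτ => hF.periodic τ hτ θ) (hF.periodic t ht θ)

theorem congr (hF : IsSmoothCylinderFun F) (h : ∀ t ∈ Icc (0 : ℝ) 1, ∀ θ, G t θ = F t θ) :
    IsSmoothCylinderFun G :=
  ⟨hF.smooth.congr fun p hp => h p.1 hp.1 p.2, fun t ht θ => by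
    rw [h t ht, h t ht, hF.periodic t ht]⟩

theorem add (hF : IsSmoothCylinderFun F) (hG : IsSmoothCylinderFun G) :
    IsSmoothCylinderFun fun t θ => F t θ + G t θ :=
  ⟨hF.smooth.add hG.smooth, fun t ht => (hF.periodic t ht).add (hG.periodic t ht)⟩

theorem sub (hF : IsSmoothCylinderFun F) (hG : IsSmoothCylinderFun G) :
    IsSmoothCylinderFun fun t θ => F t θ - G t θ :=
  ⟨hF.smooth.sub hG.smooth, fun t ht => (hF.periodic t ht).sub (hG.periodic t ht)⟩

theorem mul (hF : IsSmoothCylinderFun F) (hG : IsSmoothCylinderFun G) :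
    IsSmoothCylinderFun fun t θ => F t θ * G t θ :=
  ⟨hF.smooth.mul hG.smooth, fun t ht => (hF.periodic t ht).mul (hG.periodic t ht)⟩

theorem const_mul (a : ℂ) (hF : IsSmoothCylinderFun F) :
    IsSmoothCylinderFun fun t θ => a * F t θ :=
  (of_isSmoothPeriodic (.const a)).mul hF

/-- A function on the cylinder, extended to all times. -/
def clamp (F : ℝ → ℝ → ℂ) (t : ℝ) : ℝ → ℂ := F (projIcc (0 : ℝ) 1 zero_le_one t)

theorem clamp_of_mem (F : ℝ → ℝ → ℂ) {t : ℝ} (ht : t ∈ Icc (0 : ℝ) 1) : clamp F t = F t := by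
  rw [clamp, projIcc_of_mem zero_le_one ht]

theorem continuous_clamp (hF : IsSmoothCylinderFun F) :
    Continuous fun p : ℝ × ℝ => clamp F p.1 p.2 :=
  hF.smooth.continuousOn.comp_continuous
    (f := fun p : ℝ × ℝ => ((projIcc (0 : ℝ) 1 zero_le_one p.1 : ℝ), p.2))
    (((continuous_subtype_val.comp continuous_projIcc).comp continuous_fst).prodMk continuous_snd)
    fun p => ⟨(projIcc (0 : ℝ) 1 zero_le_one p.1).2, trivial⟩

theorem exists_bound (hF : IsSmoothCylinderFun F) :
    ∃ C, 0 ≤ C ∧ ∀ t ∈ Icc (0 : ℝ) 1, ∀ θ, ‖F t θ‖ ≤ C := by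
  obtain ⟨C, hC⟩ := ((isCompact_Icc (a := (0 : ℝ)) (b := 1)).prod
    (isCompact_Icc (a := (0 : ℝ)) (b := 2 * Real.pi))).exists_bound_of_continuousOn
    (hF.smooth.continuousOn.mono (prod_mono_right (subset_univ _)))
  have hC' : ∀ t ∈ Icc (0 : ℝ) 1, ∀ θ, ‖F t θ‖ ≤ C := fun t ht θ => by
    obtain ⟨θ', hθ', h⟩ := (hF.periodic t ht).exists_mem_Ico₀ Real.two_pi_pos θ
    rw [h]
    exact hC (t, θ') ⟨ht, hθ'.1, hθ'.2.le⟩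
  exact ⟨C, (norm_nonneg _).trans (hC' 0 ⟨le_rfl, zero_le_one⟩ 0), hC'⟩

/-- Each integration by parts trades a `θ`-derivative for a power of `n`; uniformity in `t` comes
from compactness of the cylinder. -/
theorem exists_coef_bound (hF : IsSmoothCylinderFun F) (k : ℕ) :
    ∃ C, 0 ≤ C ∧ ∀ t ∈ Icc (0 : ℝ) 1, ∀ n : ℤ, (1 + |(n : ℝ)|) ^ k * ‖coef (F t) n‖ ≤ C := by
  induction k generalizing F with
  | zero =>
    obtain ⟨C, hC0, hC⟩ := hF.exists_bound
    exact ⟨C, hC0, fun t ht n => by simpa using norm_coef_le (hC t ht) n⟩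
  | succ k ih =>
    obtain ⟨C, hC0, hC⟩ := ih hF
    obtain ⟨C', hC0', hC'⟩ := ih hF.deriv_snd
    refine ⟨C + C', by positivity, fun t ht n => ?_⟩
    have h1 := hC t ht n
    have h2 := hC' t ht n
    rw [(hF.slice ht).coef_deriv, norm_mul, norm_mul, Complex.norm_I, one_mul,
      show ‖(n : ℂ)‖ = |(n : ℝ)| by rw [← Complex.ofReal_intCast, Complex.norm_real]; rfl] at h2
    calc _ = (1 + |(n : ℝ)|) ^ k * ‖coef (F t) n‖ +
          (1 + |(n : ℝ)|) ^ k * (|(n : ℝ)| * ‖coef (F t) n‖) := by ring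
      _ ≤ _ := add_le_add h1 h2

theorem continuous_coef (hF : IsSmoothCylinderFun F) (n : ℤ) :
    Continuous fun t => coef (clamp F t) n := by
  simp only [coef_eq_integral]
  refine continuous_const.mul
    (intervalIntegral.continuous_parametric_intervalIntegral_of_continuous' ?_ _ _)
  exact ((continuous_character _).comp continuous_snd).mul hF.continuous_clamp

theorem continuousOn_coef (hF : IsSmoothCylinderFun F) (n : ℤ) :
    ContinuousOn (fun t => coef (F t) n) (Icc 0 1) :=
  (hF.continuous_coef n).continuousOn.congr fun t ht => by
    simp only [clamp_of_mem F ht]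

/-- Fubini exchanges the time integral of `∂_t F` with the Fourier integral. The integrated form
also handles the endpoints `t = 0, 1`. -/
theorem coef_eq_add_integral (hF : IsSmoothCylinderFun F) (n : ℤ) {t : ℝ}
    (ht : t ∈ Icc (0 : ℝ) 1) : coef (F t) n = coef (F 0) n +
      ∫ τ in (0 : ℝ)..t, coef (fun θ => derivWithin (fun τ => F τ θ) (Icc 0 1) τ) n := by
  set D : ℝ → ℝ → ℂ := fun t θ => derivWithin (fun τ => F τ θ) (Icc 0 1) t with hD
  have hDs : IsSmoothCylinderFun D := hF.deriv_fst
  have h0 : (0 : ℝ) ∈ Icc (0 : ℝ) 1 := ⟨le_rfl, zero_le_one⟩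
  have h1 : ∀ θ, F t θ - F 0 θ = ∫ τ in (0 : ℝ)..t, clamp D τ θ := fun θ => by
    refine (intervalIntegral.integral_eq_sub_of_hasDerivAt_of_le ht.1
      (f := fun τ => F τ θ) (fun τ hτ => ?_) (fun τ hτ => ?_) ?_).symm
    · exact (hF.hasDerivWithinAt ⟨hτ.1, hτ.2.trans ht.2⟩ θ).continuousWithinAt.mono
        (Icc_subset_Icc_right ht.2)
    · have hτ' : τ ∈ Icc (0 : ℝ) 1 := ⟨hτ.1.le, hτ.2.le.trans ht.2⟩
      rw [clamp_of_mem D hτ']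
      exact (hF.hasDerivWithinAt hτ' θ).hasDerivAt (Icc_mem_nhds hτ.1 (hτ.2.trans_le ht.2))
    · exact (hDs.continuous_clamp.comp (by fun_prop : Continuous fun τ : ℝ => (τ, θ))).intervalIntegrable
        _ _
  rw [← sub_eq_iff_eq_add', ← coef_sub (hF.slice ht).continuous (hF.slice h0).continuous,
    coef_congr h1, coef_eq_integral]
  have h2 : ∫ τ in (0 : ℝ)..t, coef (D τ) n = ∫ τ in (0 : ℝ)..t, coef (clamp D τ) n :=
    intervalIntegral.integral_congr fun τ hτ => by
      rw [uIcc_of_le ht.1] at hτ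
      rw [clamp_of_mem D ⟨hτ.1, hτ.2.trans ht.2⟩]
  rw [h2]
  simp only [coef_eq_integral, ← intervalIntegral.integral_const_mul]
  simp only [intervalIntegral.integral_of_le ht.1, intervalIntegral.integral_of_le Real.two_pi_pos.le]
  simp only [MeasureTheory.integral_const_mul]
  congr 1
  simp only [← MeasureTheory.integral_const_mul]
  refine MeasureTheory.integral_integral_swap ?_
  rw [MeasureTheory.Measure.prod_restrict]
  have hc : Continuous fun p : ℝ × ℝ => character (-n) p.1 * clamp D p.2 p.1 :=
    ((continuous_character _).comp continuous_fst).mul (hDs.continuous_clamp.comp continuous_swap)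
  exact (hc.continuousOn.integrableOn_compact (isCompact_Icc.prod isCompact_Icc)).mono_set
    (prod_mono Ioc_subset_Icc_self Ioc_subset_Icc_self)

end IsSmoothCylinderFun

/-! ### Fourier series -/

theorem summable_one_add_abs_inv_sq : Summable fun n : ℤ => ((1 + |(n : ℝ)|) ^ 2)⁻¹ := by
  have h : Summable fun n : ℕ => (((n : ℝ) + 1) ^ 2)⁻¹ := by
    have := (summable_nat_add_iff 1).2 (Real.summable_one_div_nat_pow.2 (one_lt_two))
    simpa using this
  refine Summable.of_nat_of_neg ?_ ?_ <;>
  · refine h.congr fun n => ?_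
    simp [add_comm]

namespace IsSmoothPeriodic

variable {f g : ℝ → ℂ}

theorem exists_coef_bound (hf : IsSmoothPeriodic f) (k : ℕ) :
    ∃ C, 0 ≤ C ∧ ∀ n : ℤ, (1 + |(n : ℝ)|) ^ k * ‖coef f n‖ ≤ C := by
  obtain ⟨C, hC0, hC⟩ := (IsSmoothCylinderFun.of_isSmoothPeriodic hf).exists_coef_bound k
  exact ⟨C, hC0, hC 0 ⟨le_rfl, zero_le_one⟩⟩

theorem summable_coef (hf : IsSmoothPeriodic f) (k : ℕ) :
    Summable fun n : ℤ => (1 + |(n : ℝ)|) ^ k * ‖coef f n‖ := by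
  obtain ⟨C, hC0, hC⟩ := hf.exists_coef_bound (k + 2)
  refine Summable.of_nonneg_of_le (fun n => by positivity) (fun n => ?_)
    (summable_one_add_abs_inv_sq.mul_left C)
  rw [← div_eq_mul_inv, le_div_iff₀ (by positivity)]
  refine le_trans (le_of_eq ?_) (hC n)
  ring

theorem hasSum_coef (hf : IsSmoothPeriodic f) (θ : ℝ) :
    HasSum (fun n => coef f n * character n θ) (f θ) := by
  have : Fact (0 < 2 * Real.pi) := ⟨Real.two_pi_pos⟩
  have hcont : Continuous hf.periodic.lift := continuous_coinduced_dom.2 hf.continuous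
  set f' : C(AddCircle (2 * Real.pi), ℂ) := ⟨hf.periodic.lift, hcont⟩ with hf'
  have h1 : ∀ n, fourierCoeff f' n = coef f n := fun n => by
    rw [fourierCoeff_eq_intervalIntegral _ _ 0, coef_eq_integral, zero_add, Complex.real_smul]
    push_cast
    rw [one_div]
    congr 1
    refine intervalIntegral.integral_congr fun θ _ => ?_
    simp only [fourier_eq_character rfl, smul_eq_mul]
    rfl
  have hs : Summable (fourierCoeff f') := by
    refine Summable.of_norm ?_
    simpa [h1] using hf.summable_coef 0
  have h2 := has_pointwise_sum_fourier_series_of_summable hs (θ : AddCircle (2 * Real.pi))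
  simp only [h1, fourier_eq_character rfl, smul_eq_mul] at h2
  exact h2

/-- The Fourier coefficients of a product. -/
theorem hasSum_coef_mul (hf : IsSmoothPeriodic f) (hg : IsSmoothPeriodic g) (k : ℤ) :
    HasSum (fun m => coef f m * coef g (k - m)) (coef (fun θ => f θ * g θ) k) := by
  obtain ⟨M, hM0, hM⟩ := (IsSmoothCylinderFun.of_isSmoothPeriodic hg).exists_bound
  have h := intervalIntegral.hasSum_integral_of_dominated_convergence (a := 0) (b := 2 * Real.pi)
    (μ := MeasureTheory.volume)
    (F := fun (m : ℤ) θ => character (-k) θ * (coef f m * character m θ * g θ))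
    (f := fun θ => character (-k) θ * (f θ * g θ))
    (fun m _ => ‖coef f m‖ * M) (fun m => ?_) (fun m => ?_) ?_ ?_ ?_
  · rw [coef_eq_integral]
    refine (h.mul_left _).congr_fun fun m => ?_
    rw [coef_eq_integral g, mul_left_comm, ← intervalIntegral.integral_const_mul]
    congr 1
    refine intervalIntegral.integral_congr fun θ _ => ?_
    rw [show -(k - m) = -k + m by ring, character_add]
    ring
  · exact ((continuous_character _).mul ((continuous_const.mul (continuous_character _)).mul
      hg.continuous)).aestronglyMeasurable
  · refine Eventually.of_forall fun θ _ => ?_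
    rw [norm_mul, norm_mul, norm_mul, norm_character, norm_character, one_mul, mul_one]
    exact mul_le_mul_of_nonneg_left (hM 0 ⟨le_rfl, zero_le_one⟩ θ) (norm_nonneg _)
  · refine Eventually.of_forall fun θ _ => ?_
    simpa using (hf.summable_coef 0).mul_right M
  · exact intervalIntegrable_const
  · refine Eventually.of_forall fun θ _ => ?_
    exact ((hf.hasSum_coef θ).mul_right (g θ)).mul_left _

/-- The Virasoro cocycle in terms of the angle. -/
theorem virasoroCocycle_eq (hf : IsSmoothPeriodic f) (c : ℝ) (g : ℝ → ℂ) :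
    virasoroCocycle c f g = -(c / 12 * Complex.I : ℂ) * coef (fun θ =>
      (_root_.deriv (_root_.deriv (_root_.deriv f)) θ + _root_.deriv f θ) * g θ) 0 := by
  set e : ℝ → ℂ := fun θ => Complex.exp (Complex.I * θ) with he
  have he0 : ∀ θ, e θ ≠ 0 := fun θ => Complex.exp_ne_zero _
  have hI := Complex.I_ne_zero
  have hde : ∀ θ, HasDerivAt e (Complex.I * e θ) θ := fun θ => by
    have hce : character 1 = e := by
      funext θ
      simp [character, he]
    simpa [hce] using hasDerivAt_character 1 θ
  have hdei : ∀ θ, HasDerivAt (fun θ => (e θ)⁻¹) (-Complex.I * (e θ)⁻¹) θ := fun θ => by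
    refine ((hde θ).fun_inv (he0 θ)).congr_deriv ?_
    have := he0 θ
    field_simp
  -- With `z = e θ`, one finds `∂_z (i z f) = f' + i f`; the third derivative is `-z⁻² (f''' + f')`,
  -- the `f''` terms cancelling.
  have h1 : zDeriv (zCoeff f) = fun θ => _root_.deriv f θ + Complex.I * f θ := by
    funext θ
    have hd : HasDerivAt (zCoeff f) (Complex.I * (Complex.I * e θ) * f θ +
        Complex.I * e θ * _root_.deriv f θ) θ := ((hde θ).const_mul _).fun_mul (hf.hasDerivAt θ)
    rw [zDeriv, hd.deriv]
    have := he0 θ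
    change (Complex.I * e θ)⁻¹ * _ = _
    field_simp
    ring
  have h2 : zDeriv (zDeriv (zCoeff f)) = fun θ => -Complex.I * (e θ)⁻¹ *
      (_root_.deriv (_root_.deriv f) θ + Complex.I * _root_.deriv f θ) := by
    funext θ
    rw [h1]
    have hd : HasDerivAt (fun θ => _root_.deriv f θ + Complex.I * f θ)
        (_root_.deriv (_root_.deriv f) θ + Complex.I * _root_.deriv f θ) θ :=
      (hf.deriv.hasDerivAt θ).fun_add ((hf.hasDerivAt θ).const_mul _)
    rw [zDeriv, hd.deriv, mul_inv, Complex.inv_I]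
  have h3 : ∀ θ, zDeriv (zDeriv (zDeriv (zCoeff f))) θ = -((e θ)⁻¹ ^ 2) *
      (_root_.deriv (_root_.deriv (_root_.deriv f)) θ + _root_.deriv f θ) := fun θ => by
    rw [h2]
    have hd := ((hdei θ).const_mul (-Complex.I)).fun_mul
      ((hf.deriv.deriv.hasDerivAt θ).fun_add ((hf.deriv.hasDerivAt θ).const_mul Complex.I))
    rw [zDeriv, hd.deriv, mul_inv, Complex.inv_I]
    change -Complex.I * (e θ)⁻¹ * _ = _
    linear_combination (-(e θ)⁻¹ ^ 2 * (Complex.I ^ 2 * _root_.deriv f θ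
      - _root_.deriv (_root_.deriv (_root_.deriv f)) θ - _root_.deriv f θ + 0)) * Complex.I_sq
  rw [virasoroCocycle, coef_eq_integral]
  have h4 : ∀ θ, zDeriv (zDeriv (zDeriv (zCoeff f))) θ * zCoeff g θ *
      (Complex.I * Complex.exp (Complex.I * θ)) = character (-0) θ *
      ((_root_.deriv (_root_.deriv (_root_.deriv f)) θ + _root_.deriv f θ) * g θ) := fun θ => by
    rw [h3]
    have h5 : character (-0) θ = 1 := by simp [character]
    rw [h5, zCoeff]
    change _ * (Complex.I * e θ * g θ) * (Complex.I * e θ) = _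
    have h6 : (e θ)⁻¹ * e θ = 1 := inv_mul_cancel₀ (he0 θ)
    set q := (e θ)⁻¹
    linear_combination (-(Complex.I ^ 2 * (q * e θ + 1)) *
      ((_root_.deriv (_root_.deriv (_root_.deriv f)) θ + _root_.deriv f θ) * g θ)) * h6 -
      ((_root_.deriv (_root_.deriv (_root_.deriv f)) θ + _root_.deriv f θ) * g θ) * Complex.I_sq
  simp only [h4]
  rw [mul_inv, Complex.inv_I]
  ring

theorem coef_deriv_cube_add (hf : IsSmoothPeriodic f) (m : ℤ) :
    coef (fun θ => _root_.deriv (_root_.deriv (_root_.deriv f)) θ + _root_.deriv f θ) m =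
      -Complex.I * ((m : ℂ) ^ 3 - m) * coef f m := by
  rw [coef_add hf.deriv.deriv.deriv.continuous hf.deriv.continuous, hf.deriv.deriv.coef_deriv,
    hf.deriv.coef_deriv, hf.coef_deriv]
  linear_combination (m ^ 3 * Complex.I * coef f m) * Complex.I_sq

/-- The Virasoro cocycle in terms of Fourier coefficients. -/
theorem hasSum_virasoroCocycle (hf : IsSmoothPeriodic f) (hg : IsSmoothPeriodic g) (c : ℝ) :
    HasSum (fun m : ℤ => -(coef f m * coef g (-m)) * ((c / 12 : ℂ) * ((m : ℂ) ^ 3 - m)))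
      (virasoroCocycle c f g) := by
  rw [hf.virasoroCocycle_eq]
  refine (((hf.deriv.deriv.deriv.add hf.deriv).hasSum_coef_mul hg 0).mul_left _).congr_fun
    fun m => ?_
  rw [hf.coef_deriv_cube_add, zero_sub]
  linear_combination (-(c / 12 : ℂ) * ((m : ℂ) ^ 3 - m) * coef f m * coef g (-m)) * Complex.I_sq

end IsSmoothPeriodic

open IsSmoothCylinderFun (clamp clamp_of_mem)

theorem hasSum_mul_of_summable_norm {B ι ι' : Type*} [NormedRing B] [CompleteSpace B] {x : ι → B}
    {y : ι' → B} {a b : B} (hx : HasSum x a) (hy : HasSum y b) (hx' : Summable fun i => ‖x i‖)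
    (hy' : Summable fun i => ‖y i‖) : HasSum (fun p : ι × ι' => x p.1 * y p.2) (a * b) := by
  rw [← hx.tsum_eq, ← hy.tsum_eq, tsum_mul_tsum_of_summable_norm hx' hy']
  exact (summable_mul_of_summable_norm hx' hy').hasSum

namespace PosEnergyRep

variable {c : ℝ} {H : Type*} [NormedAddCommGroup H] [InnerProductSpace ℂ H] [CompleteSpace H]
  (ρ : PosEnergyRep c H)

/-! ### Smeared operators -/

/-- The bounded operator `π(f) (1 + L₀)⁻¹`. -/
def op (f : ℝ → ℂ) : H →L[ℂ] H := ∑' n : ℤ, (Complex.I * coef f n) • ρ.ell n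

variable {ρ} {f g : ℝ → ℂ}

theorem norm_smul_ell_le (hc : 0 ≤ c) (a : ℂ) (n : ℤ) :
    ‖(Complex.I * a) • ρ.ell n‖ ≤ (1 + c) * ((1 + |(n : ℝ)|) ^ 2 * ‖a‖) := by
  rw [norm_smul, norm_mul, Complex.norm_I, one_mul]
  calc ‖a‖ * ‖ρ.ell n‖ ≤ ‖a‖ * ((1 + c) * (1 + |(n : ℝ)|) ^ 2) := by
        gcongr
        exact (ell_spec hc n).1
    _ = _ := by ring

theorem summable_norm_op (hc : 0 ≤ c) (hf : IsSmoothPeriodic f) :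
    Summable fun n : ℤ => ‖(Complex.I * coef f n) • ρ.ell n‖ :=
  Summable.of_nonneg_of_le (fun _ => norm_nonneg _) (fun n => norm_smul_ell_le hc _ n)
    ((hf.summable_coef 2).mul_left (1 + c))

theorem hasSum_op (hc : 0 ≤ c) (hf : IsSmoothPeriodic f) :
    HasSum (fun n : ℤ => (Complex.I * coef f n) • ρ.ell n) (ρ.op f) :=
  (summable_norm_op hc hf).of_norm.hasSum

theorem op_add (hc : 0 ≤ c) (hf : IsSmoothPeriodic f) (hg : IsSmoothPeriodic g) :
    ρ.op (fun θ => f θ + g θ) = ρ.op f + ρ.op g := by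
  refine (hasSum_op hc (hf.add hg)).unique
    (((hasSum_op hc hf).add (hasSum_op hc hg)).congr_fun fun n => ?_)
  rw [coef_add hf.continuous hg.continuous, mul_add, add_smul]

theorem op_const_mul (hc : 0 ≤ c) (a : ℂ) (hf : IsSmoothPeriodic f) :
    ρ.op (fun θ => a * f θ) = a • ρ.op f := by
  refine (hasSum_op hc (hf.const_mul a)).unique
    (((hasSum_op hc hf).const_smul a).congr_fun fun n => ?_)
  rw [coef_const_mul, smul_smul, mul_left_comm]

theorem op_const (hc : 0 ≤ c) (a : ℂ) : ρ.op (fun _ => a) = (Complex.I * a) • (1 - ρ.R) := by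
  rw [← ell_zero hc]
  refine (hasSum_op hc (.const a)).unique ?_
  have hn : ∀ n : ℤ, n ≠ 0 → coef (fun _ => a) n = 0 := fun n hn => by
    have h := (IsSmoothPeriodic.const a).coef_deriv n
    rw [deriv_const'] at h
    have h0 : coef (fun _ => (0 : ℂ)) n = 0 := by simpa using coef_const_mul 0 (fun _ => 0) n
    rw [h0, eq_comm, mul_eq_zero, mul_eq_zero] at h
    simpa [hn, Complex.I_ne_zero] using h
  have h0 : coef (fun _ => a) 0 = a := by
    rw [coef_eq_integral]
    have : (Real.pi : ℂ) ≠ 0 := by exact_mod_cast Real.pi_ne_zero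
    simp [character]
    field_simp
  have h := hasSum_ite_eq (0 : ℤ) ((Complex.I * a) • ρ.ell 0)
  refine h.congr_fun fun n => ?_
  split_ifs with h1
  · rw [h1, h0]
  · rw [hn n h1, mul_zero, zero_smul]

/-- Termwise this is `(1 + L₀) L_n R²`. The factor `-n` from `[L₀, L_n]` turns `f̂(n)` into the
coefficient of `i f'`. -/
theorem hasSum_op_commutator (hc : 0 ≤ c) (hf : IsSmoothPeriodic f) :
    HasSum (fun n : ℤ => (Complex.I * coef f n) • (ρ.ell n - (n : ℂ) • (ρ.ell n * ρ.R)))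
      (ρ.op f + ρ.op (fun θ => Complex.I * deriv f θ) * ρ.R) := by
  refine ((hasSum_op hc hf).add
    ((hasSum_op hc (hf.deriv.const_mul Complex.I)).mul_right ρ.R)).congr_fun fun n => ?_
  rw [coef_const_mul, hf.coef_deriv, smul_sub, sub_eq_add_neg, smul_smul, ← neg_smul,
    smul_mul_assoc]
  congr 2
  linear_combination (-Complex.I * n * coef f n) * Complex.I_sq

theorem summable_norm_op_commutator (hc : 0 ≤ c) (hf : IsSmoothPeriodic f) :
    Summable fun n : ℤ => ‖(Complex.I * coef f n) • (ρ.ell n - (n : ℂ) • (ρ.ell n * ρ.R))‖ := by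
  refine Summable.of_nonneg_of_le (fun _ => norm_nonneg _) (fun n => ?_)
    ((hf.summable_coef 3).mul_left (1 + c))
  rw [norm_smul, norm_mul, Complex.norm_I, one_mul]
  have h1 : ‖ρ.ell n - (n : ℂ) • (ρ.ell n * ρ.R)‖ ≤ (1 + |(n : ℝ)|) * ‖ρ.ell n‖ := by
    refine (norm_sub_le _ _).trans ?_
    rw [norm_smul, show ‖(n : ℂ)‖ = |(n : ℝ)| by rw [← Complex.ofReal_intCast, Complex.norm_real]; rfl,
      add_mul, one_mul]
    gcongr
    refine (norm_mul_le _ _).trans ?_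
    simpa using mul_le_mul_of_nonneg_left (cutoff (ρ := ρ)).norm_R (norm_nonneg (ρ.ell n))
  calc _ ≤ ‖coef f n‖ * ((1 + |(n : ℝ)|) * ((1 + c) * (1 + |(n : ℝ)|) ^ 2)) := by
        gcongr
        exact h1.trans (by gcongr; exact (ell_spec hc n).1)
    _ = _ := by ring

/-- The commutator of `1 + L₀` with a smeared operator. -/
theorem op_mul_R (hc : 0 ≤ c) (hf : IsSmoothPeriodic f) :
    ρ.op f * ρ.R = ρ.R * (ρ.op f + ρ.op (fun θ => Complex.I * deriv f θ) * ρ.R) := by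
  refine ((hasSum_op hc hf).mul_right ρ.R).unique
    (((hasSum_op_commutator hc hf).mul_left ρ.R).congr_fun fun n => ?_)
  rw [smul_mul_assoc, mul_smul_comm]
  exact congrArg _ (ell_mul_R hc n)

/-- The commutator of two smeared operators. -/
theorem op_commutator (hc : 0 ≤ c) (hf : IsSmoothPeriodic f) (hg : IsSmoothPeriodic g) :
    ρ.op f * (ρ.op g + ρ.op (fun θ => Complex.I * deriv g θ) * ρ.R) -
      ρ.op g * (ρ.op f + ρ.op (fun θ => Complex.I * deriv f θ) * ρ.R) =
    ρ.op (fun θ => deriv f θ * g θ - f θ * deriv g θ) * ρ.R +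
      virasoroCocycle c f g • (ρ.R * ρ.R) := by
  have h1 : HasSum (fun p : ℤ × ℤ => ((Complex.I * coef f p.1) • ρ.ell p.1) *
      ((Complex.I * coef g p.2) • (ρ.ell p.2 - (p.2 : ℂ) • (ρ.ell p.2 * ρ.R))))
      (ρ.op f * (ρ.op g + ρ.op (fun θ => Complex.I * deriv g θ) * ρ.R)) :=
    hasSum_mul_of_summable_norm (x := fun n : ℤ => (Complex.I * coef f n) • ρ.ell n)
      (y := fun n : ℤ => (Complex.I * coef g n) • (ρ.ell n - (n : ℂ) • (ρ.ell n * ρ.R)))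
      (hasSum_op hc hf) (hasSum_op_commutator hc hg)
      (summable_norm_op hc hf) (summable_norm_op_commutator hc hg)
  have h2 : HasSum (fun p : ℤ × ℤ => ((Complex.I * coef g p.1) • ρ.ell p.1) *
      ((Complex.I * coef f p.2) • (ρ.ell p.2 - (p.2 : ℂ) • (ρ.ell p.2 * ρ.R))))
      (ρ.op g * (ρ.op f + ρ.op (fun θ => Complex.I * deriv f θ) * ρ.R)) :=
    hasSum_mul_of_summable_norm (x := fun n : ℤ => (Complex.I * coef g n) • ρ.ell n)
      (y := fun n : ℤ => (Complex.I * coef f n) • (ρ.ell n - (n : ℂ) • (ρ.ell n * ρ.R)))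
      (hasSum_op hc hg) (hasSum_op_commutator hc hf)
      (summable_norm_op hc hg) (summable_norm_op_commutator hc hf)
  -- The second double series is summed with its indices swapped, so that equal indices combine into
  -- commutators. The new indices `k = m + n` and `m` then make the sum over `m` a convolution of
  -- Fourier coefficients, with the cocycle appearing at `k = 0`.
  have h3 := h1.sub ((Equiv.prodComm ℤ ℤ).hasSum_iff.2 h2)
  set e : ℤ × ℤ ≃ ℤ × ℤ :=
    { toFun := fun p => (p.2, p.1 - p.2)
      invFun := fun p => (p.1 + p.2, p.1)
      left_inv := fun p => by simp
      right_inv := fun p => by simp } with he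
  have h4 : HasSum (fun p : ℤ × ℤ => (-(coef f p.2 * coef g (p.1 - p.2)) * (2 * (p.2 : ℂ) - p.1)) •
      (ρ.ell p.1 * ρ.R) + (if p.1 = 0 then -(coef f p.2 * coef g (p.1 - p.2)) *
        ((c / 12 : ℂ) * ((p.2 : ℂ) ^ 3 - p.2)) else 0) • (ρ.R * ρ.R)) _ :=
    (e.hasSum_iff.2 h3).congr_fun fun p => by
      obtain ⟨k, m⟩ := p
      simp only [he, Function.comp, Equiv.coe_fn_mk, Equiv.prodComm_apply, Prod.fst_swap,
        Prod.snd_swap]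
      have h5 := ell_commutator (ρ := ρ) hc m (k - m)
      rw [add_sub_cancel] at h5
      have h6 : ∀ (x y : ℂ) (A B : H →L[ℂ] H), (Complex.I * x) • A * ((Complex.I * y) • B) =
          (-(x * y)) • (A * B) := fun x y A B => by
        rw [smul_mul_smul_comm]
        congr 1
        linear_combination (x * y) * Complex.I_sq
      rw [h6, h6, mul_comm (coef g _), ← smul_sub, h5, smul_add, smul_smul, smul_smul]
      congr 2
      · push_cast
        ring
      · split_ifs <;> simp
  have h7 : ∀ k : ℤ, HasSum (fun m : ℤ => (-(coef f m * coef g (k - m)) * (2 * (m : ℂ) - k)) •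
      (ρ.ell k * ρ.R) + (if k = 0 then -(coef f m * coef g (k - m)) *
        ((c / 12 : ℂ) * ((m : ℂ) ^ 3 - m)) else 0) • (ρ.R * ρ.R))
      ((Complex.I * coef (fun θ => deriv f θ * g θ - f θ * deriv g θ) k) • (ρ.ell k * ρ.R) +
        (if k = 0 then virasoroCocycle c f g else 0) • (ρ.R * ρ.R)) := fun k => by
    refine HasSum.add (HasSum.smul_const ?_ _) (HasSum.smul_const ?_ _)
    · rw [coef_sub (hf.deriv.mul hg).continuous (hf.mul hg.deriv).continuous]
      refine (((hf.deriv.hasSum_coef_mul hg k).sub (hf.hasSum_coef_mul hg.deriv k)).mul_left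
        Complex.I).congr_fun fun m => ?_
      rw [hf.coef_deriv, hg.coef_deriv]
      push_cast
      linear_combination (-(coef f m * coef g (k - m)) * (2 * (m : ℂ) - k)) * Complex.I_sq
    · split_ifs with hk
      · subst hk
        refine (hf.hasSum_virasoroCocycle hg c).congr_fun fun m => ?_
        rw [zero_sub]
      · exact hasSum_zero
  refine (h4.prod_fiberwise h7).unique (HasSum.add ?_ ?_)
  · refine ((hasSum_op hc ((hf.deriv.mul hg).sub (hf.mul hg.deriv))).mul_right ρ.R).congr_fun
      fun k => ?_
    rw [smul_mul_assoc]
  · refine HasSum.smul_const ?_ _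
    exact hasSum_ite_eq (0 : ℤ) _

/-- The formal adjoint of a smeared operator. -/
theorem inner_op (hc : 0 ≤ c) (hf : IsSmoothPeriodic f) (x y : H) :
    inner ℂ (ρ.op f x) (ρ.R y) = inner ℂ (ρ.R x) (ρ.op (fun θ => -starRingEnd ℂ (f θ)) y) := by
  have hf' : IsSmoothPeriodic fun θ => -starRingEnd ℂ (f θ) := by
    simpa using hf.conj.const_mul (-1)
  have h1 : HasSum (fun n => inner ℂ (((Complex.I * coef f n) • ρ.ell n) x) (ρ.R y))
      (inner ℂ (ρ.op f x) (ρ.R y)) := by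
    have h := ((hasSum_op (ρ := ρ) hc hf).mapL (ContinuousLinearMap.apply ℂ H x)).mapL
      (innerSL ℂ (ρ.R y))
    have h' := h.map (starRingEnd ℂ) Complex.continuous_conj
    simpa [Function.comp_def, mul_comm] using h'
  have h2 : HasSum (fun n => inner ℂ (ρ.R x)
      (((Complex.I * coef (fun θ => -starRingEnd ℂ (f θ)) n) • ρ.ell n) y))
      (inner ℂ (ρ.R x) (ρ.op (fun θ => -starRingEnd ℂ (f θ)) y)) :=
    ((hasSum_op hc hf').mapL (ContinuousLinearMap.apply ℂ H y)).mapL (innerSL ℂ (ρ.R x))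
  refine h1.unique (((Equiv.neg ℤ).hasSum_iff.2 h2).congr_fun fun n => ?_)
  simp only [Function.comp, Equiv.neg_apply, smul_apply, inner_smul_left, inner_smul_right,
    inner_ell hc, coef_neg, coef_conj, neg_neg, map_mul, Complex.conj_I]
  ring

theorem re_inner_op_eq_zero (hc : 0 ≤ c) (hf : IsSmoothPeriodic f) (hr : ∀ θ, (f θ).im = 0)
    (x : H) : (inner ℂ (ρ.op f x) (ρ.R x)).re = 0 := by
  have e : (fun θ => -starRingEnd ℂ (f θ)) = fun θ => (-1 : ℂ) * f θ := funext fun θ => by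
    rw [Complex.conj_eq_iff_im.2 (hr θ), neg_one_mul]
  have h := inner_op (ρ := ρ) hc hf x x
  rw [e, op_const_mul hc _ hf, smul_apply, inner_smul_right, ← inner_conj_symm (ρ.R x)] at h
  have h2 := congrArg Complex.re h
  simp only [neg_one_mul, Complex.neg_re, Complex.conj_re] at h2
  linarith

theorem summable_norm_bound (C : ℝ) :
    Summable fun n : ℤ => (1 + c) * (C * ((1 + |(n : ℝ)|) ^ 2)⁻¹) :=
  (summable_one_add_abs_inv_sq.mul_left C).mul_left (1 + c)

theorem exists_norm_smul_ell_le (hc : 0 ≤ c) {F : ℝ → ℝ → ℂ} (hF : IsSmoothCylinderFun F) :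
    ∃ C, ∀ t, ∀ n : ℤ, ‖(Complex.I * coef (clamp F t) n) • ρ.ell n‖ ≤
      (1 + c) * (C * ((1 + |(n : ℝ)|) ^ 2)⁻¹) := by
  -- Two powers absorb the growth of `‖ρ.ell n‖`; the other two give summability over `n`.
  obtain ⟨C, hC0, hC⟩ := hF.exists_coef_bound 4
  refine ⟨C, fun t n => (norm_smul_ell_le hc _ n).trans ?_⟩
  refine mul_le_mul_of_nonneg_left ?_ (by positivity)
  rw [← div_eq_mul_inv, le_div_iff₀ (by positivity)]
  refine le_trans (le_of_eq ?_) (hC _ (projIcc (0 : ℝ) 1 zero_le_one t).2 n)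
  rw [clamp]
  ring

theorem continuous_op (hc : 0 ≤ c) {F : ℝ → ℝ → ℂ} (hF : IsSmoothCylinderFun F) :
    Continuous fun t => ρ.op (clamp F t) := by
  obtain ⟨C, hC⟩ := exists_norm_smul_ell_le (ρ := ρ) hc hF
  exact continuous_tsum
    (fun n => (continuous_const.mul (hF.continuous_coef n)).smul continuous_const)
    (summable_norm_bound C) fun n t => hC t n

theorem exists_norm_op_le (hc : 0 ≤ c) {F : ℝ → ℝ → ℂ} (hF : IsSmoothCylinderFun F) :
    ∃ C, ∀ t, ‖ρ.op (clamp F t)‖ ≤ C := by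
  obtain ⟨C, hC⟩ := exists_norm_smul_ell_le (ρ := ρ) hc hF
  exact ⟨_, fun t => tsum_of_norm_bounded (summable_norm_bound C).hasSum (hC t)⟩

/-- The Fourier coefficients are integrals of their time derivatives; summing these identities under
a uniform summable bound gives an integral formula in operator norm. -/
theorem hasDerivWithinAt_op (hc : 0 ≤ c) {F : ℝ → ℝ → ℂ} (hF : IsSmoothCylinderFun F) {t : ℝ}
    (ht : t ∈ Icc (0 : ℝ) 1) : HasDerivWithinAt (fun t => ρ.op (F t))
      (ρ.op fun θ => derivWithin (fun τ => F τ θ) (Icc 0 1) t) (Icc 0 1) t := by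
  set D : ℝ → ℝ → ℂ := fun t θ => derivWithin (fun τ => F τ θ) (Icc 0 1) t with hD
  have hDs : IsSmoothCylinderFun D := hF.deriv_fst
  obtain ⟨C, hC⟩ := exists_norm_smul_ell_le (ρ := ρ) hc hDs
  have key : ∀ t ∈ Icc (0 : ℝ) 1, ρ.op (F t) = ρ.op (F 0) + ∫ τ in (0 : ℝ)..t, ρ.op (clamp D τ) := by
    intro t ht
    have h1 := intervalIntegral.hasSum_integral_of_dominated_convergence (a := 0) (b := t)
      (μ := MeasureTheory.volume)
      (F := fun (n : ℤ) τ => (Complex.I * coef (clamp D τ) n) • ρ.ell n)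
      (f := fun τ => ρ.op (clamp D τ))
      (fun n _ => (1 + c) * (C * ((1 + |(n : ℝ)|) ^ 2)⁻¹))
      (fun n => ((continuous_const.mul (hDs.continuous_coef n)).smul
        continuous_const).aestronglyMeasurable)
      (fun n => Eventually.of_forall fun τ _ => hC τ n)
      (Eventually.of_forall fun τ _ => summable_norm_bound C) intervalIntegrable_const
      (Eventually.of_forall fun τ _ =>
        hasSum_op hc (hDs.slice (projIcc (0 : ℝ) 1 zero_le_one τ).2))
    have h0 : (0 : ℝ) ∈ Icc (0 : ℝ) 1 := ⟨le_rfl, zero_le_one⟩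
    rw [← sub_eq_iff_eq_add']
    have h2 := (hasSum_op (ρ := ρ) hc (hF.slice ht)).sub (hasSum_op (ρ := ρ) hc (hF.slice h0))
    refine h2.unique ?_
    refine h1.congr_fun fun n => ?_
    rw [intervalIntegral.integral_smul_const, intervalIntegral.integral_const_mul, ← sub_smul,
      ← mul_sub, hF.coef_eq_add_integral n ht, add_sub_cancel_left]
    congr 2
    refine intervalIntegral.integral_congr fun τ hτ => ?_
    rw [uIcc_of_le ht.1] at hτ
    rw [clamp_of_mem D ⟨hτ.1, hτ.2.trans ht.2⟩]
  have h := hasDerivWithinAt_of_integral_right (g := fun τ => ρ.op (clamp D τ)) (ρ.op (F 0))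
    (continuous_op hc hDs).continuousOn key ht
  rwa [clamp_of_mem D ht] at h

/-- The closed operator `π(f)` on `H₁`. -/
theorem mem_graph_smeared (hc : 0 ≤ c) (hf : IsSmoothPeriodic f) (z : H) :
    (ρ.R z, ρ.op f z) ∈ (ρ.smeared f).graph := by
  set T := ρ.preSmeared f with hT
  have hterm : ∀ w : ρ.W, HasSum (ρ.term f w) (ρ.op f (ρ.addL0 1 w)) := fun w => by
    refine ((hasSum_op hc hf).mapL (ContinuousLinearMap.apply ℂ H
      ((ρ.addL0 1 w : ρ.W) : H))).congr_fun fun n => ?_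
    simp only [ContinuousLinearMap.apply_apply, smul_apply, (ell_spec hc n).2]
    rfl
  have hval : ∀ p ∈ T.graph, ∃ w : ρ.W, p = (ρ.R (ρ.addL0 1 w), ρ.op f (ρ.addL0 1 w)) := by
    rintro ⟨u, v⟩ h
    obtain ⟨w, rfl, rfl⟩ := (LinearPMap.mem_graph_iff _).1 h
    refine ⟨⟨w.1, w.2.1⟩, ?_⟩
    rw [R_addL0]
    exact Prod.ext rfl (hterm ⟨w.1, w.2.1⟩).tsum_eq
  -- The formal adjoint `π(-f̄)` is defined on the dense range of `R`, and this makes `T` closable;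
  -- only then is the closure of its graph the graph of `π(f)`.
  have hsub : ∀ p ∈ T.graph.topologicalClosure, ∀ y,
      inner ℂ p.2 (ρ.R y) = inner ℂ p.1 (ρ.op (fun θ => -starRingEnd ℂ (f θ)) y) := by
    intro p hp y
    refine closure_minimal (s := (T.graph : Set (H × H))) (t := {p | inner ℂ p.2 (ρ.R y) =
      inner ℂ p.1 (ρ.op (fun θ => -starRingEnd ℂ (f θ)) y)})
      ?_ (isClosed_eq (by fun_prop) (by fun_prop)) hp
    intro p hp
    obtain ⟨w, rfl⟩ := hval p hp
    exact inner_op hc hf _ y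
  have hcl : T.IsClosable := by
    refine ⟨T.graph.topologicalClosure.toLinearPMap, ?_⟩
    rw [Submodule.toLinearPMap_graph_eq]
    intro p hp hp0
    have h := hsub p hp
    simp only [hp0, inner_zero_left] at h
    exact (denseRange_R (ρ := ρ)).eq_zero_of_inner_left ℂ h
  rw [smeared, ← hcl.graph_closure_eq_closure_graph]
  have hd : DenseRange (fun w : ρ.W => (ρ.addL0 1 w : H)) := by
    have : (range fun w : ρ.W => (ρ.addL0 1 w : H)) = ρ.W := by
      ext u
      refine ⟨?_, fun hu => ?_⟩
      · rintro ⟨w, rfl⟩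
        exact (ρ.addL0 1 w).2
      · obtain ⟨w, hw⟩ := (addL0_bijective (ρ := ρ) one_pos).2 ⟨u, hu⟩
        exact ⟨w, by simp [hw]⟩
    rw [DenseRange, this]
    exact ρ.dense
  refine hd.induction_on (p := fun y => (ρ.R y, ρ.op f y) ∈ T.graph.topologicalClosure) z
    (T.graph.isClosed_topologicalClosure.preimage (by fun_prop)) fun w => ?_
  refine T.graph.le_topologicalClosure ((LinearPMap.mem_graph_iff _).2
    ⟨⟨w.1, w.2, (hterm w).summable⟩, ?_, ?_⟩)
  · exact (R_addL0 w).symm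
  · exact (hterm w).tsum_eq

end PosEnergyRep

/-! ### The generator attached to a path of vector fields -/

/-- The path `i ∂_θ X`. -/
def twist (X : ℝ → ℝ → ℂ) (t θ : ℝ) : ℂ := Complex.I * deriv (X t) θ

theorem IsSmoothCylinderFun.twist_iterate {X : ℝ → ℝ → ℂ} (hX : IsSmoothCylinderFun X) (j : ℕ) :
    IsSmoothCylinderFun (twist^[j] X) := by
  induction j with
  | zero => exact hX
  | succ j ih =>
    rw [Function.iterate_succ_apply']
    exact ih.deriv_snd.const_mul Complex.I

theorem clamp_mem : ∀ t : ℝ, (projIcc (0 : ℝ) 1 zero_le_one t : ℝ) ∈ Icc (0 : ℝ) 1 :=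
  fun t => (projIcc (0 : ℝ) 1 zero_le_one t).2

theorem IsSmoothCylinderFun.continuousOn_virasoroCocycle {X f : ℝ → ℝ → ℂ}
    (hX : IsSmoothCylinderFun X) (hf : IsSmoothCylinderFun f) (c : ℝ) :
    ContinuousOn (fun t => virasoroCocycle c (X t) (f t)) (Icc 0 1) :=
  (continuousOn_const.mul (((hX.deriv_snd.deriv_snd.deriv_snd.add hX.deriv_snd).mul
    hf).continuousOn_coef 0)).congr fun _ ht => (hX.slice ht).virasoroCocycle_eq c _

namespace PosEnergyRep

variable {c : ℝ} {H : Type*} [NormedAddCommGroup H] [InnerProductSpace ℂ H] [CompleteSpace H]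
  (ρ : PosEnergyRep c H)

/-- The bounded operators attached to the path `X`, extended to all times by constancy. -/
def gen (X : ℝ → ℝ → ℂ) (j : ℕ) (t : ℝ) : H →L[ℂ] H := ρ.op (clamp (twist^[j] X) t)

variable {ρ} {X f : ℝ → ℝ → ℂ} {ν : ℝ}

theorem gen_zero_of_mem {t : ℝ} (ht : t ∈ Icc (0 : ℝ) 1) : ρ.gen X 0 t = ρ.op (X t) := by
  rw [gen, clamp_of_mem _ ht, Function.iterate_zero, id]

/-- The iterated commutators of `1 + L₀` with `π(X)` are `π((i ∂_θ)^j X)`, so the entire hierarchy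
consists of smeared smooth fields; only dissipativity has to be supplied. -/
theorem isGenerator_gen (hc : 0 ≤ c) (hX : IsSmoothCylinderFun X) (hν : 0 ≤ ν)
    (hd : ∀ t ∈ Icc (0 : ℝ) 1, ∀ z,
      (inner ℂ (ρ.op (X t) z) (ρ.R z)).re ≤ ν * ‖ρ.R z‖ ^ 2) :
    IsGenerator ρ.R (ρ.gen X) ν where
  cont j := continuous_op hc (hX.twist_iterate j)
  bdd j := exists_norm_op_le hc (hX.twist_iterate j)
  rel j t := by
    rw [gen, gen, Function.iterate_succ_apply', clamp,
      op_mul_R hc ((hX.twist_iterate j).slice (clamp_mem t)), mul_add, mul_assoc]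
    rfl
  nonneg := hν
  dissip t z := hd _ (clamp_mem t) z

/-- The time-ordered exponential of a path of vector fields. -/
theorem isTimeOrderedExpOf_evol (hc : 0 ≤ c) (hX : IsSmoothCylinderFun X)
    (ha : IsGenerator ρ.R (ρ.gen X) ν) : ρ.IsTimeOrderedExpOf X (evol ρ.J ρ.K (ρ.gen X)) :=
  isTimeOrderedExp_evol cutoff ha mem_graph_oneAddL0 fun t ht z => by
    rw [gen_zero_of_mem ht]
    exact mem_graph_smeared hc (hX.slice ht) z

theorem dense_domain_oneAddL0 : Dense (ρ.oneAddL0.domain : Set H) :=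
  (denseRange_R (ρ := ρ)).mono <| by
    rintro _ ⟨z, rfl⟩
    exact LinearPMap.mem_domain_of_mem_graph ((mem_graph_oneAddL0 _ _).2 rfl)

/-- The Segal commutation relation, applied to a vector of the form `(1 + L₀)⁻¹ z`. -/
theorem evol_op (hc : 0 ≤ c) (hX : IsSmoothCylinderFun X) (ha : IsGenerator ρ.R (ρ.gen X) ν)
    (hf : IsSmoothCylinderFun f) (hXf : SolvesHoloEquation X f) (z : H) :
    evol ρ.J ρ.K (ρ.gen X) 1 0 (ρ.op (f 0) z) =
      ρ.op (f 1) (evol ρ.J ρ.K (shiftGen ρ.R (ρ.gen X)) 1 0 z) +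
      (∫ τ in (0 : ℝ)..1, virasoroCocycle c (X τ) (f τ)) •
        evol ρ.J ρ.K (ρ.gen X) 1 0 (ρ.R z) := by
  refine evol_commutation (φ := fun t => ρ.op (f t))
    (φ₁ := fun t => ρ.op fun θ => Complex.I * deriv (f t) θ)
    (φd := fun t => ρ.op fun θ => derivWithin (fun τ => f τ θ) (Icc 0 1) t)
    cutoff ha (hX.continuousOn_virasoroCocycle hf c) (fun t ht => hasDerivWithinAt_op hc hf ht)
    (fun t ht => op_mul_R hc (hf.slice ht)) (fun t ht => ?_) z
  have h1 : ρ.gen X 1 t = ρ.op fun θ => Complex.I * deriv (X t) θ := by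
    rw [gen, clamp_of_mem _ ht]
    rfl
  rw [gen_zero_of_mem ht, h1, op_commutator hc (hX.slice ht) (hf.slice ht), add_sub_cancel_right]
  congr 2
  exact funext (hXf t ht)

end PosEnergyRep

/-! ### Straightening a positive vector field -/

/-- The path from `1 / p` to the constant `1 / k` whose reciprocal is affine. -/
def straighten (p : ℝ → ℂ) (k : ℂ) (s θ : ℝ) : ℂ := ((1 - s) * p θ + s * k)⁻¹

/-- A density whose mean is the primitive of the Virasoro cocycle along `straighten p k`. -/
def schwarzDensity (p : ℝ → ℂ) (k : ℂ) (s θ : ℝ) : ℂ :=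
  (1 - s) ^ 2 * deriv p θ ^ 2 * straighten p k s θ ^ 3 - straighten p k s θ

theorem IsSmoothCylinderFun.inv {F : ℝ → ℝ → ℂ} (hF : IsSmoothCylinderFun F)
    (h0 : ∀ t ∈ Icc (0 : ℝ) 1, ∀ θ, F t θ ≠ 0) : IsSmoothCylinderFun fun t θ => (F t θ)⁻¹ :=
  ⟨hF.smooth.inv fun p hp => h0 p.1 hp.1 p.2, fun t ht θ => by rw [hF.periodic t ht θ]⟩

theorem isSmoothCylinderFun_fst : IsSmoothCylinderFun fun s _ => (s : ℂ) :=
  ⟨(Complex.ofRealCLM.contDiff.comp contDiff_fst).contDiffOn, fun _ _ _ => rfl⟩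

section Straighten

variable {p G : ℝ → ℂ} {k : ℂ}

theorem isSmoothCylinderFun_straighten (hp : IsSmoothPeriodic p)
    (h0 : ∀ s ∈ Icc (0 : ℝ) 1, ∀ θ, (1 - s) * p θ + s * k ≠ 0) :
    IsSmoothCylinderFun (straighten p k) := by
  have h1 := IsSmoothCylinderFun.of_isSmoothPeriodic (.const 1)
  refine IsSmoothCylinderFun.inv (F := fun s θ => (1 - s) * p θ + s * k) ?_ h0
  exact ((h1.sub isSmoothCylinderFun_fst).mul (.of_isSmoothPeriodic hp)).add
    (isSmoothCylinderFun_fst.mul (.of_isSmoothPeriodic (.const k)))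

theorem isSmoothCylinderFun_schwarzDensity (hp : IsSmoothPeriodic p)
    (h0 : ∀ s ∈ Icc (0 : ℝ) 1, ∀ θ, (1 - s) * p θ + s * k ≠ 0) :
    IsSmoothCylinderFun (schwarzDensity p k) := by
  have h1 := (IsSmoothCylinderFun.of_isSmoothPeriodic (.const 1)).sub isSmoothCylinderFun_fst
  have hf := isSmoothCylinderFun_straighten hp h0
  have hd := IsSmoothCylinderFun.of_isSmoothPeriodic hp.deriv
  refine ((((h1.mul h1).mul (hd.mul hd)).mul ((hf.mul hf).mul hf)).sub hf).congr fun s _ θ => ?_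
  rw [schwarzDensity]
  ring

theorem deriv_straighten (hp : IsSmoothPeriodic p) {s θ : ℝ} (h0 : (1 - s) * p θ + s * k ≠ 0) :
    deriv (straighten p k s) θ = -((1 - s) * deriv p θ) * straighten p k s θ ^ 2 := by
  refine HasDerivAt.deriv (((((hp.hasDerivAt θ).const_mul (1 - (s : ℂ))).add_const
    (s * k)).fun_inv h0).congr_deriv ?_)
  rw [straighten, inv_pow, div_eq_mul_inv]

theorem hasDerivAt_straighten_fst {s θ : ℝ} (h0 : (1 - s) * p θ + s * k ≠ 0) :
    HasDerivAt (fun s => straighten p k s θ) (straighten p k s θ ^ 2 * (p θ - k)) s := by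
  have hs : HasDerivAt (fun s : ℝ => (s : ℂ)) 1 s := Complex.ofRealCLM.hasDerivAt
  refine ((((hs.const_sub 1).mul_const (p θ)).fun_add (hs.mul_const k)).fun_inv h0).congr_deriv ?_
  rw [straighten, inv_pow, div_eq_mul_inv]
  ring

/-- For `X = f G` the terms containing `G` cancel in `X_θ f - X f_θ`. What remains is `f² (p - k)`,
the `s`-derivative of the reciprocal of an affine function. -/
theorem solvesHoloEquation_straighten (hp : IsSmoothPeriodic p) (hG : ∀ θ, HasDerivAt G (p θ - k) θ)
    (h0 : ∀ s ∈ Icc (0 : ℝ) 1, ∀ θ, (1 - s) * p θ + s * k ≠ 0) :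
    SolvesHoloEquation (fun s θ => straighten p k s θ * G θ) (straighten p k) := by
  intro s hs θ
  rw [(hasDerivAt_straighten_fst (h0 s hs θ)).hasDerivWithinAt.derivWithin
    (uniqueDiffOn_Icc_zero_one s hs)]
  rw [((((isSmoothCylinderFun_straighten hp h0).slice hs).hasDerivAt θ).fun_mul (hG θ)).deriv]
  ring

theorem derivWithin_schwarzDensity (hp : IsSmoothPeriodic p)
    (h0 : ∀ s ∈ Icc (0 : ℝ) 1, ∀ θ, (1 - s) * p θ + s * k ≠ 0) {s : ℝ} (hs : s ∈ Icc (0 : ℝ) 1)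
    (θ : ℝ) : derivWithin (fun s => schwarzDensity p k s θ) (Icc 0 1) s =
      3 * deriv (straighten p k s) θ ^ 2 * (p θ - k) +
        2 * straighten p k s θ * deriv (straighten p k s) θ * deriv p θ -
        straighten p k s θ ^ 2 * (p θ - k) := by
  have h1 : HasDerivAt (fun s : ℝ => (1 - s : ℂ)) (-1) s :=
    (Complex.ofRealCLM.hasDerivAt (x := s)).const_sub 1
  have hf := hasDerivAt_straighten_fst (h0 s hs θ)
  have h := (((h1.fun_pow 2).mul_const (deriv p θ ^ 2)).fun_mul (hf.fun_pow 3)).fun_sub hf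
  have h' := h.hasDerivWithinAt.derivWithin (uniqueDiffOn_Icc_zero_one s hs)
  refine h'.trans ?_
  rw [deriv_straighten hp (h0 s hs θ)]
  push_cast
  ring

/-- Repeated integration by parts removes `G`; the remaining density is exactly `-1/2` times the
`s`-derivative of `schwarzDensity`. -/
theorem coef_cocycle_straighten (hp : IsSmoothPeriodic p) (hG : ∀ θ, HasDerivAt G (p θ - k) θ)
    (hGs : IsSmoothPeriodic G) (h0 : ∀ s ∈ Icc (0 : ℝ) 1, ∀ θ, (1 - s) * p θ + s * k ≠ 0) {s : ℝ}
    (hs : s ∈ Icc (0 : ℝ) 1) : coef (fun θ =>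
      (deriv (deriv (deriv fun θ => straighten p k s θ * G θ)) θ +
        deriv (fun θ => straighten p k s θ * G θ) θ) * straighten p k s θ) 0 =
      -(1 / 2) * coef (fun θ => derivWithin (fun s => schwarzDensity p k s θ) (Icc 0 1) s) 0 := by
  have hf := (isSmoothCylinderFun_straighten hp h0).slice hs
  have hE := (isSmoothCylinderFun_schwarzDensity hp h0).deriv_fst.slice hs
  set f := straighten p k s with hfdef
  set X : ℝ → ℂ := fun θ => f θ * G θ with hXdef
  have hX : IsSmoothPeriodic X := hf.mul hGs
  have hX1 : ∀ θ, deriv X θ = deriv f θ * G θ + f θ * (p θ - k) := fun θ =>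
    ((hf.hasDerivAt θ).fun_mul (hG θ)).deriv
  have hg := hp.sub (.const k)
  -- `Φ` collects the boundary terms of these integrations by parts. It is periodic, so its
  -- derivative has mean zero.
  set Φ : ℝ → ℂ := fun θ => deriv (deriv X) θ * f θ - deriv X θ * deriv f θ +
    (1 / 2) * (deriv f θ * deriv f θ * G θ) + f θ * (p θ - k) * deriv f θ +
    (1 / 2) * (f θ * f θ * G θ) with hΦdef
  have hΦ : IsSmoothPeriodic Φ :=
    ((((hX.deriv.deriv.mul hf).sub (hX.deriv.mul hf.deriv)).add
      (((hf.deriv.mul hf.deriv).mul hGs).const_mul _)).add ((hf.mul hg).mul hf.deriv)).add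
      (((hf.mul hf).mul hGs).const_mul _)
  have hdΦ : ∀ θ, (deriv (deriv (deriv X)) θ + deriv X θ) * f θ = deriv Φ θ +
      (-(1 / 2)) * derivWithin (fun s => schwarzDensity p k s θ) (Icc 0 1) s := fun θ => by
    have e1 := hX.deriv.hasDerivAt θ
    have e2 := hX.deriv.deriv.hasDerivAt θ
    have e3 := hf.hasDerivAt θ
    have e4 := hf.deriv.hasDerivAt θ
    have e5 := (hp.hasDerivAt θ).sub_const k
    have h : HasDerivAt Φ _ θ := (((((e2.fun_mul e3).fun_sub (e1.fun_mul e4)).fun_add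
      (((e4.fun_mul e4).fun_mul (hG θ)).const_mul (1 / 2))).fun_add
      ((e3.fun_mul e5).fun_mul e4)).fun_add (((e3.fun_mul e3).fun_mul (hG θ)).const_mul (1 / 2)))
    rw [h.deriv, derivWithin_schwarzDensity hp h0 hs, ← hfdef, hX1]
    ring
  rw [coef_congr hdΦ, coef_add hΦ.deriv.continuous (hE.const_mul _).continuous, hΦ.coef_deriv,
    coef_const_mul, Int.cast_zero, mul_zero, zero_mul, zero_add]

theorem integral_virasoroCocycle_straighten (hp : IsSmoothPeriodic p)
    (hG : ∀ θ, HasDerivAt G (p θ - k) θ) (hGs : IsSmoothPeriodic G)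
    (h0 : ∀ s ∈ Icc (0 : ℝ) 1, ∀ θ, (1 - s) * p θ + s * k ≠ 0) (c : ℝ) :
    ∫ s in (0 : ℝ)..1, virasoroCocycle c (fun θ => straighten p k s θ * G θ) (straighten p k s) =
      (c / 24 * Complex.I : ℂ) *
        (coef (schwarzDensity p k 1) 0 - coef (schwarzDensity p k 0) 0) := by
  have h1 : ∀ s ∈ uIcc (0 : ℝ) 1, virasoroCocycle c (fun θ => straighten p k s θ * G θ)
      (straighten p k s) = (c / 24 * Complex.I : ℂ) * coef (fun θ =>
        derivWithin (fun s => schwarzDensity p k s θ) (Icc 0 1) s) 0 := fun s hs => by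
    rw [uIcc_of_le zero_le_one] at hs
    rw [(((isSmoothCylinderFun_straighten hp h0).slice hs).mul hGs).virasoroCocycle_eq,
      coef_cocycle_straighten hp hG hGs h0 hs]
    ring
  rw [intervalIntegral.integral_congr h1, intervalIntegral.integral_const_mul,
    (isSmoothCylinderFun_schwarzDensity hp h0).coef_eq_add_integral 0 ⟨zero_le_one, le_rfl⟩,
    add_sub_cancel_left]

end Straighten

/-! ### Semiboundedness of the energy density -/

section Real

variable {v : ℝ → ℝ}

/-- Nonnegativity at `θ + t` for `t = -v'/(2M)`, together with `v(θ + t) ≤ v + v' t + M t²`, forces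
the bound. The mean value inequality gives `M t²` rather than `M t²/2`, whence the constant `4`. -/
theorem sq_deriv_le (hv : ContDiff ℝ ∞ v) (h0 : ∀ θ, 0 ≤ v θ) {M : ℝ} (hM : 0 < M)
    (hb : ∀ θ, |deriv (deriv v) θ| ≤ M) (θ : ℝ) : deriv v θ ^ 2 ≤ 4 * M * v θ := by
  have hv' := (contDiff_infty_iff_deriv.1 hv)
  have hv'' := (contDiff_infty_iff_deriv.1 hv'.2)
  set d := deriv v θ with hd
  set t := -d / (2 * M) with ht
  have h1 : ∀ x ∈ uIcc θ (θ + t), ‖deriv v x - d‖ ≤ M * |t| := fun x hx => by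
    have h := convex_univ.norm_image_sub_le_of_norm_deriv_le (f := deriv v) (C := M)
      (fun x _ => hv''.1 x) (fun x _ => hb x) (mem_univ θ) (mem_univ x)
    refine h.trans ?_
    gcongr
    have := abs_sub_left_of_mem_uIcc hx
    rwa [add_sub_cancel_left] at this
  have h2 := (convex_uIcc θ (θ + t)).norm_image_sub_le_of_norm_hasDerivWithin_le
    (f := fun x => v x - d * x) (f' := fun x => deriv v x - d)
    (fun x _ => by
      simpa using ((hv'.1 x).hasDerivAt.fun_sub ((hasDerivAt_id x).const_mul d)).hasDerivWithinAt)
    h1 left_mem_uIcc right_mem_uIcc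
  have h3 : v (θ + t) - v θ - d * t ≤ M * t ^ 2 := by
    rw [add_sub_cancel_left, Real.norm_eq_abs, Real.norm_eq_abs, mul_assoc, ← sq, sq_abs] at h2
    refine le_trans (le_of_eq ?_) ((le_abs_self _).trans h2)
    ring
  have h4 : d * t + M * t ^ 2 = -(d ^ 2 / (4 * M)) := by
    rw [ht]
    field_simp
    ring
  have h5 : d ^ 2 / (4 * M) ≤ v θ := by linarith [h0 (θ + t)]
  rw [div_le_iff₀ (by positivity)] at h5
  linarith

theorem isSmoothPeriodic_ofReal (hv : ContDiff ℝ ∞ v) (hp : Function.Periodic v (2 * Real.pi)) :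
    IsSmoothPeriodic fun θ => (v θ : ℂ) :=
  ⟨Complex.ofRealCLM.contDiff.comp hv, fun θ => by rw [hp θ]⟩

/-- A primitive of a periodic function with vanishing mean. -/
theorem exists_periodic_primitive (hv : ContDiff ℝ ∞ v) (hp : Function.Periodic v (2 * Real.pi))
    (hm : ∫ θ in (0 : ℝ)..(2 * Real.pi), v θ = 0) :
    ∃ G : ℝ → ℝ, ContDiff ℝ ∞ G ∧ Function.Periodic G (2 * Real.pi) ∧
      ∀ θ, HasDerivAt G (v θ) θ := by
  have hd : ∀ θ, HasDerivAt (fun θ => ∫ x in (0 : ℝ)..θ, v x) (v θ) θ := fun θ =>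
    (hv.continuous.integral_hasStrictDerivAt 0 θ).hasDerivAt
  refine ⟨fun θ => ∫ x in (0 : ℝ)..θ, v x, ?_, fun θ => ?_, hd⟩
  · rw [contDiff_infty_iff_deriv, funext fun θ => (hd θ).deriv]
    exact ⟨fun θ => (hd θ).differentiableAt, hv⟩
  · have h := hp.intervalIntegral_add_eq θ 0
    rw [zero_add, hm] at h
    simp only
    rw [← intervalIntegral.integral_add_adjacent_intervals
      (hv.continuous.intervalIntegrable 0 θ) (hv.continuous.intervalIntegrable θ _), h, add_zero]

end Real

namespace PosEnergyRep

variable {c : ℝ} {H : Type*} [NormedAddCommGroup H] [InnerProductSpace ℂ H] [CompleteSpace H]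
  {ρ : PosEnergyRep c H}

theorem re_inner_L_zero_nonneg (v : ρ.W) : 0 ≤ (inner ℂ v (ρ.L 0 v)).re := by
  by_contra! h
  set x := (inner ℂ v (ρ.L 0 v)).re with hx
  have h1 : ∀ b : ℝ, 0 ≤ b → 0 ≤ 2 * b * x + ‖ρ.L 0 v‖ ^ 2 := fun b hb => by
    have h2 := pow_le_pow_left₀ (by positivity) (norm_le_add_L_zero (ρ := ρ) hb v) 2
    rw [@norm_add_sq ℂ, inner_smul_left, Complex.conj_ofReal, norm_smul, Complex.norm_real,
      Real.norm_of_nonneg hb] at h2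
    have h3 : RCLike.re ((b : ℂ) * inner ℂ v (ρ.L 0 v)) = b * x := by simp [hx]
    rw [h3] at h2
    linarith
  -- The inequality is affine in `b`; if `x < 0`, this value of `b` makes its right-hand side equal
  -- to `-1`.
  have h4 := h1 ((‖ρ.L 0 v‖ ^ 2 + 1) / (-(2 * x))) (by
    have : 0 < -(2 * x) := by linarith
    positivity)
  have h5 : 2 * ((‖ρ.L 0 v‖ ^ 2 + 1) / (-(2 * x))) * x = -(‖ρ.L 0 v‖ ^ 2 + 1) := by
    have := h.ne
    field_simp
  linarith

theorem re_inner_one_sub_R_nonneg (y : H) : 0 ≤ (inner ℂ ((1 - ρ.R) y) (ρ.R y)).re := by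
  have hd : DenseRange (fun w : ρ.W => (w : H)) := by simpa [DenseRange] using ρ.dense
  refine hd.induction_on (p := fun y => 0 ≤ (inner ℂ ((1 - ρ.R) y) (ρ.R y)).re) y
    (isClosed_le continuous_const (by fun_prop)) fun w => ?_
  obtain ⟨w, rfl⟩ := (addL0_bijective (ρ := ρ) one_pos).2 w
  have h := re_inner_L_zero_nonneg (ρ := ρ) w
  rw [sub_apply, R_addL0, ← inner_conj_symm, Complex.conj_re]
  simpa [addL0_apply] using! h

/-- Let `k` be the mean of `1/v`. The real path `X = f G`, with `G' = 1/v - k`, has an isometric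
evolution `T`, and the Segal relation reads `T π(v) = (i/k) L₀ T + κ T`. Taking expectations and
multiplying by `i` leaves `-k⁻¹ ⟨L₀ Tξ, Tξ⟩`, which is nonpositive, and a term bounded by `|κ|
‖ξ‖²`. -/
theorem re_inner_op_I_mul_le_of_pos (hc : 0 ≤ c) {v : ℝ → ℝ} (hv : ContDiff ℝ ∞ v)
    (hvp : Function.Periodic v (2 * Real.pi)) (hpos : ∀ θ, 0 < v θ) {M : ℝ} (hM : 0 < M)
    (hvM : ∀ θ, v θ ≤ M) (hb : ∀ θ, |deriv (deriv v) θ| ≤ M) (z : H) :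
    (inner ℂ (ρ.op (fun θ => Complex.I * v θ) z) (ρ.R z)).re ≤ c / 4 * M * ‖ρ.R z‖ ^ 2 := by
  have hpi := Real.two_pi_pos
  have hw := isSmoothPeriodic_ofReal hv hvp
  have hui : ContDiff ℝ ∞ fun θ => (v θ)⁻¹ := hv.inv fun θ => (hpos θ).ne'
  have hup : Function.Periodic (fun θ => (v θ)⁻¹) (2 * Real.pi) := fun θ => by simp only [hvp θ]
  set k : ℝ := (2 * Real.pi)⁻¹ * ∫ θ in (0 : ℝ)..(2 * Real.pi), (v θ)⁻¹ with hk
  have hkM : M⁻¹ ≤ k := by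
    have h := intervalIntegral.integral_mono_on hpi.le
      (intervalIntegrable_const (c := M⁻¹) (μ := MeasureTheory.volume))
      (hui.continuous.intervalIntegrable _ _) fun θ _ => inv_anti₀ (hpos θ) (hvM θ)
    rw [intervalIntegral.integral_const, sub_zero, smul_eq_mul] at h
    rwa [hk, inv_mul_eq_div, le_div_iff₀ hpi, mul_comm]
  have hk0 : 0 < k := (inv_pos.2 hM).trans_le hkM
  obtain ⟨G, hGs, hGp, hG⟩ := exists_periodic_primitive (hui.sub (contDiff_const (c := k)))
    (fun θ => by simp only [hvp θ]) (by
      rw [intervalIntegral.integral_sub (hui.continuous.intervalIntegrable _ _)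
        intervalIntegrable_const, intervalIntegral.integral_const, sub_zero, smul_eq_mul, hk]
      field_simp
      ring)
  set p : ℝ → ℂ := fun θ => ((v θ)⁻¹ : ℝ) with hp
  have hps : IsSmoothPeriodic p := isSmoothPeriodic_ofReal hui hup
  have hGs' : IsSmoothPeriodic fun θ => (G θ : ℂ) := isSmoothPeriodic_ofReal hGs hGp
  have hG' : ∀ θ, HasDerivAt (fun θ => (G θ : ℂ)) (p θ - k) θ := fun θ => by
    simpa [hp] using (hG θ).ofReal_comp
  have hreal : ∀ s θ, straighten p k s θ = (((1 - s) * (v θ)⁻¹ + s * k)⁻¹ : ℝ) := fun s θ => by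
    simp [straighten, hp]
  have h0 : ∀ s ∈ Icc (0 : ℝ) 1, ∀ θ, (1 - s) * p θ + s * (k : ℂ) ≠ 0 := fun s hs θ => by
    have h1 : 0 < (1 - s) * (v θ)⁻¹ + s * k := by
      rcases hs.2.eq_or_lt with rfl | h
      · simpa
      · have := inv_pos.2 (hpos θ)
        have := mul_pos (sub_pos.2 h) this
        have := mul_nonneg hs.1 hk0.le
        linarith
    have h2 : ((1 - s) * p θ + s * (k : ℂ)) = (((1 - s) * (v θ)⁻¹ + s * k : ℝ) : ℂ) := by
      simp [hp]
    rw [h2]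
    exact_mod_cast h1.ne'
  set f := straighten p k with hf
  have hfs : IsSmoothCylinderFun f := isSmoothCylinderFun_straighten hps h0
  set X : ℝ → ℝ → ℂ := fun s θ => f s θ * G θ with hX
  have hXs : IsSmoothCylinderFun X := hfs.mul (.of_isSmoothPeriodic hGs')
  have hXr : ∀ s θ, (X s θ).im = 0 := fun s θ => by
    rw [hX]
    simp only [hreal, ← Complex.ofReal_mul, Complex.ofReal_im]
  have hskew : ∀ t ∈ Icc (0 : ℝ) 1, ∀ z, (inner ℂ (ρ.op (X t) z) (ρ.R z)).re = 0 :=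
    fun t ht z => re_inner_op_eq_zero hc (hXs.slice ht) (hXr t) z
  have ha : IsGenerator ρ.R (ρ.gen X) 0 := isGenerator_gen hc hXs le_rfl fun t ht z => by
    rw [hskew t ht z, zero_mul]
  set T := evol ρ.J ρ.K (ρ.gen X) 1 0 with hT
  set y := evol ρ.J ρ.K (shiftGen ρ.R (ρ.gen X)) 1 0 z with hy
  have htri : ((1 : ℝ), (0 : ℝ)) ∈ triangle := ⟨le_rfl, zero_le_one, le_rfl⟩
  have hnorm : ∀ x, ‖T x‖ = ‖x‖ := fun x => norm_evol_apply_eq cutoff ha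
    (fun t z => hskew _ (clamp_mem t) z) htri x
  have hinner : ∀ x x', inner ℂ (T x) (T x') = inner ℂ x x' :=
    LinearIsometry.inner_map_map (𝕜 := ℂ) ⟨T.toLinearMap, hnorm⟩
  have hTR : T (ρ.R z) = ρ.R y := evol_R cutoff ha htri z
  have hrel := evol_op (ρ := ρ) hc hXs ha hfs (solvesHoloEquation_straighten hps hG' h0) z
  rw [integral_virasoroCocycle_straighten hps hG' hGs' h0, ← hT, ← hy] at hrel
  have hf0 : f 0 = fun θ => (v θ : ℂ) := funext fun θ => by simp [hreal]
  have hf1 : f 1 = fun _ => ((k⁻¹ : ℝ) : ℂ) := funext fun θ => by simp [hreal]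
  have hM1 : ‖coef (schwarzDensity p k 1) 0‖ ≤ M := norm_coef_le (fun θ => by
    rw [schwarzDensity, ← hf, hf1, Complex.ofReal_one, sub_self]
    simp only [ne_eq, OfNat.ofNat_ne_zero, not_false_eq_true, zero_pow, zero_mul, zero_sub, norm_neg,
      Complex.norm_real, Real.norm_of_nonneg (inv_pos.2 hk0).le]
    exact inv_le_of_inv_le₀ hM hkM) 0
  -- At `s = 0` the density is `v'²/v - v`, between `-M` and `4M` however small `v` is. With the
  -- bound `M` at `s = 1` this gives `|κ| ≤ (c/24)(M + 5M) = c M / 4`.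
  have hM0 : ‖coef (schwarzDensity p k 0) 0‖ ≤ 5 * M := norm_coef_le (fun θ => by
    have hθ := hpos θ
    have hd : HasDerivAt p ((-deriv v θ / v θ ^ 2 : ℝ) : ℂ) θ :=
      (((contDiff_infty_iff_deriv.1 hv).1 θ).hasDerivAt.fun_inv hθ.ne').ofReal_comp
    have h1 : schwarzDensity p k 0 θ = ((deriv v θ ^ 2 / v θ - v θ : ℝ) : ℂ) := by
      rw [schwarzDensity, ← hf, hf0, hd.deriv]
      have : (v θ : ℂ) ≠ 0 := by exact_mod_cast hθ.ne'
      push_cast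
      field_simp
      ring
    have h2 : deriv v θ ^ 2 / v θ ≤ 4 * M := by
      rw [div_le_iff₀ hθ]
      exact sq_deriv_le hv (fun θ => (hpos θ).le) hM hb θ
    have h3 : 0 ≤ deriv v θ ^ 2 / v θ := by positivity
    rw [h1, Complex.norm_real, Real.norm_eq_abs, abs_le]
    constructor <;> linarith [hvM θ]) 0
  set κ : ℂ := c / 24 * Complex.I *
    (coef (schwarzDensity p k 1) 0 - coef (schwarzDensity p k 0) 0) with hκ
  have hκM : ‖κ‖ ≤ c / 4 * M := by
    have h1 : ‖(c / 24 : ℂ)‖ = c / 24 := by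
      rw [show (c / 24 : ℂ) = ((c / 24 : ℝ) : ℂ) by push_cast; rfl, Complex.norm_real,
        Real.norm_of_nonneg (by positivity)]
    rw [hκ, norm_mul, norm_mul, Complex.norm_I, mul_one, h1]
    calc c / 24 * _ ≤ c / 24 * (M + 5 * M) := by
          gcongr
          exact (norm_sub_le _ _).trans (add_le_add hM1 hM0)
      _ = _ := by ring
  have hmain : inner ℂ (ρ.op (f 0) z) (ρ.R z) =
      starRingEnd ℂ (Complex.I * (k⁻¹ : ℝ)) * inner ℂ ((1 - ρ.R) y) (ρ.R y) +
        starRingEnd ℂ κ * (‖ρ.R z‖ ^ 2 : ℝ) := by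
    rw [← hinner, hrel, inner_add_left, inner_smul_left, hinner, inner_self_eq_norm_sq_to_K, hTR,
      hf1, op_const hc, smul_apply, inner_smul_left]
    push_cast
    rfl
  have hfin : (inner ℂ (ρ.op (fun θ => Complex.I * v θ) z) (ρ.R z)).re =
      -(k⁻¹ * (inner ℂ ((1 - ρ.R) y) (ρ.R y)).re) - κ.im * ‖ρ.R z‖ ^ 2 := by
    rw [op_const_mul hc _ hw, ← hf0, smul_apply, inner_smul_left, hmain]
    generalize inner ℂ ((1 - ρ.R) y) (ρ.R y) = b
    generalize ‖ρ.R z‖ ^ 2 = r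
    simp [-Complex.ofReal_inv]
    ring
  rw [hfin]
  have h1 := mul_nonneg (inv_pos.2 hk0).le (re_inner_one_sub_R_nonneg (ρ := ρ) y)
  have h2 : -κ.im ≤ c / 4 * M := (neg_le_abs _).trans ((Complex.abs_im_le_norm κ).trans hκM)
  have h3 := mul_le_mul_of_nonneg_right h2 (sq_nonneg ‖ρ.R z‖)
  linarith

/-- Quantum energy inequality. -/
theorem re_inner_op_I_mul_le (hc : 0 ≤ c) {v : ℝ → ℝ} (hv : ContDiff ℝ ∞ v)
    (hvp : Function.Periodic v (2 * Real.pi)) (h0 : ∀ θ, 0 ≤ v θ) {M : ℝ} (hM : 0 ≤ M)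
    (hvM : ∀ θ, v θ ≤ M) (hb : ∀ θ, |deriv (deriv v) θ| ≤ M) (z : H) :
    (inner ℂ (ρ.op (fun θ => Complex.I * v θ) z) (ρ.R z)).re ≤ c / 4 * M * ‖ρ.R z‖ ^ 2 := by
  set x := (inner ℂ ((1 - ρ.R) z) (ρ.R z)).re with hx
  -- The strict case applies to `v + ε`. The added constant contributes only `-ε L₀`, and the bound
  -- stays finite as `ε → 0`.
  have h1 : ∀ ε : ℝ, 0 < ε → (inner ℂ (ρ.op (fun θ => Complex.I * v θ) z) (ρ.R z)).re - ε * x ≤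
      c / 4 * (M + ε) * ‖ρ.R z‖ ^ 2 := fun ε hε => by
    have h2 := re_inner_op_I_mul_le_of_pos (ρ := ρ) hc (v := fun θ => v θ + ε) (M := M + ε)
      (hv.add contDiff_const) (fun θ => by simp only [hvp θ])
      (fun θ => add_pos_of_nonneg_of_pos (h0 θ) hε) (by positivity)
      (fun θ => by linarith [hvM θ]) (fun θ => by
        simp only [deriv_add_const']
        linarith [hb θ]) z
    have h3 : (fun θ => Complex.I * ((v θ + ε : ℝ) : ℂ)) =
        fun θ => Complex.I * v θ + Complex.I * ε := funext fun θ => by push_cast; ring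
    rw [h3, op_add hc ((isSmoothPeriodic_ofReal hv hvp).const_mul _) (.const _), op_const hc,
      ← mul_assoc, Complex.I_mul_I, add_apply, smul_apply, inner_add_left, inner_smul_left] at h2
    rw [hx]
    generalize inner ℂ ((1 - ρ.R) z) (ρ.R z) = b at h2 ⊢
    simpa using h2
  have h4 : Tendsto (fun ε : ℝ => (inner ℂ (ρ.op (fun θ => Complex.I * v θ) z) (ρ.R z)).re - ε * x)
      (𝓝[>] 0) (𝓝 ((inner ℂ (ρ.op (fun θ => Complex.I * v θ) z) (ρ.R z)).re - 0 * x)) :=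
    ((by fun_prop : Continuous _).tendsto 0).mono_left nhdsWithin_le_nhds
  have h5 : Tendsto (fun ε : ℝ => c / 4 * (M + ε) * ‖ρ.R z‖ ^ 2) (𝓝[>] 0)
      (𝓝 (c / 4 * (M + 0) * ‖ρ.R z‖ ^ 2)) :=
    ((by fun_prop : Continuous _).tendsto 0).mono_left nhdsWithin_le_nhds
  have h6 := le_of_tendsto_of_tendsto h4 h5 (eventually_mem_nhdsWithin.mono h1)
  simpa using h6

end PosEnergyRep

/-! ### Inward pointing vector fields -/

theorem IsSmoothPeriodic.deriv_im {f : ℝ → ℂ} (hf : IsSmoothPeriodic f) :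
    _root_.deriv (fun θ => (f θ).im) = fun θ => (_root_.deriv f θ).im :=
  funext fun θ => (Complex.imCLM.hasFDerivAt.comp_hasDerivAt θ (hf.hasDerivAt θ)).deriv

namespace PosEnergyRep

variable {c : ℝ} {H : Type*} [NormedAddCommGroup H] [InnerProductSpace ℂ H] [CompleteSpace H]
  {ρ : PosEnergyRep c H}

/-- Inward pointing vector fields act by quasi-dissipative operators. -/
theorem re_inner_op_le (hc : 0 ≤ c) {f : ℝ → ℂ} (hf : IsSmoothPeriodic f)
    (him : ∀ θ, 0 ≤ (f θ).im) {M : ℝ} (hM : ∀ θ, ‖f θ‖ ≤ M)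
    (hM' : ∀ θ, ‖deriv (deriv f) θ‖ ≤ M) (z : H) :
    (inner ℂ (ρ.op f z) (ρ.R z)).re ≤ c / 4 * M * ‖ρ.R z‖ ^ 2 := by
  have hre := isSmoothPeriodic_ofReal (v := fun θ => (f θ).re)
    (Complex.reCLM.contDiff.comp hf.smooth) fun θ => by simp only [hf.periodic θ]
  have hi : ContDiff ℝ ∞ fun θ => (f θ).im := Complex.imCLM.contDiff.comp hf.smooth
  have hip : Function.Periodic (fun θ => (f θ).im) (2 * Real.pi) := fun θ => by
    simp only [hf.periodic θ]
  have e : f = fun θ => ((f θ).re : ℂ) + Complex.I * (f θ).im := funext fun θ => by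
    rw [mul_comm, Complex.re_add_im]
  have h1 := re_inner_op_eq_zero (ρ := ρ) hc hre (fun θ => Complex.ofReal_im _) z
  have h2 := re_inner_op_I_mul_le (ρ := ρ) hc hi hip him ((norm_nonneg _).trans (hM 0))
    (fun θ => (le_abs_self _).trans ((Complex.abs_im_le_norm _).trans (hM θ))) (fun θ => by
      rw [hf.deriv_im, hf.deriv.deriv_im]
      exact (Complex.abs_im_le_norm _).trans (hM' θ)) z
  rw [e, op_add hc hre ((isSmoothPeriodic_ofReal hi hip).const_mul _), add_apply, inner_add_left,
    Complex.add_re, h1, zero_add]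
  exact h2

/-- Compactness of the cylinder bounds `X` and `∂_θ² X` uniformly in `t`, so one constant `ν` serves
all times. -/
theorem exists_isGenerator_gen (hc : 0 ≤ c) {X : ℝ → ℝ → ℂ} (hX : IsInwardPath X) :
    ∃ ν, IsGenerator ρ.R (ρ.gen X) ν := by
  have hXs := hX.toIsSmoothCylinderFun
  obtain ⟨M, hM0, hM⟩ := hXs.exists_bound
  obtain ⟨M', hM0', hM'⟩ := hXs.deriv_snd.deriv_snd.exists_bound
  refine ⟨c / 4 * (M + M'), isGenerator_gen hc hXs (by positivity) fun t ht z => ?_⟩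
  exact re_inner_op_le hc (hXs.slice ht) (hX.inward t ht)
    (fun θ => (hM t ht θ).trans (by linarith)) (fun θ => (hM' t ht θ).trans (by linarith)) z

theorem segalCommutationRelations_evol (hc : 0 ≤ c) {X : ℝ → ℝ → ℂ} (hX : IsSmoothCylinderFun X)
    {ν : ℝ} (ha : IsGenerator ρ.R (ρ.gen X) ν) :
    ρ.SegalCommutationRelations X (evol ρ.J ρ.K (ρ.gen X) 1 0) := by
  intro f hf hXf ξ hξ
  obtain ⟨z, hz⟩ := LinearPMap.mem_domain_iff.1 hξ
  obtain rfl := (mem_graph_oneAddL0 _ _).1 hz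
  refine ⟨ρ.op (f 0) z, ρ.op (f 1) (evol ρ.J ρ.K (shiftGen ρ.R (ρ.gen X)) 1 0 z),
    mem_graph_smeared hc (hf.slice ⟨le_rfl, zero_le_one⟩) z, ?_, evol_op hc hX ha hf hXf z⟩
  rw [evol_R cutoff ha ⟨le_rfl, zero_le_one, le_rfl⟩]
  exact mem_graph_smeared hc (hf.slice ⟨zero_le_one, le_rfl⟩) _

end PosEnergyRep

end SegalVirasoro

end

theorem mainTheorem4 {c : ℝ} (hc : 0 ≤ c)
    {H : Type*} [NormedAddCommGroup H] [InnerProductSpace ℂ H] [CompleteSpace H]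
    (ρ : SegalVirasoro.PosEnergyRep c H)
    (X : ℝ → ℝ → ℂ) (hX : SegalVirasoro.IsInwardPath X) :
    ∃ U : ℝ → ℝ → H →L[ℂ] H,
      ρ.IsTimeOrderedExpOf X U ∧
      (∀ U' : ℝ → ℝ → H →L[ℂ] H, ρ.IsTimeOrderedExpOf X U' →
        ∀ s t : ℝ, 0 ≤ s → s ≤ t → t ≤ 1 → U' t s = U t s) ∧
      ρ.SegalCommutationRelations X (U 1 0) := by
  obtain ⟨ν, ha⟩ := SegalVirasoro.PosEnergyRep.exists_isGenerator_gen (ρ := ρ) hc hX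
  have hU := SegalVirasoro.PosEnergyRep.isTimeOrderedExpOf_evol hc hX.toIsSmoothCylinderFun ha
  exact ⟨_, hU, fun U' hU' s t hs hst ht =>
    SegalVirasoro.IsTimeOrderedExp.unique SegalVirasoro.PosEnergyRep.dense_domain_oneAddL0 hU hU'
      hs hst ht,
    SegalVirasoro.PosEnergyRep.segalCommutationRelations_evol hc hX.toIsSmoothCylinderFun ha⟩
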